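/- Let $\mathbb{F}_q$ be a finite field. For $n\ge 0$ write $\mathcal G_n=\mathfrak{gl}_n(\mathbb{F}_q)$, $G_n=\mathrm{GL}_n(\mathbb{F}_q)$, and let $C(\mathcal G_n)$ be the complex vector space of functions $f:\mathcal G_n\to\mathbb{C}$ with $f(gxg^{-1})=f(x)$ for all $g\in G_n$, $x\in\mathcal G_n$ (so $C(\mathcal G_0)=\mathbb{C}$). For a rational parabolic subgroup $P$ of $\mathrm{GL}_n$ with unipotent radical $U_P$ and a rational Levi subgroup $L$ of $P$, with Lie algebras $\mathcal P=\mathcal L\oplus\mathcal U_P$ (all taken over $\mathbb{F}_q$) and projection $\pi_{\mathcal L}:\mathcal P\to\mathcal L$, Harish-Chandra restriction and induction are $${}^*R_{\mathcal L}(f)(x)=\frac1{|U_P|}\sum_{y\in\mathcal U_P}f(x+y)\quad(x\in\mathcal L),\qquad R_{\mathcal L}(f)(x)=\frac1{|P|}\sum_{g\in G_n,\ gxg^{-1}\in\mathcal P}f(\pi_{\mathcal L}(gxg^{-1}))\quad(x\in\mathcal G_n).$$ They depend only on $\mathcal L$ and not on $P$. For $k,l\ge 1$ let $R^{k+l}_{k,l}$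 be the induction from the block-diagonal subalgebra $\mathcal G_k\times\mathcal G_l\subseteq\mathcal G_{k+l}$, and $(f_1\boxtimes f_2)(x_1,x_2)=f_1(x_1)f_2(x_2)$. A function $f\in C(\mathcal G_n)$ is pre-cuspidal if ${}^*R_{\mathcal L}(f)=0$ for every rational Levi subgroup of every rational proper parabolic subgroup of $\mathrm{GL}_n$. The duality operation is the linear endomorphism of $C(\mathcal G_n)$ $$\mathcal D_n=\sum_{P\supseteq B}(-1)^{r(P)}R_{\mathcal L_P}\circ{}^*R_{\mathcal L_P},$$ where $B$ is a fixed (arbitrary) rational Borel subgroup, $P$ runs over the rational parabolic subgroups containing $B$, $\mathcal L_P$ is the Lie algebra of an arbitrary rational Levi subgroup of $P$, and $r(P)$ is the semisimple $\mathbb{F}_q$-rank of $P$ (equal to $n$ minus the number of blocks of $P$); $\mathcal D_0=\mathrm{id}$. It does not depend on the choices. Proposition. Let $m$ be a positive integer. There is a unique family $\mathbb D_0,\dots,\mathbb D_m$, with $\mathbb D_n$ a linear endomorphism of $C(\mathcal G_n)$, such that (i) $\mathbb D_0=\mathrm{id}$, and $$\mathbb D_{n_1+n_2}\bigl(R^{n_1+n_2}_{n_1,n_2}(f_1\boxtimes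 f_2)\bigr)=R^{n_1+n_2}_{n_1,n_2}\bigl(\mathbb D_{n_1}(f_1)\boxtimes\mathbb D_{n_2}(f_2)\bigr)$$ for all positive integers $n_1,n_2$ with $n_1+n_2\le m$ and all $f_i\in C(\mathcal G_{n_i})$; (ii) $\mathbb D_n(f)=(-1)^{n-1}f$ for every $n\in\{1,\dots,m\}$ and every pre-cuspidal $f\in C(\mathcal G_n)$. Moreover $\mathbb D_n=\mathcal D_n$ for every $n\in\{0,1,\dots,m\}$, for any choice of $B$ and of the Levi subgroups in the definition of $\mathcal D_n$. -/

import Mathlib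

/-- `InvFun 𝔽 n` is the complex vector space `C(𝔤𝔩ₙ(𝔽))` of invariant functions: functions
`f : 𝔤𝔩ₙ(𝔽) → ℂ` with `f (g x g⁻¹) = f x` for all `g ∈ GLₙ(𝔽)`. -/
def InvFun (𝔽 : Type*) [Field 𝔽] (n : ℕ) : Submodule ℂ (Matrix (Fin n) (Fin n) 𝔽 → ℂ) where
  carrier := {f | ∀ (g : GL (Fin n) 𝔽) (x : Matrix (Fin n) (Fin n) 𝔽),
    f (g.val * x * g⁻¹.val) = f x}
  zero_mem' := fun _ _ => rfl
  add_mem' := fun {a b} ha hb g x => by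
    simp only [Pi.add_apply]
    rw [ha g x, hb g x]
  smul_mem' := fun c a ha g x => by
    simp only [Pi.smul_apply]
    rw [ha g x]

/-- A rational parabolic subgroup `P` of `GLₙ` over `𝔽` together with a rational Levi subgroup
`L` of `P`. Such a pair is the same as an ordered direct sum decomposition
`𝔽ⁿ = V₀ ⊕ ⋯ ⊕ V_{r-1}`: `P` is the stabiliser of the flag `V₀ ⊆ V₀ ⊕ V₁ ⊆ ⋯`, and `L` is the
stabiliser of all the `Vᵢ`. The decomposition is recorded by the projections `eᵢ` onto `Vᵢ`
along the other summands, i.e. by a complete family of orthogonal idempotent matrices.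
(Zero summands are allowed; they change neither `P` nor `L`.) -/
structure ParabolicPair (𝔽 : Type*) [Field 𝔽] (n : ℕ) where
  /-- the number of summands -/
  r : ℕ
  /-- the projections onto the summands -/
  e : Fin r → Matrix (Fin n) (Fin n) 𝔽
  /-- they form a complete family of orthogonal idempotents -/
  idem : CompleteOrthogonalIdempotents e

namespace ParabolicPair

variable {𝔽 : Type*} [Field 𝔽] {n : ℕ}

/-- The Lie algebra `𝓟` of `P`: the matrices that map each `Vᵢ` into `V₀ ⊕ ⋯ ⊕ Vᵢ`. -/
def lieP (Q : ParabolicPair 𝔽 n) : Subalgebra 𝔽 (Matrix (Fin n) (Fin n) 𝔽) where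
  carrier := {A | ∀ i j, i < j → Q.e j * A * Q.e i = 0}
  mul_mem' := fun {A B} hA hB i j hij => by
    have h : Q.e j * (A * B) * Q.e i = ∑ k, (Q.e j * A * Q.e k) * (Q.e k * B * Q.e i) := by
      calc Q.e j * (A * B) * Q.e i = Q.e j * A * (∑ k, Q.e k) * (B * Q.e i) := by
            rw [Q.idem.complete]; simp only [mul_one, mul_assoc]
        _ = ∑ k, Q.e j * A * Q.e k * (B * Q.e i) := by
            rw [Finset.mul_sum, Finset.sum_mul]
        _ = _ := by
            refine Finset.sum_congr rfl fun k _ => ?_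
            have hk : Q.e k * Q.e k = Q.e k := Q.idem.idem k
            calc Q.e j * A * Q.e k * (B * Q.e i) = Q.e j * A * (Q.e k * Q.e k) * (B * Q.e i) := by
                  rw [hk]
              _ = _ := by simp only [mul_assoc]
    rw [h]
    refine Finset.sum_eq_zero fun k _ => ?_
    rcases lt_or_ge k j with hk | hk
    · rw [hA k j hk, zero_mul]
    · rw [hB i k (lt_of_lt_of_le hij hk), mul_zero]
  add_mem' := fun {A B} hA hB i j hij => by
    rw [mul_add, add_mul, hA i j hij, hB i j hij, add_zero]
  algebraMap_mem' := fun c i j hij => by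
    rw [← Algebra.commutes, mul_assoc, Q.idem.ortho hij.ne', mul_zero]

/-- The Lie algebra `𝓤` of the unipotent radical of `P`: the matrices that map each `Vᵢ` into
`V₀ ⊕ ⋯ ⊕ Vᵢ₋₁`. -/
def lieU (Q : ParabolicPair 𝔽 n) : Submodule 𝔽 (Matrix (Fin n) (Fin n) 𝔽) where
  carrier := {A | ∀ i j, i ≤ j → Q.e j * A * Q.e i = 0}
  zero_mem' := fun i j _ => by rw [mul_zero, zero_mul]
  add_mem' := fun {A B} hA hB i j hij => by
    rw [mul_add, add_mul, hA i j hij, hB i j hij, add_zero]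
  smul_mem' := fun c A hA i j hij => by
    rw [Matrix.mul_smul, Matrix.smul_mul, hA i j hij, smul_zero]

/-- The Lie algebra `𝓛` of `L`: the matrices that map each `Vᵢ` into itself. -/
def lieL (Q : ParabolicPair 𝔽 n) : Submodule 𝔽 (Matrix (Fin n) (Fin n) 𝔽) where
  carrier := {A | ∀ i j, i ≠ j → Q.e j * A * Q.e i = 0}
  zero_mem' := fun i j _ => by rw [mul_zero, zero_mul]
  add_mem' := fun {A B} hA hB i j hij => by
    rw [mul_add, add_mul, hA i j hij, hB i j hij, add_zero]
  smul_mem' := fun c A hA i j hij => by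
    rw [Matrix.mul_smul, Matrix.smul_mul, hA i j hij, smul_zero]

/-- The group of rational points of `P`, the invertible elements of `𝓟`. -/
def grpP (Q : ParabolicPair 𝔽 n) : Subgroup (GL (Fin n) 𝔽) :=
  Q.lieP.toSubmonoid.units

/-- The set of rational points of the unipotent radical of `P`. -/
def grpU (Q : ParabolicPair 𝔽 n) : Set (GL (Fin n) 𝔽) :=
  {g | g.val - 1 ∈ Q.lieU}

/-- The block-diagonal part `∑ᵢ eᵢ A eᵢ` of a matrix. On `𝓟 = 𝓛 ⊕ 𝓤` this is the projection
`π_𝓛 : 𝓟 → 𝓛`. -/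
def proj (Q : ParabolicPair 𝔽 n) (A : Matrix (Fin n) (Fin n) 𝔽) : Q.lieL :=
  ⟨∑ k, Q.e k * A * Q.e k, fun i j hij => by
    rw [Finset.mul_sum, Finset.sum_mul]
    refine Finset.sum_eq_zero fun k _ => ?_
    by_cases hk : k = i
    · subst hk
      calc Q.e j * (Q.e k * A * Q.e k) * Q.e k = (Q.e j * Q.e k) * (A * Q.e k * Q.e k) := by
            simp only [mul_assoc]
        _ = 0 := by rw [Q.idem.ortho hij.symm, zero_mul]
    · rw [mul_assoc, mul_assoc (Q.e k * A), Q.idem.ortho hk, mul_zero, mul_zero]⟩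

/-- The semisimple rational rank `r(P)`, that is, the sum of `dim Vᵢ - 1` over the nonzero
summands (the truncated subtraction gives `0` for zero summands). -/
noncomputable def ssRank (Q : ParabolicPair 𝔽 n) : ℕ :=
  ∑ i, ((Q.e i).rank - 1)

/-- `P` is a Borel subgroup: the flag is complete, i.e. all summands are lines. -/
def IsBorel (Q : ParabolicPair 𝔽 n) : Prop :=
  ∀ i, (Q.e i).rank = 1

/-- `P` has type `c = (c₀, …, c_{r-1})`, a composition of `n`: there are `r` summands and
`dim Vᵢ = cᵢ`. -/
def HasType (Q : ParabolicPair 𝔽 n) (c : Composition n) : Prop :=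
  ∃ h : Q.r = c.length, ∀ i : Fin Q.r, (Q.e i).rank = c.blocksFun (Fin.cast h i)

/-- The standard pair attached to a labelling `b` of the coordinates: `Vᵢ` is spanned by the
standard basis vectors with label `i`. -/
def standard (𝔽 : Type*) [Field 𝔽] {n r : ℕ} (b : Fin n → Fin r) : ParabolicPair 𝔽 n where
  r := r
  e := fun i => Matrix.diagonal fun j => if b j = i then 1 else 0
  idem :=
    { idem := fun i => by
        simp [IsIdempotentElem, Matrix.diagonal_mul_diagonal]
      ortho := fun i j hij => by
        simp only [Matrix.diagonal_mul_diagonal]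
        rw [Matrix.diagonal_eq_zero]
        funext k
        by_cases h : b k = i
        · subst h; simp [hij]
        · simp [h]
      complete := by
        ext k l
        rw [Matrix.sum_apply]
        by_cases h : k = l
        · subst h; simp
        · simp [h] }

section HarishChandra

variable [Fintype 𝔽] [DecidableEq 𝔽]

open scoped Classical in
/-- Harish-Chandra restriction
`(*R f)(x) = |U_P|⁻¹ ∑_{y ∈ 𝓤} f (x + y)` for `x ∈ 𝓛`. -/
noncomputable def hcRes (Q : ParabolicPair 𝔽 n) : InvFun 𝔽 n →ₗ[ℂ] (Q.lieL → ℂ) where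
  toFun := fun f x => (Nat.card Q.grpU : ℂ)⁻¹ *
    ∑ y : Matrix (Fin n) (Fin n) 𝔽, if y ∈ Q.lieU then f.val (x.val + y) else 0
  map_add' := fun f g => by
    funext x
    simp only [Submodule.coe_add, Pi.add_apply, ← mul_add, ← Finset.sum_add_distrib]
    congr 1
    refine Finset.sum_congr rfl fun y _ => ?_
    split_ifs <;> simp
  map_smul' := fun c f => by
    funext x
    simp only [Submodule.coe_smul, Pi.smul_apply, smul_eq_mul, RingHom.id_apply]
    rw [mul_left_comm c]
    congr 1
    rw [Finset.mul_sum]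
    refine Finset.sum_congr rfl fun y _ => ?_
    split_ifs <;> simp

open scoped Classical in
/-- Harish-Chandra induction
`(R f)(x) = |P|⁻¹ ∑_{g ∈ GLₙ(𝔽), g x g⁻¹ ∈ 𝓟} f (π_𝓛 (g x g⁻¹))`, written for all functions
on `𝓛`; it is only used for `L`-invariant ones. -/
noncomputable def hcInd (Q : ParabolicPair 𝔽 n) : (Q.lieL → ℂ) →ₗ[ℂ] InvFun 𝔽 n where
  toFun := fun f => ⟨fun x => (Nat.card Q.grpP : ℂ)⁻¹ *
    ∑ g : GL (Fin n) 𝔽,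
      if g.val * x * g⁻¹.val ∈ Q.lieP then f (Q.proj (g.val * x * g⁻¹.val)) else 0, by
    intro h x
    simp only
    congr 1
    refine Fintype.sum_equiv (Equiv.mulRight h) _ _ fun g => ?_
    have e : g.val * (h.val * x * h⁻¹.val) * g⁻¹.val = (g * h).val * x * (g * h)⁻¹.val := by
      rw [mul_inv_rev]
      simp only [Units.val_mul, mul_assoc]
    rw [Equiv.coe_mulRight, e]⟩
  map_add' := fun f g => by
    apply Subtype.ext
    funext x
    simp only [Submodule.coe_add, Pi.add_apply, ← mul_add, ← Finset.sum_add_distrib]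
    congr 1
    refine Finset.sum_congr rfl fun y _ => ?_
    split_ifs <;> simp
  map_smul' := fun c f => by
    apply Subtype.ext
    funext x
    simp only [Submodule.coe_smul, Pi.smul_apply, smul_eq_mul, RingHom.id_apply]
    rw [mul_left_comm c]
    congr 1
    rw [Finset.mul_sum]
    refine Finset.sum_congr rfl fun y _ => ?_
    split_ifs <;> simp

end HarishChandra

end ParabolicPair

/-- The pair formed by the block upper triangular parabolic of `GL_{k+l}` with diagonal blocks of
sizes `k`, `l`, and its block-diagonal Levi subgroup `L_{k,l}`. -/
def blockPair (𝔽 : Type*) [Field 𝔽] (k l : ℕ) : ParabolicPair 𝔽 (k + l) :=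
  ParabolicPair.standard 𝔽 (Fin.addCases (fun _ : Fin k => (0 : Fin 2)) (fun _ : Fin l => 1))

/-- The function `f₁ ⊠ f₂` on `𝓛_{k,l} = 𝔤𝔩_k × 𝔤𝔩_l`: `f₁` of the first diagonal block times
`f₂` of the second one. -/
def boxProd {𝔽 : Type*} [Field 𝔽] {k l : ℕ} (f₁ : InvFun 𝔽 k) (f₂ : InvFun 𝔽 l) :
    (blockPair 𝔽 k l).lieL → ℂ :=
  fun x => f₁.val (x.val.submatrix (Fin.castAdd l) (Fin.castAdd l)) *
    f₂.val (x.val.submatrix (Fin.natAdd k) (Fin.natAdd k))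

/-- `R_{k,l}^{k+l} (f₁ ⊠ f₂)`. -/
noncomputable def hcProd {𝔽 : Type*} [Field 𝔽] [Fintype 𝔽] [DecidableEq 𝔽] {k l : ℕ}
    (f₁ : InvFun 𝔽 k) (f₂ : InvFun 𝔽 l) : InvFun 𝔽 (k + l) :=
  (blockPair 𝔽 k l).hcInd (boxProd f₁ f₂)

/-- `f` is pre-cuspidal: all Harish-Chandra restrictions of `f` to Levi subgroups of proper
parabolic subgroups vanish. -/
def IsPrecuspidal {𝔽 : Type*} [Field 𝔽] [Fintype 𝔽] [DecidableEq 𝔽] {n : ℕ}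
    (f : InvFun 𝔽 n) : Prop :=
  ∀ Q : ParabolicPair 𝔽 n, Q.grpP ≠ ⊤ → Q.hcRes f = 0

/-- The choices in the definition of the duality operation: a Borel subgroup `B`, and a Levi
subgroup for each of the parabolic subgroups containing `B` (there is exactly one such parabolic
subgroup of each type, the types being the compositions of `n`). -/
structure DualityChoice (𝔽 : Type*) [Field 𝔽] (n : ℕ) where
  /-- the Borel subgroup -/
  B : ParabolicPair 𝔽 n
  isBorel : B.IsBorel
  /-- the parabolic subgroup of type `c` containing `B`, with the chosen Levi subgroup -/
  P : Composition n → ParabolicPair 𝔽 n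
  hasType : ∀ c, (P c).HasType c
  le_P : ∀ c, B.grpP ≤ (P c).grpP

/-- Choices exist: upper triangular matrices and standard block subgroups. -/
instance (𝔽 : Type*) [Field 𝔽] (n : ℕ) : Nonempty (DualityChoice 𝔽 n) := by
  refine ⟨{ B := ParabolicPair.standard 𝔽 (id : Fin n → Fin n)
            isBorel := fun (i : Fin n) => ?_
            P := fun c => ParabolicPair.standard 𝔽 c.index
            hasType := fun c => ⟨rfl, fun (i : Fin c.length) => ?_⟩
            le_P := fun c => ?_ }⟩
  · change (Matrix.diagonal fun j : Fin n => if id j = i then (1 : 𝔽) else 0).rank = 1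
    classical
    rw [Matrix.rank_diagonal]
    simp
  · change (Matrix.diagonal fun j : Fin n => if c.index j = i then (1 : 𝔽) else 0).rank
      = c.blocksFun i
    classical
    rw [Matrix.rank_diagonal]
    have hx : ∀ j, (if c.index j = i then (1 : 𝔽) else 0) ≠ 0 ↔ j ∈ Set.range (c.embedding i) := by
      intro j
      rw [Composition.mem_range_embedding_iff']
      simp [eq_comm]
    simp only [hx]
    rw [Fintype.card_congr (Equiv.ofInjective _ (c.embedding i).injective).symm, Fintype.card_fin]
  · have key : ∀ A : Matrix (Fin n) (Fin n) 𝔽,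
        A ∈ (ParabolicPair.standard 𝔽 (id : Fin n → Fin n)).lieP →
        A ∈ (ParabolicPair.standard 𝔽 c.index).lieP := by
      intro A hA i j hij
      change Fin c.length at i j
      have hij' : i < j := hij
      ext k l
      change ((Matrix.diagonal fun t : Fin n => if c.index t = j then (1 : 𝔽) else 0) * A *
        (Matrix.diagonal fun t : Fin n => if c.index t = i then (1 : 𝔽) else 0)) k l = 0
      rw [Matrix.mul_diagonal, Matrix.diagonal_mul]
      by_cases h1 : c.index k = j
      · by_cases h2 : c.index l = i
        · have hlk : l < k := by
            have hs := c.lt_sizeUpTo_index_succ l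
            have ht := c.sizeUpTo_index_le k
            have hm : c.sizeUpTo (c.index l).succ ≤ c.sizeUpTo (c.index k) :=
              c.monotone_sizeUpTo (by rw [h1, h2]; simpa using hij')
            exact Fin.lt_def.mpr (lt_of_lt_of_le hs (hm.trans ht))
          have h0 : ((Matrix.diagonal fun t : Fin n => if id t = k then (1 : 𝔽) else 0) * A *
            (Matrix.diagonal fun t : Fin n => if id t = l then (1 : 𝔽) else 0)) k l = 0 :=
            congrFun (congrFun (hA l k hlk) k) l
          rw [Matrix.mul_diagonal, Matrix.diagonal_mul] at h0
          have h3 : A k l = 0 := by simpa using h0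
          rw [h3, mul_zero, zero_mul]
        · simp [h2]
      · simp [h1]
    intro g hg
    exact ⟨key _ hg.1, key _ hg.2⟩

/-- The duality operation `𝓓ₙ f = ∑_{P ⊇ B} (-1)^{r(P)} R_{𝓛_P} (*R_{𝓛_P} f)`. -/
noncomputable def duality {𝔽 : Type*} [Field 𝔽] [Fintype 𝔽] [DecidableEq 𝔽] {n : ℕ}
    (χ : DualityChoice 𝔽 n) : Module.End ℂ (InvFun 𝔽 n) :=
  ∑ c : Composition n, (-1 : ℂ) ^ (χ.P c).ssRank • ((χ.P c).hcInd ∘ₗ (χ.P c).hcRes)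

/-- The two conditions on a family `𝔻₀, …, 𝔻ₘ`: it is the identity in degree `0` and commutes
with Harish-Chandra inductions, and `𝔻ₙ` acts by `(-1)ⁿ⁻¹` on pre-cuspidal functions for
`1 ≤ n ≤ m`. -/
structure IsDualityFamily {𝔽 : Type*} [Field 𝔽] [Fintype 𝔽] [DecidableEq 𝔽] {m : ℕ}
    (D : (n : Fin (m + 1)) → Module.End ℂ (InvFun 𝔽 n.val)) : Prop where
  zero : D ⟨0, Nat.succ_pos m⟩ = LinearMap.id
  comm : ∀ (n₁ n₂ : ℕ) (_ : 0 < n₁) (_ : 0 < n₂) (h : n₁ + n₂ ≤ m)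
    (f₁ : InvFun 𝔽 n₁) (f₂ : InvFun 𝔽 n₂),
    D ⟨n₁ + n₂, by omega⟩ (hcProd f₁ f₂) =
      hcProd (D ⟨n₁, by omega⟩ f₁) (D ⟨n₂, by omega⟩ f₂)
  precuspidal : ∀ n : Fin (m + 1), 1 ≤ n.val → ∀ f : InvFun 𝔽 n.val, IsPrecuspidal f →
    D n f = (-1 : ℂ) ^ (n.val - 1) • f

universe u

attribute [local instance] Fintype.ofFinite

open scoped Classical in
/-- The average of a complex function over a finite type. -/
noncomputable def avg {α : Type*} [Finite α] (f : α → ℂ) : ℂ :=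
  letI := Fintype.ofFinite α
  (Nat.card α : ℂ)⁻¹ * ∑ a, f a

theorem avg_eq {α : Type*} [Fintype α] (f : α → ℂ) :
    avg f = (Nat.card α : ℂ)⁻¹ * ∑ a, f a := by
  unfold avg
  congr!

theorem avg_congr {α β : Type*} [Finite α] [Finite β] (e : α ≃ β) {f : α → ℂ} {g : β → ℂ}
    (h : ∀ a, f a = g (e a)) : avg f = avg g := by
  have := Fintype.ofFinite α
  have := Fintype.ofFinite β
  rw [avg_eq, avg_eq, Nat.card_congr e, Fintype.sum_equiv e f g h]

theorem avg_mul_left {α : Type*} [Finite α] (c : ℂ) (f : α → ℂ) :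
    avg (fun a => c * f a) = c * avg f := by
  have := Fintype.ofFinite α
  rw [avg_eq, avg_eq, ← Finset.mul_sum]; ring

theorem avg_mul_right {α : Type*} [Finite α] (c : ℂ) (f : α → ℂ) :
    avg (fun a => f a * c) = avg f * c := by
  have := Fintype.ofFinite α
  rw [avg_eq, avg_eq, ← Finset.sum_mul]; ring

theorem avg_add {α : Type*} [Finite α] (f g : α → ℂ) :
    avg (fun a => f a + g a) = avg f + avg g := by
  have := Fintype.ofFinite α
  simp only [avg_eq, Finset.sum_add_distrib]; ring

theorem avg_const {α : Type*} [Finite α] [Nonempty α] (c : ℂ) :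
    avg (fun _ : α => c) = c := by
  have := Fintype.ofFinite α
  rw [avg_eq]
  simp

theorem avg_prod {α β : Type*} [Finite α] [Finite β] (f : α × β → ℂ) :
    avg f = avg fun a => avg fun b => f (a, b) := by
  have := Fintype.ofFinite α
  have := Fintype.ofFinite β
  simp only [avg_eq, Nat.card_prod, Fintype.sum_prod_type, ← Finset.mul_sum, Nat.cast_mul,
    mul_inv, mul_assoc]

theorem avg_sum {α ι : Type*} [Finite α] (s : Finset ι) (f : ι → α → ℂ) :
    avg (fun a => ∑ i ∈ s, f i a) = ∑ i ∈ s, avg (f i) := by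
  have := Fintype.ofFinite α
  simp only [avg_eq]
  rw [Finset.sum_comm, Finset.mul_sum]

/-- Averages are preserved by composition with a surjective homomorphism of finite groups. -/
theorem avg_comp_surjective {K L : Type*} [AddGroup K] [AddGroup L] [Finite K] [Finite L]
    (φ : K →+ L) (hφ : Function.Surjective φ) (f : L → ℂ) :
    avg (fun k => f (φ k)) = avg f := by
  classical
  have := Fintype.ofFinite K
  have := Fintype.ofFinite L
  have hc : ∀ l : L, (Finset.univ.filter fun k => φ k = l).card = Nat.card φ.ker := by
    intro l
    obtain ⟨k₀, rfl⟩ := hφ l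
    rw [← Fintype.card_subtype, ← Nat.card_eq_fintype_card]
    refine Nat.card_congr ⟨fun k => ⟨k.1 - k₀, ?_⟩, fun k => ⟨k.1 + k₀, ?_⟩, ?_, ?_⟩
    · rw [AddMonoidHom.mem_ker, map_sub, k.2, sub_self]
    · have := k.2
      rw [AddMonoidHom.mem_ker] at this
      simp [this]
    · intro k; simp
    · intro k; simp
  have hs : ∑ k, f (φ k) = Nat.card φ.ker * ∑ l, f l := by
    rw [← Finset.sum_fiberwise' Finset.univ φ f, Finset.mul_sum]
    refine Finset.sum_congr rfl fun l _ => ?_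
    rw [Finset.sum_const, hc l, nsmul_eq_mul]
  have hcard : Nat.card K = Nat.card φ.ker * Nat.card L := by
    rw [Nat.card_eq_fintype_card (α := K), ← Finset.card_univ,
      Finset.card_eq_sum_card_fiberwise (f := φ) (t := Finset.univ) (by simp)]
    simp [hc, mul_comm]
  have h0 : (Nat.card φ.ker : ℂ) ≠ 0 := by
    exact_mod_cast Nat.card_pos.ne'
  rw [avg_eq, avg_eq, hs, hcard]
  push_cast
  field_simp

/-- If the fibres of `φ : G → X` are the right cosets of a subgroup `P`, summing over `G` is
`|P|` times summing over the image of `φ`. -/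
@[to_additive]
theorem sum_eq_card_mul_sum_image {G X : Type*} [Group G] [Fintype G] [DecidableEq X]
    (P : Subgroup G) (φ : G → X) (hφ : ∀ g h, φ g = φ h ↔ g * h⁻¹ ∈ P) (ξ : X → ℂ) :
    ∑ g, ξ (φ g) = Nat.card P * ∑ x ∈ Finset.univ.image φ, ξ x := by
  rw [← Finset.sum_fiberwise_of_maps_to' (g := φ) (t := Finset.univ.image φ)
    (fun g hg => Finset.mem_image_of_mem φ hg) ξ, Finset.mul_sum]
  refine Finset.sum_congr rfl fun x hx => ?_
  obtain ⟨h, -, rfl⟩ := Finset.mem_image.1 hx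
  rw [Finset.sum_const, nsmul_eq_mul]
  congr 2
  rw [← Fintype.card_subtype, ← Nat.card_eq_fintype_card]
  refine Nat.card_congr ⟨fun k => ⟨k.1 * h⁻¹, (hφ _ _).1 k.2⟩,
    fun k => ⟨k.1 * h, (hφ _ _).2 (by simp)⟩, ?_, ?_⟩
  · intro k; simp
  · intro k; simp
instance LinearMap.finite_of_finite {F V W : Type*} [Field F] [AddCommGroup V] [AddCommGroup W]
    [Module F V] [Module F W] [Finite V] [Finite W] : Finite (V →ₗ[F] W) :=
  DFunLike.finite _

instance Submodule.finite_quotient_of_finite {F V : Type*} [Field F] [AddCommGroup V]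
    [Module F V] [Finite V] (W : Submodule F V) : Finite (V ⧸ W) :=
  Finite.of_surjective _ W.mkQ_surjective

/-- A finite vector space with an endomorphism. -/
structure EndObj (F : Type u) [Field F] where
  /-- the vector space -/
  V : Type u
  [acg : AddCommGroup V]
  [mod : Module F V]
  [fin : Finite V]
  /-- the endomorphism -/
  x : V →ₗ[F] V

namespace EndObj

attribute [instance] acg mod fin

variable {F : Type u} [Field F]

/-- Isomorphism of vector spaces with endomorphism. -/
instance setoid (F : Type u) [Field F] : Setoid (EndObj F) where
  r M N := ∃ e : M.V ≃ₗ[F] N.V, ∀ v, e (M.x v) = N.x (e v)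
  iseqv :=
    { refl := fun M => ⟨LinearEquiv.refl F M.V, fun _ => rfl⟩
      symm := fun {M N} ⟨e, he⟩ => ⟨e.symm, fun v => e.injective (by simp [he])⟩
      trans := fun {M N L} ⟨e, he⟩ ⟨e', he'⟩ => ⟨e.trans e', fun v => by simp [he, he']⟩ }

end EndObj

/-- The isomorphism classes of finite vector spaces with endomorphism. -/
def IsoClass (F : Type u) [Field F] : Type (u + 1) := Quotient (EndObj.setoid F)

namespace EndObj

variable {F : Type u} [Field F]

/-- The isomorphism class of an object. -/
def cls (M : EndObj F) : IsoClass F := Quotient.mk _ M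

theorem cls_eq {M N : EndObj F} (e : M.V ≃ₗ[F] N.V) (he : ∀ v, e (M.x v) = N.x (e v)) :
    M.cls = N.cls :=
  Quotient.sound ⟨e, he⟩

theorem exists_of_cls_eq {M N : EndObj F} (h : M.cls = N.cls) :
    ∃ e : M.V ≃ₗ[F] N.V, ∀ v, e (M.x v) = N.x (e v) :=
  Quotient.exact h

theorem exists_cls_eq (c : IsoClass F) : ∃ M : EndObj F, M.cls = c :=
  Quotient.exists_rep c

/-- The stable subspaces. -/
@[ext]
structure Sub (M : EndObj F) where
  /-- the underlying subspace -/
  val : Submodule F M.V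
  stable : ∀ v ∈ val, M.x v ∈ val

instance (M : EndObj F) : Finite M.Sub :=
  Finite.of_injective Sub.val fun _ _ => Sub.ext

noncomputable instance (M : EndObj F) : Fintype M.Sub := Fintype.ofFinite _

/-- A stable subspace as an object. -/
abbrev sub (M : EndObj F) (W : M.Sub) : EndObj F := ⟨W.1, M.x.restrict W.2⟩

/-- The quotient by a stable subspace as an object. -/
abbrev quo (M : EndObj F) (W : M.Sub) : EndObj F := ⟨M.V ⧸ W.1, W.1.mapQ W.1 M.x W.2⟩

theorem cls_sub_eq {M N : EndObj F} (W : M.Sub) (i : N.V →ₗ[F] M.V) (hi : Function.Injective i)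
    (hr : i.range = W.1) (hx : ∀ v, i (N.x v) = M.x (i v)) : (M.sub W).cls = N.cls := by
  symm
  refine cls_eq ((LinearEquiv.ofInjective i hi).trans (LinearEquiv.ofEq _ _ hr)) fun v => ?_
  apply Subtype.ext
  exact hx v

theorem cls_quo_eq {M N : EndObj F} (W : M.Sub) (p : M.V →ₗ[F] N.V)
    (hp : Function.Surjective p) (hk : p.ker = W.1) (hx : ∀ v, p (M.x v) = N.x (p v)) :
    (M.quo W).cls = N.cls := by
  refine cls_eq ((Submodule.quotEquivOfEq _ _ hk.symm).trans (p.quotKerEquivOfSurjective hp))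
    fun v => ?_
  obtain ⟨v, rfl⟩ := Submodule.Quotient.mk_surjective _ v
  exact hx v

/-- The zero object. -/
abbrev zero (F : Type u) [Field F] : EndObj F := ⟨PUnit, 0⟩

/-- The extension of `B` by `A` with off-diagonal entry `y`. -/
abbrev ext (A B : EndObj F) (y : B.V →ₗ[F] A.V) : EndObj F :=
  ⟨A.V × B.V, (A.x.coprod y).prod (B.x ∘ₗ LinearMap.snd F A.V B.V)⟩

/-- Transport of stable subspaces along an isomorphism. -/
def subEquiv {M N : EndObj F} (e : M.V ≃ₗ[F] N.V) (he : ∀ v, e (M.x v) = N.x (e v)) :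
    M.Sub ≃ N.Sub where
  toFun W := ⟨W.1.map e.toLinearMap, by
    rintro _ ⟨v, hv, rfl⟩
    exact ⟨M.x v, W.2 v hv, he v⟩⟩
  invFun W := ⟨W.1.comap e.toLinearMap, fun v hv => by
    have := W.2 _ hv
    rw [Submodule.mem_comap]
    rw [LinearEquiv.coe_coe, he]
    exact this⟩
  left_inv W := Sub.ext (Submodule.comap_map_eq_of_injective e.injective W.1)
  right_inv W := Sub.ext (Submodule.map_comap_eq_of_surjective e.surjective W.1)

end EndObj

namespace IsoClass

open EndObj

variable {F : Type u} [Field F]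

/-- The dimension. -/
noncomputable def rank (c : IsoClass F) : ℕ :=
  Quotient.liftOn c (fun M => Module.finrank F M.V) fun _ _ ⟨e, _⟩ => e.finrank_eq

theorem rank_cls (M : EndObj F) : M.cls.rank = Module.finrank F M.V := rfl

/-- The class of the zero object. -/
def zero (F : Type u) [Field F] : IsoClass F := (EndObj.zero F).cls

theorem rank_zero : (zero F).rank = 0 := by
  rw [zero, rank_cls]
  exact Module.finrank_zero_of_subsingleton (R := F) (M := PUnit.{u + 1})

theorem cls_eq_zero (M : EndObj F) [Subsingleton M.V] : M.cls = zero F :=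
  cls_eq (N := EndObj.zero F) ⟨⟨⟨fun _ => PUnit.unit, fun _ _ => rfl⟩, fun _ _ => rfl⟩,
    fun _ => 0, fun _ => Subsingleton.elim _ _, fun _ => rfl⟩ fun _ => rfl

theorem eq_zero_of_rank {c : IsoClass F} (h : c.rank = 0) : c = zero F := by
  obtain ⟨M, rfl⟩ := exists_cls_eq c
  rw [rank_cls] at h
  have := Module.finrank_zero_iff.1 h
  exact cls_eq_zero M

/-- The sum of `θ (W, V/W)` over the stable subspaces `W` of `V`. -/
noncomputable def hall (θ : IsoClass F → IsoClass F → ℂ) (c : IsoClass F) : ℂ :=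
  Quotient.liftOn c (fun M => ∑ W : M.Sub, θ (M.sub W).cls (M.quo W).cls) fun M N ⟨e, he⟩ => by
    refine Fintype.sum_equiv (subEquiv e he) _ _ fun W => ?_
    congr 1
    · refine cls_eq (M := M.sub W) (N := N.sub _) (e.submoduleMap W.1) fun v => ?_
      apply Subtype.ext
      exact he _
    · refine cls_quo_eq W (N := N.quo _)
        ((Submodule.mkQ (subEquiv e he W).1).comp e.toLinearMap) ?_ ?_ ?_
      · exact (Submodule.mkQ_surjective _).comp e.surjective
      · rw [LinearMap.ker_comp, Submodule.ker_mkQ]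
        exact congrArg Sub.val ((subEquiv e he).left_inv W)
      · intro v
        have : (Submodule.mkQ (subEquiv e he W).1) (N.x (e v)) =
          (N.quo (subEquiv e he W)).x (Submodule.mkQ (subEquiv e he W).1 (e v)) := rfl
        rw [← he] at this
        exact this

theorem hall_cls (θ : IsoClass F → IsoClass F → ℂ) (M : EndObj F) :
    hall θ M.cls = ∑ W : M.Sub, θ (M.sub W).cls (M.quo W).cls := rfl

theorem rank_sub_add_rank_quo (M : EndObj F) (W : M.Sub) :
    (M.sub W).cls.rank + (M.quo W).cls.rank = M.cls.rank := by
  rw [rank_cls, rank_cls, rank_cls, add_comm]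
  exact Submodule.finrank_quotient_add_finrank W.1

theorem hall_congr {θ θ' : IsoClass F → IsoClass F → ℂ} {c : IsoClass F}
    (h : ∀ a b, a.rank + b.rank = c.rank → θ a b = θ' a b) : hall θ c = hall θ' c := by
  obtain ⟨M, rfl⟩ := exists_cls_eq c
  exact Finset.sum_congr rfl fun W _ => h _ _ (rank_sub_add_rank_quo M W)

theorem hall_add (θ θ' : IsoClass F → IsoClass F → ℂ) (c : IsoClass F) :
    hall (fun a b => θ a b + θ' a b) c = hall θ c + hall θ' c := by
  obtain ⟨M, rfl⟩ := exists_cls_eq c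
  exact Finset.sum_add_distrib

theorem hall_mul_left (z : ℂ) (θ : IsoClass F → IsoClass F → ℂ) (c : IsoClass F) :
    hall (fun a b => z * θ a b) c = z * hall θ c := by
  obtain ⟨M, rfl⟩ := exists_cls_eq c
  exact (Finset.mul_sum _ _ _).symm

theorem hall_mul_right (z : ℂ) (θ : IsoClass F → IsoClass F → ℂ) (c : IsoClass F) :
    hall (fun a b => θ a b * z) c = hall θ c * z := by
  obtain ⟨M, rfl⟩ := exists_cls_eq c
  exact (Finset.sum_mul _ _ _).symm

theorem hall_zero (c : IsoClass F) : hall (fun _ _ => 0) c = 0 := by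
  obtain ⟨M, rfl⟩ := exists_cls_eq c
  exact Finset.sum_const_zero

/-- The whole space as a stable subspace. -/
def _root_.EndObj.topSub (M : EndObj F) : M.Sub := ⟨⊤, fun _ _ => trivial⟩

/-- The zero subspace as a stable subspace. -/
def _root_.EndObj.botSub (M : EndObj F) : M.Sub := ⟨⊥, fun v hv => by
  rw [Submodule.mem_bot] at hv ⊢; rw [hv, map_zero]⟩

theorem _root_.EndObj.cls_sub_top (M : EndObj F) : (M.sub M.topSub).cls = M.cls :=
  cls_sub_eq _ LinearMap.id Function.injective_id LinearMap.range_id fun _ => rfl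

theorem _root_.EndObj.cls_quo_bot (M : EndObj F) : (M.quo M.botSub).cls = M.cls :=
  cls_quo_eq _ LinearMap.id Function.surjective_id LinearMap.ker_id fun _ => rfl

theorem _root_.EndObj.rank_quo_eq_zero {M : EndObj F} {W : M.Sub} :
    (M.quo W).cls.rank = 0 ↔ W = M.topSub := by
  have h := rank_sub_add_rank_quo M W
  constructor
  · intro h0
    rw [h0, add_zero] at h
    exact Sub.ext (Submodule.eq_top_of_finrank_eq h)
  · rintro rfl
    rw [EndObj.cls_sub_top] at h
    omega

theorem _root_.EndObj.rank_sub_eq_zero {M : EndObj F} {W : M.Sub} :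
    (M.sub W).cls.rank = 0 ↔ W = M.botSub := by
  constructor
  · intro h0
    exact Sub.ext (Submodule.finrank_eq_zero.1 h0)
  · rintro rfl
    exact finrank_bot F M.V

open scoped Classical in
theorem hall_rank_right_zero (θ : IsoClass F → IsoClass F → ℂ) (c : IsoClass F) :
    hall (fun a b => if b.rank = 0 then θ a b else 0) c = θ c (zero F) := by
  obtain ⟨M, rfl⟩ := exists_cls_eq c
  rw [hall_cls]
  simp only [EndObj.rank_quo_eq_zero]
  rw [Finset.sum_ite_eq' Finset.univ M.topSub, if_pos (Finset.mem_univ _), EndObj.cls_sub_top,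
    eq_zero_of_rank (EndObj.rank_quo_eq_zero.2 rfl)]

open scoped Classical in
theorem hall_rank_left_zero (θ : IsoClass F → IsoClass F → ℂ) (c : IsoClass F) :
    hall (fun a b => if a.rank = 0 then θ a b else 0) c = θ (zero F) c := by
  obtain ⟨M, rfl⟩ := exists_cls_eq c
  rw [hall_cls]
  simp only [EndObj.rank_sub_eq_zero]
  rw [Finset.sum_ite_eq' Finset.univ M.botSub, if_pos (Finset.mem_univ _), EndObj.cls_quo_bot,
    eq_zero_of_rank (EndObj.rank_sub_eq_zero.2 rfl)]

end IsoClass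

namespace EndObj

variable {F : Type u} [Field F] (M : EndObj F)

/-- The trace of a stable subspace `U` on a stable subspace `W`. -/
def comapSub (W U : M.Sub) : (M.sub W).Sub :=
  ⟨U.1.comap W.1.subtype, fun v hv => U.2 v.1 hv⟩

/-- The image of a stable subspace `W` in the quotient by a stable subspace `U`. -/
def mapSub (U W : M.Sub) : (M.quo U).Sub :=
  ⟨W.1.map U.1.mkQ, by
    rintro _ ⟨v, hv, rfl⟩
    exact ⟨M.x v, W.2 v hv, rfl⟩⟩

open scoped Classical in
theorem sum_sub_sub (W : M.Sub) (φ : (M.sub W).Sub → ℂ) :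
    ∑ U, φ U = ∑ U : M.Sub with U.1 ≤ W.1, φ (M.comapSub W U) := by
  have key : ∀ U : (M.sub W).Sub, (U.1.map W.1.subtype).comap W.1.subtype = U.1 := fun U =>
    Submodule.comap_map_eq_of_injective W.1.injective_subtype U.1
  refine Finset.sum_nbij' (fun U => (⟨U.1.map W.1.subtype, ?_⟩ : M.Sub))
    (fun U => M.comapSub W U) ?_ ?_ ?_ ?_ ?_
  · rintro _ ⟨v, hv, rfl⟩
    exact ⟨_, U.2 v hv, rfl⟩
  · intro U _
    simp only [Finset.mem_filter, Finset.mem_univ, true_and]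
    exact Submodule.map_subtype_le W.1 U.1
  · intro U _
    exact Finset.mem_univ _
  · intro U _
    exact Sub.ext (key U)
  · intro U hU
    refine Sub.ext ?_
    change (U.1.comap W.1.subtype).map W.1.subtype = U.1
    rw [Submodule.map_comap_subtype]
    exact inf_eq_right.2 (Finset.mem_filter.1 hU).2
  · intro U _
    congr 1
    exact (Sub.ext (key U)).symm

open scoped Classical in
theorem sum_sub_quo (U : M.Sub) (φ : (M.quo U).Sub → ℂ) :
    ∑ W, φ W = ∑ W : M.Sub with U.1 ≤ W.1, φ (M.mapSub U W) := by
  have key : ∀ W : (M.quo U).Sub, (W.1.comap U.1.mkQ).map U.1.mkQ = W.1 := fun W =>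
    Submodule.map_comap_eq_of_surjective U.1.mkQ_surjective W.1
  refine Finset.sum_nbij' (fun W => (⟨W.1.comap U.1.mkQ, ?_⟩ : M.Sub))
    (fun W => M.mapSub U W) ?_ ?_ ?_ ?_ ?_
  · intro v hv
    exact W.2 _ hv
  · intro W _
    simp only [Finset.mem_filter, Finset.mem_univ, true_and]
    exact Submodule.le_comap_mkQ U.1 W.1
  · intro U _
    exact Finset.mem_univ _
  · intro W _
    exact Sub.ext (key W)
  · intro W hW
    refine Sub.ext ?_
    change (W.1.map U.1.mkQ).comap U.1.mkQ = W.1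
    rw [Submodule.comap_map_mkQ]
    exact sup_eq_right.2 (Finset.mem_filter.1 hW).2
  · intro W _
    congr 1
    exact (Sub.ext (key W)).symm

variable {M}

theorem cls_sub_comapSub {U W : M.Sub} (h : U.1 ≤ W.1) :
    ((M.sub W).sub (M.comapSub W U)).cls = (M.sub U).cls :=
  cls_sub_eq (M := M.sub W) (N := M.sub U) (M.comapSub W U) (Submodule.inclusion h)
    (Submodule.inclusion_injective h) (Submodule.range_inclusion _ _ h) fun _ => rfl

theorem cls_quo_mapSub {U W : M.Sub} (h : U.1 ≤ W.1) :
    ((M.quo U).quo (M.mapSub U W)).cls = (M.quo W).cls := by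
  refine cls_quo_eq (M := M.quo U) (N := M.quo W) (M.mapSub U W) (Submodule.factor h)
    (Submodule.factor_surjective h) ?_ ?_
  · ext v
    obtain ⟨v, rfl⟩ := U.1.mkQ_surjective v
    rw [LinearMap.mem_ker]
    change W.1.mkQ v = 0 ↔ U.1.mkQ v ∈ W.1.map U.1.mkQ
    rw [← Submodule.mem_comap, Submodule.comap_map_mkQ, sup_eq_right.2 h, Submodule.mkQ_apply,
      Submodule.Quotient.mk_eq_zero]
  · intro v
    obtain ⟨v, rfl⟩ := U.1.mkQ_surjective v
    rfl

theorem cls_sub_mapSub (U W : M.Sub) :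
    ((M.quo U).sub (M.mapSub U W)).cls = ((M.sub W).quo (M.comapSub W U)).cls := by
  symm
  refine cls_quo_eq (M := M.sub W) (N := (M.quo U).sub (M.mapSub U W)) (M.comapSub W U)
    (LinearMap.codRestrict (W.1.map U.1.mkQ) (U.1.mkQ.comp W.1.subtype)
      fun v => ⟨v.1, v.2, rfl⟩) ?_ ?_ ?_
  · rintro ⟨_, v, hv, rfl⟩
    exact ⟨⟨v, hv⟩, rfl⟩
  · refine (LinearMap.ker_codRestrict _ _ _).trans ?_
    rw [LinearMap.ker_comp, Submodule.ker_mkQ]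
    rfl
  · intro v
    rfl

end EndObj

namespace IsoClass

open EndObj

variable {F : Type u} [Field F]

/-- Two-step flags can be summed from below or from above. -/
theorem hall_hall (θ : IsoClass F → IsoClass F → IsoClass F → ℂ) (c : IsoClass F) :
    hall (fun a b => hall (fun a' a'' => θ a' a'' b) a) c =
      hall (fun a b => hall (fun b' b'' => θ a b' b'') b) c := by
  classical
  obtain ⟨M, rfl⟩ := exists_cls_eq c
  simp only [hall_cls, sum_sub_sub, sum_sub_quo]
  rw [Finset.sum_comm' (t' := Finset.univ) (s' := fun U : M.Sub => {W : M.Sub | U.1 ≤ W.1})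
    (by simp)]
  refine Finset.sum_congr rfl fun U _ => Finset.sum_congr rfl fun W hW => ?_
  have h : U.1 ≤ W.1 := (Finset.mem_filter.1 hW).2
  rw [cls_sub_comapSub h, cls_quo_mapSub h, cls_sub_mapSub]

/-- The product of the Hall algebra. -/
noncomputable def hmul (f g : IsoClass F → ℂ) : IsoClass F → ℂ := hall fun a b => f a * g b

theorem hmul_assoc (f g h : IsoClass F → ℂ) : hmul (hmul f g) h = hmul f (hmul g h) := by
  funext c
  have := hall_hall (fun a b c => f a * g b * h c) c
  simp only [mul_assoc, hall_mul_left] at this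
  simp only [hmul]
  rw [← this]
  refine hall_congr fun a b _ => ?_
  rw [← hall_mul_right]
  simp only [mul_assoc]

theorem hmul_add (f g h : IsoClass F → ℂ) : hmul f (g + h) = hmul f g + hmul f h := by
  funext c
  simp only [hmul, Pi.add_apply, mul_add, hall_add]

theorem add_hmul (f g h : IsoClass F → ℂ) : hmul (f + g) h = hmul f h + hmul g h := by
  funext c
  simp only [hmul, Pi.add_apply, add_mul, hall_add]

theorem smul_hmul (z : ℂ) (f g : IsoClass F → ℂ) : hmul (z • f) g = z • hmul f g := by
  funext c
  simp only [hmul, Pi.smul_apply, smul_eq_mul, mul_assoc, hall_mul_left]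

theorem hmul_smul (z : ℂ) (f g : IsoClass F → ℂ) : hmul f (z • g) = z • hmul f g := by
  funext c
  simp only [hmul, Pi.smul_apply, smul_eq_mul, mul_left_comm _ z, hall_mul_left]

end IsoClass

namespace IsoClass

open EndObj

variable {F : Type u} [Field F]

/-- The coproduct of the Hall algebra: the average over all extensions of `b` by `a`. -/
noncomputable def cop (f : IsoClass F → ℂ) (a b : IsoClass F) : ℂ :=
  Quotient.liftOn₂ a b (fun A B => avg fun y : B.V →ₗ[F] A.V => f (ext A B y).cls)
    fun A B A' B' ⟨e, he⟩ ⟨e', he'⟩ => by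
      refine avg_congr (LinearEquiv.arrowCongr e' e).toEquiv fun y => ?_
      congr 1
      refine cls_eq (LinearEquiv.prodCongr e e') fun v => ?_
      simp [he, he']

theorem cop_cls (f : IsoClass F → ℂ) (A B : EndObj F) :
    cop f A.cls B.cls = avg fun y : B.V →ₗ[F] A.V => f (ext A B y).cls := rfl

theorem rank_ext (A B : EndObj F) (y : B.V →ₗ[F] A.V) :
    (ext A B y).cls.rank = A.cls.rank + B.cls.rank :=
  Module.finrank_prod

theorem cop_congr {f g : IsoClass F → ℂ} {a b : IsoClass F}
    (h : ∀ c, c.rank = a.rank + b.rank → f c = g c) : cop f a b = cop g a b := by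
  obtain ⟨A, rfl⟩ := exists_cls_eq a
  obtain ⟨B, rfl⟩ := exists_cls_eq b
  rw [cop_cls, cop_cls]
  congr 1
  funext y
  exact h _ (rank_ext A B y)

theorem cop_zero (a b : IsoClass F) : cop (0 : IsoClass F → ℂ) a b = 0 := by
  obtain ⟨A, rfl⟩ := exists_cls_eq a
  obtain ⟨B, rfl⟩ := exists_cls_eq b
  rw [cop_cls]
  exact avg_const 0

theorem cop_add (f g : IsoClass F → ℂ) (a b : IsoClass F) :
    cop (f + g) a b = cop f a b + cop g a b := by
  obtain ⟨A, rfl⟩ := exists_cls_eq a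
  obtain ⟨B, rfl⟩ := exists_cls_eq b
  exact avg_add _ _

theorem cop_smul (z : ℂ) (f : IsoClass F → ℂ) (a b : IsoClass F) :
    cop (z • f) a b = z * cop f a b := by
  obtain ⟨A, rfl⟩ := exists_cls_eq a
  obtain ⟨B, rfl⟩ := exists_cls_eq b
  exact avg_mul_left _ _

theorem cop_right_zero (f : IsoClass F → ℂ) {a b : IsoClass F} (hb : b.rank = 0) :
    cop f a b = f a := by
  obtain ⟨A, rfl⟩ := exists_cls_eq a
  obtain ⟨B, rfl⟩ := exists_cls_eq b
  have : Subsingleton B.V := Module.finrank_zero_iff.1 hb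
  rw [cop_cls]
  have h : ∀ y : B.V →ₗ[F] A.V, f (ext A B y).cls = f A.cls := fun y => by
    congr 1
    refine cls_eq ⟨LinearMap.fst F A.V B.V, fun a => (a, 0), fun v => ?_, fun v => rfl⟩
      fun v => ?_
    · exact Prod.ext rfl (Subsingleton.elim _ _)
    · have h0 : v.2 = 0 := Subsingleton.elim _ _
      change A.x v.1 + y v.2 = A.x v.1
      rw [h0, map_zero, add_zero]
  simp only [h]
  exact avg_const _

theorem cop_left_zero (f : IsoClass F → ℂ) {a b : IsoClass F} (ha : a.rank = 0) :
    cop f a b = f b := by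
  obtain ⟨A, rfl⟩ := exists_cls_eq a
  obtain ⟨B, rfl⟩ := exists_cls_eq b
  have : Subsingleton A.V := Module.finrank_zero_iff.1 ha
  rw [cop_cls]
  have h : ∀ y : B.V →ₗ[F] A.V, f (ext A B y).cls = f B.cls := fun y => by
    congr 1
    refine cls_eq ⟨LinearMap.snd F A.V B.V, fun a => (0, a), fun v => ?_, fun v => rfl⟩
      fun v => rfl
    exact Prod.ext (Subsingleton.elim _ _) rfl
  simp only [h]
  exact avg_const _

/-- Averaging over the endomorphisms inducing given endomorphisms of `W` and `V/W`. -/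
theorem avg_add_unipotent (f : IsoClass F → ℂ) (M : EndObj F) (W : M.Sub) :
    (avg fun y : (M.V ⧸ W.1) →ₗ[F] W.1 =>
      f (EndObj.mk M.V (M.x + W.1.subtype ∘ₗ y ∘ₗ W.1.mkQ)).cls) =
      cop f (M.sub W).cls (M.quo W).cls := by
  obtain ⟨s, hs⟩ := LinearMap.exists_rightInverse_of_surjective W.1.mkQ W.1.range_mkQ
  have hs' : ∀ b, W.1.mkQ (s b) = b := fun b => LinearMap.congr_fun hs b
  have hW : ∀ w ∈ W.1, W.1.mkQ w = 0 := fun w hw => (Submodule.Quotient.mk_eq_zero _).2 hw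
  have hx : ∀ v, W.1.mkQ (M.x v) = (M.quo W).x (W.1.mkQ v) := fun v => rfl
  let y₀ : (M.V ⧸ W.1) →ₗ[F] W.1 :=
    LinearMap.codRestrict W.1 (M.x ∘ₗ s - s ∘ₗ (M.quo W).x) fun b => by
      rw [← Submodule.Quotient.mk_eq_zero, ← Submodule.mkQ_apply]
      simp only [LinearMap.sub_apply, LinearMap.comp_apply, map_sub, hs', hx, sub_self]
  rw [cop_cls]
  refine avg_congr (Equiv.addLeft y₀) fun y => ?_
  congr 1
  symm
  refine cls_eq (M := ext (M.sub W) (M.quo W) (y₀ + y)) (N := EndObj.mk M.V _)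
    (LinearEquiv.ofBijective (W.1.subtype.coprod s) ⟨?_, ?_⟩) ?_
  · rw [injective_iff_map_eq_zero]
    rintro ⟨w, b⟩ h
    have h1 : (w : M.V) + s b = 0 := h
    have h2 : b = 0 := by
      have := congrArg W.1.mkQ h1
      rwa [map_add, hs', hW _ w.2, zero_add, map_zero] at this
    rw [h2, map_zero, add_zero] at h1
    rw [h2]
    exact Prod.ext (Subtype.ext h1) rfl
  · intro v
    refine ⟨(⟨v - s (W.1.mkQ v), ?_⟩, W.1.mkQ v), ?_⟩
    · rw [← Submodule.Quotient.mk_eq_zero, ← Submodule.mkQ_apply, map_sub, hs', sub_self]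
    · simp
  · rintro ⟨w, b⟩
    change ((M.sub W).x w : M.V) + (y₀ b + y b : W.1) + s ((M.quo W).x b) =
      M.x (w + s b) + (y (W.1.mkQ (w + s b)) : W.1)
    have h3 : W.1.mkQ (w + s b) = b := by rw [map_add, hs', hW _ w.2, zero_add]
    have h4 : ((y₀ b : W.1) : M.V) = M.x (s b) - s ((M.quo W).x b) := rfl
    have h5 : ((M.sub W).x w : M.V) = M.x w := rfl
    rw [h3, map_add, Submodule.coe_add, h4, h5]
    abel

end IsoClass

namespace EndObj

variable {F : Type u} [Field F]

open scoped Classical in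
theorem sum_sub_eq (M : EndObj F) (φ : M.Sub → ℂ) :
    ∑ W, φ W = ∑ W : Submodule F M.V, if h : ∀ v ∈ W, M.x v ∈ W then φ ⟨W, h⟩ else 0 := by
  symm
  rw [← Finset.sum_filter_of_ne (p := fun W : Submodule F M.V => ∀ v ∈ W, M.x v ∈ W)
    fun W _ hW => by
      by_contra h
      exact hW (dif_neg h)]
  symm
  refine Finset.sum_bij (fun W _ => W.1) (fun W _ => ?_) (fun W _ W' _ h => Sub.ext h)
    (fun W hW => ?_) fun W _ => ?_
  · exact Finset.mem_filter.2 ⟨Finset.mem_univ _, W.2⟩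
  · exact ⟨⟨W, (Finset.mem_filter.1 hW).2⟩, Finset.mem_univ _, rfl⟩
  · rw [dif_pos W.2]

end EndObj

section Unipotent

variable {F A B : Type*} [Field F] [AddCommGroup A] [AddCommGroup B] [Module F A] [Module F B]

/-- The unipotent automorphism `(a, b) ↦ (a + φ b, b)`. -/
def unipotentEquiv (φ : B →ₗ[F] A) : (A × B) ≃ₗ[F] A × B where
  toFun v := (v.1 + φ v.2, v.2)
  invFun v := (v.1 - φ v.2, v.2)
  left_inv v := by simp
  right_inv v := by simp
  map_add' v w := by
    ext
    · simp only [Prod.fst_add, Prod.snd_add, map_add]; abel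
    · rfl
  map_smul' c v := by ext <;> simp

theorem map_unipotentEquiv_prod_eq_iff (A' : Submodule F A) (B' : Submodule F B)
    (φ ψ : B →ₗ[F] A) :
    (A'.prod B').map (unipotentEquiv φ).toLinearMap =
      (A'.prod B').map (unipotentEquiv ψ).toLinearMap ↔
    φ + -ψ ∈ B'.compatibleMaps A' := by
  have key : ∀ φ : B →ₗ[F] A, ∀ v, v ∈ (A'.prod B').map (unipotentEquiv φ).toLinearMap ↔
      v.1 - φ v.2 ∈ A' ∧ v.2 ∈ B' := fun φ v => by
    rw [Submodule.mem_map_equiv]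
    exact Submodule.mem_prod
  rw [SetLike.ext_iff]
  simp only [key]
  constructor
  · intro h b hb
    have := ((h (φ b, b)).1 ⟨by simp, hb⟩).1
    simpa [sub_eq_add_neg] using this
  · intro h v
    refine and_congr_left fun hv => ?_
    have h1 : φ v.2 + -ψ v.2 ∈ A' := h hv
    constructor
    · intro h2
      convert A'.add_mem h2 h1 using 1
      abel
    · intro h2
      convert A'.sub_mem h2 h1 using 1
      abel

theorem exists_map_unipotentEquiv_prod (W : Submodule F (A × B)) :
    ∃ φ : B →ₗ[F] A, ((W.comap (LinearMap.inl F A B)).prod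
      (W.map (LinearMap.snd F A B))).map (unipotentEquiv φ).toLinearMap = W := by
  obtain ⟨s, hs⟩ := LinearMap.exists_rightInverse_of_surjective
    ((LinearMap.snd F A B).submoduleMap W) (LinearMap.range_eq_top.2
      ((LinearMap.snd F A B).submoduleMap_surjective W))
  obtain ⟨r, hr⟩ := LinearMap.exists_leftInverse_of_injective
    (W.map (LinearMap.snd F A B)).subtype (Submodule.ker_subtype _)
  refine ⟨LinearMap.fst F A B ∘ₗ W.subtype ∘ₗ s ∘ₗ r, ?_⟩
  ext v
  rw [Submodule.mem_map_equiv]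
  have hsec : ∀ hb : v.2 ∈ W.map (LinearMap.snd F A B),
      (((W.subtype (s (r v.2))).1, v.2) : A × B) ∈ W := by
    intro hb
    have h1 : r v.2 = ⟨v.2, hb⟩ := LinearMap.congr_fun hr ⟨v.2, hb⟩
    have h2 : (W.subtype (s (r v.2))).2 = v.2 := by
      have := congrArg Subtype.val (LinearMap.congr_fun hs ⟨v.2, hb⟩)
      rw [h1]
      exact this
    have h3 := (s (r v.2)).2
    convert h3 using 1
    exact Prod.ext rfl h2.symm
  constructor
  · rintro ⟨h1, h2⟩
    have h3 : ((v.1 - (W.subtype (s (r v.2))).1, 0) : A × B) ∈ W := h1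
    convert W.add_mem h3 (hsec h2) using 1
    ext <;> simp
  · intro hv
    have hb : v.2 ∈ W.map (LinearMap.snd F A B) := ⟨v, hv, rfl⟩
    refine ⟨?_, hb⟩
    change ((v.1 - (W.subtype (s (r v.2))).1, 0) : A × B) ∈ W
    convert W.sub_mem hv (hsec hb) using 1
    ext <;> simp

theorem comap_inl_map_unipotentEquiv_prod (A' : Submodule F A) (B' : Submodule F B)
    (φ : B →ₗ[F] A) :
    ((A'.prod B').map (unipotentEquiv φ).toLinearMap).comap (LinearMap.inl F A B) = A' := by
  ext a
  rw [Submodule.mem_comap, Submodule.mem_map_equiv]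
  change (a - φ 0 ∈ A' ∧ (0 : B) ∈ B') ↔ a ∈ A'
  simp

theorem map_snd_map_unipotentEquiv_prod (A' : Submodule F A) (B' : Submodule F B)
    (φ : B →ₗ[F] A) :
    ((A'.prod B').map (unipotentEquiv φ).toLinearMap).map (LinearMap.snd F A B) = B' := by
  ext b
  constructor
  · rintro ⟨_, ⟨v, hv, rfl⟩, rfl⟩
    exact hv.2
  · intro hb
    exact ⟨_, ⟨(0, b), ⟨A'.zero_mem, hb⟩, rfl⟩, rfl⟩

/-- Summing over the subspaces of `A × B` a function that is invariant under unipotent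
automorphisms. -/
theorem sum_submodule_prod_eq [Finite A] [Finite B] (γ : Submodule F (A × B) → ℂ)
    (hγ : ∀ W (φ : B →ₗ[F] A), γ (W.map (unipotentEquiv φ).toLinearMap) = γ W) :
    ∑ W, γ W = ∑ A' : Submodule F A, ∑ B' : Submodule F B,
      (Nat.card (B'.compatibleMaps A') : ℂ)⁻¹ * (Nat.card (B →ₗ[F] A) * γ (A'.prod B')) := by
  classical
  rw [← Fintype.sum_prod_type', ← Finset.sum_fiberwise Finset.univ
    (fun W : Submodule F (A × B) =>
      (W.comap (LinearMap.inl F A B), W.map (LinearMap.snd F A B))) γ]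
  refine Finset.sum_congr rfl ?_
  rintro ⟨A', B'⟩ -
  have h := sum_eq_card_add_sum_image (B'.compatibleMaps A').toAddSubgroup
    (fun φ : B →ₗ[F] A => (A'.prod B').map (unipotentEquiv φ).toLinearMap)
    (fun φ ψ => map_unipotentEquiv_prod_eq_iff A' B' φ ψ) γ
  simp only [hγ, Finset.sum_const, nsmul_eq_mul, Finset.card_univ] at h
  have h0 : (Nat.card (B'.compatibleMaps A').toAddSubgroup : ℂ) ≠ 0 := by
    exact_mod_cast Nat.card_pos.ne'
  rw [← Nat.card_eq_fintype_card] at h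
  rw [h]
  refine Eq.trans ?_ (inv_mul_cancel_left₀ h0 _).symm
  refine Finset.sum_congr ?_ fun _ _ => rfl
  ext W
  simp only [Finset.mem_filter, Finset.mem_univ, true_and, Finset.mem_image, Prod.mk.injEq]
  constructor
  · rintro ⟨rfl, rfl⟩
    exact exists_map_unipotentEquiv_prod W
  · rintro ⟨φ, rfl⟩
    exact ⟨comap_inl_map_unipotentEquiv_prod A' B' φ, map_snd_map_unipotentEquiv_prod A' B' φ⟩

/-- The maps induced by a map `B → A` that sends `B'` into `A'`. -/
def compatibleMapsToProd (A' : Submodule F A) (B' : Submodule F B) :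
    B'.compatibleMaps A' →+ (B' →ₗ[F] A') × ((B ⧸ B') →ₗ[F] A ⧸ A') where
  toFun y := (y.1.restrict y.2, B'.mapQ A' y.1 y.2)
  map_zero' := by
    ext <;> rfl
  map_add' y z := by
    ext <;> rfl

theorem compatibleMapsToProd_surjective (A' : Submodule F A) (B' : Submodule F B) :
    Function.Surjective (compatibleMapsToProd A' B') := by
  rintro ⟨s, t⟩
  obtain ⟨r, hr⟩ := LinearMap.exists_leftInverse_of_injective B'.subtype (Submodule.ker_subtype _)
  obtain ⟨σ, hσ⟩ := LinearMap.exists_rightInverse_of_surjective A'.mkQ A'.range_mkQ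
  have hr' : ∀ b : B', r b = b := fun b => LinearMap.congr_fun hr b
  have hB : ∀ b : B', B'.mkQ b = 0 := fun b => (Submodule.Quotient.mk_eq_zero _).2 b.2
  have h1 : ∀ b : B', (A'.subtype ∘ₗ s ∘ₗ r + σ ∘ₗ t ∘ₗ B'.mkQ) b = s b := fun b => by
    simp only [LinearMap.add_apply, LinearMap.comp_apply, hr', hB, map_zero, add_zero]
    rfl
  refine ⟨⟨A'.subtype ∘ₗ s ∘ₗ r + σ ∘ₗ t ∘ₗ B'.mkQ, fun b hb => ?_⟩, ?_⟩
  · rw [Submodule.mem_comap, h1 ⟨b, hb⟩]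
    exact (s _).2
  · refine Prod.ext ?_ ?_
    · ext b
      exact h1 b
    · ext b
      change A'.mkQ ((s (r b) : A') + σ (t (B'.mkQ b))) = t (B'.mkQ b)
      rw [map_add, Submodule.mkQ_apply A' (s (r b) : A'),
        (Submodule.Quotient.mk_eq_zero _).2 (s (r b)).2, zero_add]
      exact LinearMap.congr_fun hσ _

end Unipotent

namespace IsoClass

open EndObj

variable {F : Type u} [Field F]

open scoped Classical in
/-- The summand of `θ` at `W`, provided that `W` is stable. -/
noncomputable def stableTerm (θ : IsoClass F → IsoClass F → ℂ) (M : EndObj F)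
    (W : Submodule F M.V) : ℂ :=
  if h : ∀ v ∈ W, M.x v ∈ W then θ (M.sub ⟨W, h⟩).cls (M.quo ⟨W, h⟩).cls else 0

theorem hall_cls_eq_sum (θ : IsoClass F → IsoClass F → ℂ) (M : EndObj F) :
    hall θ M.cls = ∑ W, stableTerm θ M W := by
  rw [hall_cls, sum_sub_eq]
  rfl

theorem stableTerm_map (θ : IsoClass F → IsoClass F → ℂ) {M N : EndObj F} (e : M.V ≃ₗ[F] N.V)
    (he : ∀ v, e (M.x v) = N.x (e v)) (W : Submodule F M.V) :
    stableTerm θ N (W.map e.toLinearMap) = stableTerm θ M W := by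
  by_cases h : ∀ v ∈ W, M.x v ∈ W
  · have h' : ∀ v ∈ W.map e.toLinearMap, N.x v ∈ W.map e.toLinearMap := by
      rintro _ ⟨v, hv, rfl⟩
      exact ⟨M.x v, h v hv, he v⟩
    rw [stableTerm, stableTerm, dif_pos h, dif_pos h']
    congr 1
    · refine cls_sub_eq (M := N) (N := M.sub ⟨W, h⟩) _ (e.toLinearMap ∘ₗ W.subtype)
        (e.injective.comp W.injective_subtype) ?_ fun v => he _
      rw [LinearMap.range_comp, Submodule.range_subtype]
    · symm
      refine cls_quo_eq (M := M) (N := N.quo ⟨_, h'⟩) _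
        ((Submodule.mkQ (W.map e.toLinearMap)).comp e.toLinearMap)
        ((Submodule.mkQ_surjective _).comp e.surjective) ?_ fun v => ?_
      · refine (LinearMap.ker_comp _ _).trans ?_
        rw [Submodule.ker_mkQ]
        exact Submodule.comap_map_eq_of_injective e.injective W
      · exact congrArg (Submodule.mkQ (W.map e.toLinearMap)) (he v)
  · have h' : ¬ ∀ v ∈ W.map e.toLinearMap, N.x v ∈ W.map e.toLinearMap := fun h' => h fun v hv => by
      obtain ⟨w, hw, hw'⟩ := h' _ ⟨v, hv, rfl⟩
      have : w = M.x v := e.injective (hw'.trans (he v).symm)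
      rwa [← this]
    rw [stableTerm, stableTerm, dif_neg h, dif_neg h']

/-- Conjugation by a unipotent element permutes the extensions. -/
theorem avg_stableTerm_unipotent (θ : IsoClass F → IsoClass F → ℂ) (A B : EndObj F)
    (φ : B.V →ₗ[F] A.V) (W : Submodule F (A.V × B.V)) :
    (avg fun y => stableTerm θ (ext A B y) (W.map (unipotentEquiv φ).toLinearMap)) =
      avg fun y => stableTerm θ (ext A B y) W := by
  symm
  refine avg_congr (Equiv.addRight (φ ∘ₗ B.x - A.x ∘ₗ φ)) fun y => ?_
  symm
  refine stableTerm_map θ (M := ext A B y) (N := ext A B _) (unipotentEquiv φ) (fun v => ?_) W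
  refine Prod.ext ?_ rfl
  change A.x v.1 + y v.2 + φ (B.x v.2) =
    A.x (v.1 + φ v.2) + (y v.2 + (φ (B.x v.2) - A.x (φ v.2)))
  rw [map_add]
  abel

theorem cls_ext_sub_prod {A B : EndObj F} (A' : A.Sub) (B' : B.Sub)
    (y : B'.1.compatibleMaps A'.1) (h : ∀ v ∈ A'.1.prod B'.1, (ext A B y.1).x v ∈ A'.1.prod B'.1) :
    ((ext A B y.1).sub ⟨A'.1.prod B'.1, h⟩).cls =
      (ext (A.sub A') (B.sub B') (compatibleMapsToProd A'.1 B'.1 y).1).cls := by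
  refine cls_sub_eq (M := ext A B y.1) (N := ext (A.sub A') (B.sub B') _) _
    (A'.1.subtype.prodMap B'.1.subtype) ?_ ?_ fun v => rfl
  · exact A'.1.injective_subtype.prodMap B'.1.injective_subtype
  · rw [LinearMap.range_prodMap, Submodule.range_subtype, Submodule.range_subtype]

theorem cls_ext_quo_prod {A B : EndObj F} (A' : A.Sub) (B' : B.Sub)
    (y : B'.1.compatibleMaps A'.1) (h : ∀ v ∈ A'.1.prod B'.1, (ext A B y.1).x v ∈ A'.1.prod B'.1) :
    ((ext A B y.1).quo ⟨A'.1.prod B'.1, h⟩).cls =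
      (ext (A.quo A') (B.quo B') (compatibleMapsToProd A'.1 B'.1 y).2).cls := by
  refine cls_quo_eq (M := ext A B y.1) (N := ext (A.quo A') (B.quo B') _) _
    (A'.1.mkQ.prodMap B'.1.mkQ) ?_ ?_ fun v => rfl
  · exact A'.1.mkQ_surjective.prodMap B'.1.mkQ_surjective
  · rw [LinearMap.ker_prodMap, Submodule.ker_mkQ, Submodule.ker_mkQ]

theorem stable_prod_iff {A B : EndObj F} (A' : Submodule F A.V) (B' : Submodule F B.V)
    (y : B.V →ₗ[F] A.V) :
    (∀ v ∈ A'.prod B', (ext A B y).x v ∈ A'.prod B') ↔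
      ((∀ v ∈ A', A.x v ∈ A') ∧ ∀ v ∈ B', B.x v ∈ B') ∧ y ∈ B'.compatibleMaps A' := by
  constructor
  · intro h
    have h1 : ∀ v ∈ A', A.x v ∈ A' := fun v hv => by
      have := (h (v, 0) ⟨hv, B'.zero_mem⟩).1
      simpa using this
    refine ⟨⟨h1, fun v hv => ?_⟩, fun v hv => ?_⟩
    · exact (h (0, v) ⟨A'.zero_mem, hv⟩).2
    · have := (h (0, v) ⟨A'.zero_mem, hv⟩).1
      simpa using this
  · rintro ⟨⟨h1, h2⟩, h3⟩ v hv
    exact ⟨A'.add_mem (h1 _ hv.1) (h3 hv.2), h2 _ hv.2⟩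

theorem sum_stableTerm_prod (f g : IsoClass F → ℂ) {A B : EndObj F} (A' : A.Sub) (B' : B.Sub) :
    ∑ y, stableTerm (fun a b => f a * g b) (ext A B y) (A'.1.prod B'.1) =
      Nat.card (B'.1.compatibleMaps A'.1) * (cop f (A.sub A').cls (B.sub B').cls *
        cop g (A.quo A').cls (B.quo B').cls) := by
  classical
  set K := B'.1.compatibleMaps A'.1
  have h0 : (Nat.card K : ℂ) ≠ 0 := by exact_mod_cast Nat.card_pos.ne'
  have hst : ∀ y : K, ∀ v ∈ A'.1.prod B'.1, (ext A B y.1).x v ∈ A'.1.prod B'.1 := fun y =>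
    (stable_prod_iff _ _ _).2 ⟨⟨A'.2, B'.2⟩, y.2⟩
  have h1 : ∑ y, stableTerm (fun a b => f a * g b) (ext A B y) (A'.1.prod B'.1) =
      ∑ y : K, stableTerm (fun a b => f a * g b) (ext A B y.1) (A'.1.prod B'.1) := by
    rw [← Finset.sum_filter_of_ne (p := (· ∈ K)) fun y _ hy => by
      by_contra h
      exact hy (dif_neg fun h' => h ((stable_prod_iff _ _ _).1 h').2)]
    exact Finset.sum_subtype _ (by simp) _
  have h2 := avg_comp_surjective (compatibleMapsToProd A'.1 B'.1)
    (compatibleMapsToProd_surjective A'.1 B'.1) fun z =>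
      f (ext (A.sub A') (B.sub B') z.1).cls * g (ext (A.quo A') (B.quo B') z.2).cls
  rw [avg_prod] at h2
  simp only [avg_mul_left, avg_mul_right] at h2
  rw [h1, cop_cls, cop_cls, ← h2, avg_eq, mul_inv_cancel_left₀ h0]
  refine Finset.sum_congr rfl fun y _ => ?_
  rw [stableTerm, dif_pos (hst y), cls_ext_sub_prod, cls_ext_quo_prod]

/-- Green's formula: the coproduct is multiplicative. -/
theorem cop_hmul (f g : IsoClass F → ℂ) (a b : IsoClass F) :
    cop (hmul f g) a b =
      hall (fun a' a'' => hall (fun b' b'' => cop f a' b' * cop g a'' b'') b) a := by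
  classical
  obtain ⟨A, rfl⟩ := exists_cls_eq a
  obtain ⟨B, rfl⟩ := exists_cls_eq b
  have h1 : cop (hmul f g) A.cls B.cls = ∑ W : Submodule F (A.V × B.V),
      avg fun y => stableTerm (fun a b => f a * g b) (ext A B y) W := by
    rw [cop_cls, ← avg_sum]
    simp only [hmul, hall_cls_eq_sum]
  rw [h1, sum_submodule_prod_eq _ fun W φ => avg_stableTerm_unipotent _ A B φ W]
  have hc : (Nat.card (B.V →ₗ[F] A.V) : ℂ) ≠ 0 := by exact_mod_cast Nat.card_pos.ne'
  simp only [avg_eq, mul_inv_cancel_left₀ hc]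
  simp only [hall_cls]
  rw [sum_sub_eq]
  refine Finset.sum_congr rfl fun A' _ => ?_
  split_ifs with hA
  · rw [sum_sub_eq]
    refine Finset.sum_congr rfl fun B' _ => ?_
    split_ifs with hB
    · have h2 := sum_stableTerm_prod f g (⟨A', hA⟩ : A.Sub) (⟨B', hB⟩ : B.Sub)
      have h0 : (Nat.card (B'.compatibleMaps A') : ℂ) ≠ 0 := by
        exact_mod_cast Nat.card_pos.ne'
      exact (congrArg _ h2).trans (inv_mul_cancel_left₀ h0 _)
    · rw [Finset.sum_eq_zero, mul_zero]
      intro y _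
      exact dif_neg fun h => hB ((stable_prod_iff _ _ _).1 h).1.2
  · refine Finset.sum_eq_zero fun B' _ => ?_
    rw [Finset.sum_eq_zero, mul_zero]
    intro y _
    exact dif_neg fun h => hA ((stable_prod_iff _ _ _).1 h).1.1

end IsoClass

namespace IsoClass

open EndObj

variable {F : Type u} [Field F]

open scoped Classical in
/-- The recursion defining the antipode, with a bound for the depth of the recursion. -/
noncomputable def antipodeAux : ℕ → (IsoClass F → ℂ) → IsoClass F → ℂ
  | 0, f, c => f c
  | k + 1, f, c => if c.rank = 0 then f c else
      -hall (fun a b => if b.rank = 0 then 0 else antipodeAux k (fun a' => cop f a' b) a) c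

theorem antipodeAux_eq (k l : ℕ) (f : IsoClass F → ℂ) (c : IsoClass F) (hk : c.rank ≤ k)
    (hl : c.rank ≤ l) : antipodeAux k f c = antipodeAux l f c := by
  induction k generalizing l f c with
  | zero =>
    have h0 : c.rank = 0 := Nat.le_zero.1 hk
    cases l with
    | zero => rfl
    | succ l => rw [antipodeAux, antipodeAux, if_pos h0]
  | succ k ih =>
    by_cases h0 : c.rank = 0
    · cases l with
      | zero => rw [antipodeAux, antipodeAux, if_pos h0]
      | succ l => rw [antipodeAux, antipodeAux, if_pos h0, if_pos h0]
    · obtain ⟨l, rfl⟩ : ∃ l', l = l' + 1 := ⟨l - 1, by omega⟩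
      rw [antipodeAux, antipodeAux, if_neg h0, if_neg h0]
      congr 1
      refine hall_congr fun a b hab => ?_
      split_ifs with hb
      · rfl
      · exact ih _ _ _ (by omega) (by omega)

/-- The antipode of the Hall algebra. -/
noncomputable def antipode (f : IsoClass F → ℂ) (c : IsoClass F) : ℂ := antipodeAux c.rank f c

theorem antipode_of_rank_eq_zero (f : IsoClass F → ℂ) {c : IsoClass F} (h : c.rank = 0) :
    antipode f c = f c := by
  rw [antipode, h, antipodeAux]

open scoped Classical in
theorem antipode_of_rank_ne_zero (f : IsoClass F → ℂ) {c : IsoClass F} (h : c.rank ≠ 0) :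
    antipode f c =
      -hall (fun a b => if b.rank = 0 then 0 else antipode (fun a' => cop f a' b) a) c := by
  rw [antipode, antipodeAux_eq c.rank (c.rank + 1) f c le_rfl (Nat.le_succ _), antipodeAux,
    if_neg h]
  congr 1
  refine hall_congr fun a b hab => ?_
  split_ifs with hb
  · rfl
  · exact antipodeAux_eq _ _ _ _ (by omega) le_rfl

theorem hall_antipode (f : IsoClass F → ℂ) {c : IsoClass F} (h : c.rank ≠ 0) :
    hall (fun a b => antipode (fun a' => cop f a' b) a) c = 0 := by
  classical
  have h1 := antipode_of_rank_ne_zero f h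
  have h2 : hall (fun a b => antipode (fun a' => cop f a' b) a) c =
      hall (fun a b => if b.rank = 0 then 0 else antipode (fun a' => cop f a' b) a) c +
      hall (fun a b => if b.rank = 0 then antipode (fun a' => cop f a' b) a else 0) c := by
    rw [← hall_add]
    refine hall_congr fun a b _ => ?_
    split_ifs <;> simp
  have h3 : (fun a' => cop f a' (zero F)) = f := funext fun a => cop_right_zero f rank_zero
  rw [h2, hall_rank_right_zero, h3, h1, add_neg_cancel]

theorem antipode_add (f g : IsoClass F → ℂ) : antipode (f + g) = antipode f + antipode g := by
  funext c
  induction hn : c.rank using Nat.strong_induction_on generalizing c f g with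
  | _ n ih =>
    subst hn
    by_cases h0 : c.rank = 0
    · simp [antipode_of_rank_eq_zero _ h0]
    · rw [Pi.add_apply, antipode_of_rank_ne_zero _ h0, antipode_of_rank_ne_zero _ h0,
        antipode_of_rank_ne_zero _ h0, ← neg_add, ← hall_add]
      congr 1
      refine hall_congr fun a b hab => ?_
      split_ifs with hb
      · rw [add_zero]
      · rw [← Pi.add_apply, ← ih a.rank (by omega) _ _ a rfl]
        congr 1
        funext a'
        exact cop_add f g a' b

theorem antipode_smul (z : ℂ) (f : IsoClass F → ℂ) : antipode (z • f) = z • antipode f := by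
  funext c
  induction hn : c.rank using Nat.strong_induction_on generalizing c f with
  | _ n ih =>
    subst hn
    by_cases h0 : c.rank = 0
    · simp [antipode_of_rank_eq_zero _ h0]
    · rw [Pi.smul_apply, antipode_of_rank_ne_zero _ h0, antipode_of_rank_ne_zero _ h0, smul_neg,
        smul_eq_mul, ← hall_mul_left]
      congr 1
      refine hall_congr fun a b hab => ?_
      split_ifs with hb
      · rw [mul_zero]
      · rw [← smul_eq_mul, ← Pi.smul_apply, ← ih a.rank (by omega) _ a rfl]
        congr 1
        funext a'
        exact cop_smul z f a' b

/-- The antipode as a linear map. -/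
noncomputable def antipodeLinear (F : Type u) [Field F] :
    (IsoClass F → ℂ) →ₗ[ℂ] (IsoClass F → ℂ) where
  toFun := antipode
  map_add' := antipode_add
  map_smul' := antipode_smul

theorem antipode_mul_right (f : IsoClass F → ℂ) (z : ℂ) (c : IsoClass F) :
    antipode (fun a => f a * z) c = antipode f c * z := by
  have := congrFun (antipode_smul z f) c
  rw [Pi.smul_apply, smul_eq_mul, mul_comm] at this
  rw [← this]
  congr 1
  funext a
  exact mul_comm _ _

theorem antipode_hall (θ : IsoClass F → IsoClass F → IsoClass F → ℂ) (b c : IsoClass F) :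
    antipode (fun a => hall (θ a) b) c =
      hall (fun b' b'' => antipode (fun a => θ a b' b'') c) b := by
  obtain ⟨B, rfl⟩ := exists_cls_eq b
  rw [hall_cls]
  have h : (fun a => hall (θ a) B.cls) =
      ∑ W : B.Sub, fun a => θ a (B.sub W).cls (B.quo W).cls := by
    funext a
    rw [Finset.sum_apply, hall_cls]
  rw [h]
  have h2 := congrFun (map_sum (antipodeLinear F)
    (fun W : B.Sub => fun a => θ a (B.sub W).cls (B.quo W).cls) Finset.univ) c
  rw [Finset.sum_apply] at h2
  exact h2

/-- The primitive elements of positive degree. -/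
structure IsPrim (p : IsoClass F → ℂ) : Prop where
  zero : p (zero F) = 0
  cop : ∀ a b, a.rank ≠ 0 → b.rank ≠ 0 → cop p a b = 0

open scoped Classical in
theorem IsPrim.cop_eq {p : IsoClass F → ℂ} (hp : IsPrim p) (a b : IsoClass F) :
    IsoClass.cop p a b = (if b.rank = 0 then p a else 0) + if a.rank = 0 then p b else 0 := by
  have h0 : ∀ c : IsoClass F, c.rank = 0 → p c = 0 := fun c hc => by
    rw [eq_zero_of_rank hc, hp.zero]
  by_cases hb : b.rank = 0
  · rw [cop_right_zero p hb, if_pos hb, h0 b hb, ite_self, add_zero]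
  · by_cases ha : a.rank = 0
    · rw [cop_left_zero p ha, if_neg hb, if_pos ha, zero_add]
    · rw [hp.cop a b ha hb, if_neg ha, if_neg hb, add_zero]

theorem hall_hall_comm (θ : IsoClass F → IsoClass F → IsoClass F → IsoClass F → ℂ)
    (a b : IsoClass F) :
    hall (fun a' a'' => hall (fun b' b'' => θ a' a'' b' b'') b) a =
      hall (fun b' b'' => hall (fun a' a'' => θ a' a'' b' b'') a) b := by
  obtain ⟨A, rfl⟩ := exists_cls_eq a
  obtain ⟨B, rfl⟩ := exists_cls_eq b
  exact Finset.sum_comm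

/-- The coproduct of the product with a primitive element. -/
theorem IsPrim.cop_hmul {p : IsoClass F → ℂ} (hp : IsPrim p) (h : IsoClass F → ℂ)
    (a b : IsoClass F) :
    IsoClass.cop (hmul h p) a b = hmul (fun a' => IsoClass.cop h a' b) p a +
      hall (fun b' b'' => IsoClass.cop h a b' * p b'') b := by
  classical
  rw [IsoClass.cop_hmul]
  simp only [hp.cop_eq, mul_add, hall_add]
  congr 1
  · refine hall_congr fun a' a'' _ => ?_
    rw [← hall_rank_right_zero (fun b' _ => IsoClass.cop h a' b' * p a'') b]
    simp only [mul_ite, mul_zero]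
  · rw [hall_hall_comm]
    refine hall_congr fun b' b'' _ => ?_
    rw [← hall_rank_right_zero (fun a' _ => IsoClass.cop h a' b' * p b'') a]
    simp only [mul_ite, mul_zero]

/-- The antipode turns right multiplication by a primitive element `p` into left multiplication
by `-p`. -/
theorem IsPrim.antipode_hmul {p : IsoClass F → ℂ} (hp : IsPrim p) (h : IsoClass F → ℂ) :
    antipode (hmul h p) = -hmul p (antipode h) := by
  classical
  have hp0 : ∀ c : IsoClass F, c.rank = 0 → p c = 0 := fun c hc => by
    rw [eq_zero_of_rank hc, hp.zero]
  funext c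
  rw [Pi.neg_apply]
  induction hn : c.rank using Nat.strong_induction_on generalizing c h with
  | _ n ih =>
    subst hn
    by_cases h0 : c.rank = 0
    · rw [antipode_of_rank_eq_zero _ h0, hmul, hmul,
        hall_congr (θ' := fun _ _ => 0) fun a b hab => by rw [hp0 b (by omega), mul_zero],
        hall_congr (θ := fun a b => p a * antipode h b) (θ' := fun _ _ => 0)
          fun a b hab => by rw [hp0 a (by omega), zero_mul], hall_zero, neg_zero]
    · rw [antipode_of_rank_ne_zero _ h0]
      have e1 : ∀ a b : IsoClass F, a.rank + b.rank = c.rank →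
          (if b.rank = 0 then 0 else antipode (fun a' => IsoClass.cop (hmul h p) a' b) a) =
          (if b.rank = 0 then 0 else
            -hmul p (antipode fun a' => IsoClass.cop h a' b) a) +
          hall (fun b' b'' => antipode (fun a' => IsoClass.cop h a' b') a * p b'') b := by
        intro a b hab
        split_ifs with hb
        · rw [zero_add, hall_congr (θ' := fun _ _ => 0) fun b' b'' hb' => by
            rw [hp0 b'' (by omega), mul_zero], hall_zero]
        · have e2 : (fun a' => IsoClass.cop (hmul h p) a' b) =
              hmul (fun a' => IsoClass.cop h a' b) p +
                fun a' => hall (fun b' b'' => IsoClass.cop h a' b' * p b'') b :=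
            funext fun a' => hp.cop_hmul h a' b
          rw [e2, antipode_add, Pi.add_apply, ih a.rank (by omega) _ _ rfl, antipode_hall]
          simp only [antipode_mul_right]
      rw [hall_congr e1, hall_add]
      have e3 : hall (fun a b => if b.rank = 0 then 0 else
          -hmul p (antipode fun a' => IsoClass.cop h a' b) a) c =
          hmul p (antipode h) c - p c * h (IsoClass.zero F) := by
        have e4 := hall_hall (fun a' a'' b => if b.rank = 0 then 0 else
          -(p a' * antipode (fun a' => IsoClass.cop h a' b) a'')) c
        have e5 : ∀ a b : IsoClass F, (if b.rank = 0 then 0 else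
            -hmul p (antipode fun a' => IsoClass.cop h a' b) a) =
            hall (fun a' a'' => if b.rank = 0 then 0 else
              -(p a' * antipode (fun a' => IsoClass.cop h a' b) a'')) a := by
          intro a b
          split_ifs with hb
          · rw [hall_zero]
          · rw [hmul, ← neg_one_mul, ← hall_mul_left]
            simp only [neg_one_mul]
        simp only [e5]
        rw [e4, ← hall_rank_right_zero (fun a _ => p a * h (IsoClass.zero F)) c, hmul, sub_eq_add_neg,
          ← neg_one_mul (hall _ _), ← hall_mul_left, ← hall_add]
        refine hall_congr fun a b _ => ?_
        by_cases hb : b.rank = 0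
        · rw [if_pos hb, antipode_of_rank_eq_zero _ hb, eq_zero_of_rank hb,
            hall_congr (θ' := fun _ _ => 0) fun b' b'' hb' => by
              rw [rank_zero] at hb'
              rw [if_pos (by omega)], hall_zero]
          ring
        · rw [if_neg hb, antipode_of_rank_ne_zero _ hb, mul_zero, add_zero, mul_neg,
            ← neg_mul, ← hall_mul_left]
          refine hall_congr fun b' b'' _ => ?_
          split_ifs
          · rw [mul_zero]
          · ring
      have e6 : hall (fun a b => hall (fun b' b'' =>
          antipode (fun a' => IsoClass.cop h a' b') a * p b'') b) c = h (IsoClass.zero F) * p c := by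
        rw [← hall_hall fun a b' b'' => antipode (fun a' => IsoClass.cop h a' b') a * p b'',
          ← hall_rank_left_zero (fun _ b => h (IsoClass.zero F) * p b) c]
        refine hall_congr fun a b _ => ?_
        rw [hall_mul_right]
        split_ifs with ha
        · rw [eq_zero_of_rank ha,
            ← hall_rank_left_zero (fun _ _ => h (IsoClass.zero F)) (IsoClass.zero F)]
          congr 1
          refine hall_congr fun a' b' hab => ?_
          rw [rank_zero] at hab
          rw [if_pos (by omega), antipode_of_rank_eq_zero _ (by omega),
            cop_right_zero _ (by omega), eq_zero_of_rank (c := a') (by omega)]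
        · rw [hall_antipode h ha, zero_mul]
      rw [e3, e6]
      ring

end IsoClass

namespace IsoClass

open EndObj

variable {F : Type u} [Field F]

theorem stableTerm_add_unipotent (θ : IsoClass F → IsoClass F → ℂ) (M : EndObj F)
    (W : Submodule F M.V) (y : (M.V ⧸ W) →ₗ[F] W) :
    stableTerm θ (EndObj.mk M.V (M.x + W.subtype ∘ₗ y ∘ₗ W.mkQ)) W = stableTerm θ M W := by
  have hx : ∀ v, (M.x + W.subtype ∘ₗ y ∘ₗ W.mkQ) v = M.x v + (y (W.mkQ v) : W) := fun v => rfl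
  have hW : ∀ v ∈ W, (M.x + W.subtype ∘ₗ y ∘ₗ W.mkQ) v = M.x v := fun v hv => by
    rw [hx, Submodule.mkQ_apply, (Submodule.Quotient.mk_eq_zero _).2 hv, map_zero,
      Submodule.coe_zero, add_zero]
  by_cases h : ∀ v ∈ W, M.x v ∈ W
  · have h' : ∀ v ∈ W, (M.x + W.subtype ∘ₗ y ∘ₗ W.mkQ) v ∈ W := fun v hv => by
      rw [hW v hv]; exact h v hv
    rw [stableTerm, stableTerm, dif_pos h, dif_pos h']
    congr 1
    · refine cls_eq (LinearEquiv.refl F W) fun v => Subtype.ext (hW v.1 v.2)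
    · refine cls_eq (LinearEquiv.refl F (M.V ⧸ W)) fun v => ?_
      obtain ⟨v, rfl⟩ := W.mkQ_surjective v
      change W.mkQ ((M.x + W.subtype ∘ₗ y ∘ₗ W.mkQ) v) = W.mkQ (M.x v)
      rw [hx, map_add, Submodule.mkQ_apply W (y _ : W), (Submodule.Quotient.mk_eq_zero _).2
        (Subtype.mem _), add_zero]
  · have h' : ¬ ∀ v ∈ W, (M.x + W.subtype ∘ₗ y ∘ₗ W.mkQ) v ∈ W := fun h' => h fun v hv => by
      rw [← hW v hv]; exact h' v hv
    rw [stableTerm, stableTerm, dif_neg h, dif_neg h']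

/-- Adjointness of the product and the coproduct. -/
theorem sum_hall_mul (θ : IsoClass F → IsoClass F → ℂ) (g : IsoClass F → ℂ) (V : Type u)
    [AddCommGroup V] [Module F V] [Finite V] :
    ∑ x : V →ₗ[F] V, hall θ (EndObj.mk V x).cls * g (EndObj.mk V x).cls =
      ∑ x : V →ₗ[F] V, hall (fun a b => θ a b * cop g a b) (EndObj.mk V x).cls := by
  have e : ∀ θ' (x : V →ₗ[F] V), hall θ' (EndObj.mk V x).cls =
      ∑ W : Submodule F V, stableTerm θ' (EndObj.mk V x) W := fun θ' x => hall_cls_eq_sum _ _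
  simp only [e, Finset.sum_mul]
  rw [Finset.sum_comm]
  conv_rhs => rw [Finset.sum_comm]
  refine Finset.sum_congr rfl fun W _ => ?_
  have h1 : ∀ y : (V ⧸ W) →ₗ[F] W,
      ∑ x : V →ₗ[F] V, stableTerm θ (EndObj.mk V x) W * g (EndObj.mk V x).cls =
      ∑ x : V →ₗ[F] V, stableTerm θ (EndObj.mk V x) W *
        g (EndObj.mk V (x + W.subtype ∘ₗ y ∘ₗ W.mkQ)).cls := by
    intro y
    symm
    refine Fintype.sum_equiv (Equiv.addRight (W.subtype ∘ₗ y ∘ₗ W.mkQ)) _ _ fun x => ?_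
    rw [Equiv.coe_addRight]
    congr 1
    exact (stableTerm_add_unipotent θ (EndObj.mk V x) W y).symm
  have h2 := avg_const (α := (V ⧸ W) →ₗ[F] W)
    (∑ x : V →ₗ[F] V, stableTerm θ (EndObj.mk V x) W * g (EndObj.mk V x).cls)
  rw [← h2, funext h1, avg_sum]
  refine Finset.sum_congr rfl fun x _ => ?_
  rw [avg_mul_left]
  by_cases h : ∀ v ∈ W, x v ∈ W
  · rw [stableTerm, stableTerm, dif_pos h, dif_pos h]
    congr 1
    exact avg_add_unipotent g (EndObj.mk V x) ⟨W, h⟩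
  · rw [stableTerm, stableTerm, dif_neg h, dif_neg h, zero_mul]

theorem IsPrim.sum_hall_mul {g : IsoClass F → ℂ} (hg : IsPrim g)
    (θ : IsoClass F → IsoClass F → ℂ) (h1 : ∀ a b, a.rank = 0 → θ a b = 0)
    (h2 : ∀ a b, b.rank = 0 → θ a b = 0) (V : Type u)
    [AddCommGroup V] [Module F V] [Finite V] :
    ∑ x : V →ₗ[F] V, hall θ (EndObj.mk V x).cls * g (EndObj.mk V x).cls = 0 := by
  rw [IsoClass.sum_hall_mul]
  refine Finset.sum_eq_zero fun x _ => ?_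
  rw [hall_congr (θ' := fun _ _ => 0) fun a b _ => ?_, hall_zero]
  by_cases ha : a.rank = 0
  · rw [h1 a b ha, zero_mul]
  · by_cases hb : b.rank = 0
    · rw [h2 a b hb, zero_mul]
    · rw [hg.cop a b ha hb, mul_zero]

theorem star_hall (θ : IsoClass F → IsoClass F → ℂ) (c : IsoClass F) :
    star (hall θ c) = hall (fun a b => star (θ a b)) c := by
  obtain ⟨M, rfl⟩ := exists_cls_eq c
  exact star_sum _ _

theorem hmul_zero_apply {f g : IsoClass F → ℂ} (hg : g (zero F) = 0) :
    hmul f g (zero F) = 0 := by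
  rw [hmul, hall_congr (θ' := fun _ _ => 0) fun a b hab => ?_, hall_zero]
  rw [rank_zero] at hab
  rw [eq_zero_of_rank (c := b) (by omega), hg, mul_zero]

theorem IsPrim.cop_hmul_prim {p q : IsoClass F → ℂ} (hp : IsPrim p) (hq : IsPrim q)
    {a b : IsoClass F} (ha : a.rank ≠ 0) (hb : b.rank ≠ 0) :
    IsoClass.cop (hmul p q) a b = p b * q a + p a * q b := by
  classical
  rw [hq.cop_hmul]
  congr 1
  · rw [← hall_rank_left_zero (fun _ a'' => p b * q a'') a]
    refine hall_congr fun a' a'' _ => ?_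
    dsimp only
    rw [hp.cop_eq, if_neg hb, zero_add, ite_mul, zero_mul]
  · rw [← hall_rank_left_zero (fun _ b'' => p a * q b'') b]
    refine hall_congr fun b' b'' _ => ?_
    rw [hp.cop_eq, if_neg ha, add_zero, ite_mul, zero_mul]

theorem IsPrim.hmul_comm {p q : IsoClass F → ℂ} (hp : IsPrim p) (hq : IsPrim q) :
    hmul p q = hmul q p := by
  have hp0 : ∀ c : IsoClass F, c.rank = 0 → p c = 0 := fun c hc => by
    rw [eq_zero_of_rank hc, hp.zero]
  have hq0 : ∀ c : IsoClass F, c.rank = 0 → q c = 0 := fun c hc => by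
    rw [eq_zero_of_rank hc, hq.zero]
  have hr : IsPrim (hmul p q + (-1 : ℂ) • hmul q p) := by
    refine ⟨?_, fun a b ha hb => ?_⟩
    · rw [Pi.add_apply, Pi.smul_apply, hmul_zero_apply hp.zero, hmul_zero_apply hq.zero,
        smul_zero, add_zero]
    · rw [cop_add, cop_smul, hp.cop_hmul_prim hq ha hb, hq.cop_hmul_prim hp ha hb]
      ring
  funext c
  obtain ⟨M, rfl⟩ := exists_cls_eq c
  have h1 := hr.sum_hall_mul (fun a b => star (p a * q b))
    (fun a b ha => by rw [hp0 a ha, zero_mul, star_zero])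
    (fun a b hb => by rw [hq0 b hb, mul_zero, star_zero]) M.V
  have h2 := hr.sum_hall_mul (fun a b => star (q a * p b))
    (fun a b ha => by rw [hq0 a ha, zero_mul, star_zero])
    (fun a b hb => by rw [hp0 b hb, mul_zero, star_zero]) M.V
  simp only [← star_hall] at h1 h2
  have h3 : ∑ x : M.V →ₗ[F] M.V, (Complex.normSq
      ((hmul p q + (-1 : ℂ) • hmul q p) (EndObj.mk M.V x).cls) : ℂ) = 0 := by
    rw [← sub_self (0 : ℂ)]
    nth_rw 1 [← h1]
    rw [← h2, ← Finset.sum_sub_distrib]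
    refine Finset.sum_congr rfl fun x _ => ?_
    rw [← sub_mul, ← star_sub, Complex.normSq_eq_conj_mul_self]
    congr 2
    rw [Pi.add_apply, Pi.smul_apply, smul_eq_mul, neg_one_mul, ← sub_eq_add_neg]
    rfl
  have h4 : ∑ x : M.V →ₗ[F] M.V, Complex.normSq
      ((hmul p q + (-1 : ℂ) • hmul q p) (EndObj.mk M.V x).cls) = 0 := by exact_mod_cast h3
  rw [Finset.sum_eq_zero_iff_of_nonneg fun _ _ => Complex.normSq_nonneg _] at h4
  have h5 := Complex.normSq_eq_zero.1 (h4 M.x (Finset.mem_univ _))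
  rw [Pi.add_apply, Pi.smul_apply, smul_eq_mul, neg_one_mul, ← sub_eq_add_neg] at h5
  exact sub_eq_zero.1 h5

/-- The functions supported in dimension `n`. -/
def homogeneous (F : Type u) [Field F] (n : ℕ) : Submodule ℂ (IsoClass F → ℂ) where
  carrier := {h | ∀ c, c.rank ≠ n → h c = 0}
  zero_mem' := fun _ _ => rfl
  add_mem' := fun {f g} hf hg c hc => by rw [Pi.add_apply, hf c hc, hg c hc, add_zero]
  smul_mem' := fun z f hf c hc => by rw [Pi.smul_apply, hf c hc, smul_zero]

theorem hmul_mem_homogeneous {k l : ℕ} {f g : IsoClass F → ℂ} (hf : f ∈ homogeneous F k)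
    (hg : g ∈ homogeneous F l) : hmul f g ∈ homogeneous F (k + l) := by
  intro c hc
  rw [hmul, hall_congr (θ' := fun _ _ => 0) fun a b hab => ?_, hall_zero]
  by_cases ha : a.rank = k
  · rw [hg b (by omega), mul_zero]
  · rw [hf a ha, zero_mul]

theorem exists_cls_eq_of_rank {n : ℕ} [Finite F] {c : IsoClass F} (hc : c.rank = n) :
    ∃ x : (Fin n → F) →ₗ[F] (Fin n → F), (EndObj.mk (Fin n → F) x).cls = c := by
  obtain ⟨M, rfl⟩ := exists_cls_eq c
  let e : M.V ≃ₗ[F] (Fin n → F) := LinearEquiv.ofFinrankEq _ _ (by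
    rw [Module.finrank_fin_fun]; exact hc)
  refine ⟨e.toLinearMap ∘ₗ M.x ∘ₗ e.symm.toLinearMap, cls_eq (N := M) e.symm fun v => ?_⟩
  simp

open scoped Classical in
theorem hall_single_ne_zero {n : ℕ} [Finite F] {a b : IsoClass F} (h : a.rank + b.rank = n) :
    ∑ x : (Fin n → F) →ₗ[F] (Fin n → F), hall (fun a' b' => if a' = a ∧ b' = b then 1 else 0)
      (EndObj.mk (Fin n → F) x).cls ≠ 0 := by
  obtain ⟨A, rfl⟩ := exists_cls_eq a
  obtain ⟨B, rfl⟩ := exists_cls_eq b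
  obtain ⟨x₀, hx₀⟩ := exists_cls_eq_of_rank ((rank_ext A B 0).trans h)
  let θ : IsoClass F → IsoClass F → ℕ := fun a' b' => if a' = A.cls ∧ b' = B.cls then 1 else 0
  have h1 : ∀ M : EndObj F, hall (fun a' b' => if a' = A.cls ∧ b' = B.cls then 1 else 0) M.cls =
      ((∑ W : M.Sub, θ (M.sub W).cls (M.quo W).cls : ℕ) : ℂ) := by
    intro M
    rw [hall_cls]
    push_cast [θ]
    rfl
  have h2 : hall (fun a' b' => if a' = A.cls ∧ b' = B.cls then 1 else 0)
      (EndObj.mk (Fin n → F) x₀).cls ≠ 0 := by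
    rw [hx₀, h1, Nat.cast_ne_zero]
    let W : (ext A B 0).Sub := ⟨(LinearMap.inl F A.V B.V).range, by
      rintro _ ⟨v, rfl⟩
      exact ⟨A.x v, by ext <;> simp⟩⟩
    have hW1 : ((ext A B 0).sub W).cls = A.cls := cls_sub_eq (M := ext A B 0) _
      (LinearMap.inl F A.V B.V) LinearMap.inl_injective rfl fun v => by ext <;> simp
    have hW2 : ((ext A B 0).quo W).cls = B.cls := cls_quo_eq (M := ext A B 0) _
      (LinearMap.snd F A.V B.V) LinearMap.snd_surjective (LinearMap.ker_snd F A.V B.V)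
      fun v => rfl
    intro h0
    have h3 := (Finset.sum_eq_zero_iff.1 h0) W (Finset.mem_univ _)
    simp [θ, hW1, hW2] at h3
  intro h0
  rw [Fintype.sum_congr _ _ fun x => h1 (EndObj.mk (Fin n → F) x), ← Nat.cast_sum,
    Nat.cast_eq_zero, Finset.sum_eq_zero_iff] at h0
  apply h2
  rw [h1, h0 x₀ (Finset.mem_univ _), Nat.cast_zero]

/-- Evaluation at all endomorphisms of `Fⁿ`. -/
noncomputable def evalEnd (F : Type u) [Field F] [Finite F] (n : ℕ) :
    (IsoClass F → ℂ) →ₗ[ℂ] EuclideanSpace ℂ ((Fin n → F) →ₗ[F] (Fin n → F)) :=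
  (WithLp.linearEquiv 2 ℂ _).symm.toLinearMap ∘ₗ
    LinearMap.funLeft ℂ ℂ fun x => (EndObj.mk (Fin n → F) x).cls

theorem evalEnd_apply [Finite F] (n : ℕ) (f : IsoClass F → ℂ)
    (x : (Fin n → F) →ₗ[F] (Fin n → F)) :
    evalEnd F n f x = f (EndObj.mk (Fin n → F) x).cls := rfl

/-- In positive degrees the Hall algebra is spanned by products and primitive elements. -/
theorem homogeneous_le [Finite F] {n : ℕ} (hn : 0 < n) (L : Submodule ℂ (IsoClass F → ℂ))
    (h1 : ∀ p ∈ homogeneous F n, IsPrim p → p ∈ L)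
    (h2 : ∀ k l, 0 < k → 0 < l → k + l = n → ∀ f ∈ homogeneous F k, ∀ g ∈ homogeneous F l,
      hmul f g ∈ L) : homogeneous F n ≤ L := by
  classical
  let S : Submodule ℂ (IsoClass F → ℂ) := Submodule.span ℂ
    {h | ∃ k l, 0 < k ∧ 0 < l ∧ k + l = n ∧ ∃ f ∈ homogeneous F k, ∃ g ∈ homogeneous F l,
      hmul f g = h}
  have hSn : S ≤ homogeneous F n := Submodule.span_le.2 (by
    rintro _ ⟨k, l, -, -, rfl, f, hf, g, hg, rfl⟩
    exact hmul_mem_homogeneous hf hg)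
  have hSL : S ≤ L := Submodule.span_le.2 (by
    rintro _ ⟨k, l, hk, hl, hkl, f, hf, g, hg, rfl⟩
    exact h2 k l hk hl hkl f hf g hg)
  intro h hh
  obtain ⟨_, ⟨s, hs, rfl⟩, z, hz, hsz⟩ :=
    (S.map (evalEnd F n)).exists_add_mem_mem_orthogonal (evalEnd F n h)
  have hz' : evalEnd F n (h - s) = z := by rw [map_sub, hsz, add_sub_cancel_left]
  have hdeg : h - s ∈ homogeneous F n := Submodule.sub_mem _ hh (hSn hs)
  have hprim : IsPrim (h - s) := by
    refine ⟨hdeg _ (by rw [rank_zero]; omega), fun a b ha hb => ?_⟩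
    by_cases hab : a.rank + b.rank = n
    · have hmem : hmul (Pi.single a 1) (Pi.single b 1) ∈ S := Submodule.subset_span
        ⟨a.rank, b.rank, Nat.pos_of_ne_zero ha, Nat.pos_of_ne_zero hb, hab, _,
          fun c hc => Pi.single_eq_of_ne (fun h => hc (by rw [h])) _, _,
          fun c hc => Pi.single_eq_of_ne (fun h => hc (by rw [h])) _, rfl⟩
      have hin := (Submodule.mem_orthogonal _ _).1 hz _ (Submodule.mem_map_of_mem hmem)
      rw [← hz', PiLp.inner_apply] at hin
      simp only [evalEnd_apply, RCLike.inner_apply] at hin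
      have hstar : ∀ c, (starRingEnd ℂ) (hmul (Pi.single a 1) (Pi.single b 1) c) =
          hall (fun a' b' => if a' = a ∧ b' = b then 1 else 0) c := by
        intro c
        rw [starRingEnd_apply, hmul, star_hall]
        refine hall_congr fun a' b' _ => ?_
        by_cases h1 : a' = a <;> by_cases h2 : b' = b <;> simp [h1, h2]
      simp only [hstar, mul_comm ((h - s) _)] at hin
      rw [sum_hall_mul] at hin
      have hcop : ∀ c, hall (fun a' b' => (if a' = a ∧ b' = b then 1 else 0) *
          cop (h - s) a' b') c =
          hall (fun a' b' => if a' = a ∧ b' = b then 1 else 0) c * cop (h - s) a b := by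
        intro c
        rw [← hall_mul_right]
        refine hall_congr fun a' b' _ => ?_
        split_ifs with h
        · rw [h.1, h.2]
        · rw [zero_mul, zero_mul]
      simp only [hcop, ← Finset.sum_mul] at hin
      exact (mul_eq_zero.1 hin).resolve_left (hall_single_ne_zero hab)
    · rw [cop_congr (g := 0) fun c hc => hdeg c (by omega), cop_zero]
  have := L.add_mem (h1 _ hdeg hprim) (hSL hs)
  rwa [sub_add_cancel] at this

theorem hmul_comm_of_prim [Finite F] {g : IsoClass F → ℂ}
    (hg : ∀ p, IsPrim p → hmul p g = hmul g p) {n : ℕ} (hn : 0 < n) {f : IsoClass F → ℂ}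
    (hf : f ∈ homogeneous F n) : hmul f g = hmul g f := by
  induction n using Nat.strong_induction_on generalizing f with
  | _ n ih =>
    let L : Submodule ℂ (IsoClass F → ℂ) :=
      { carrier := {f | hmul f g = hmul g f}
        zero_mem' := by
          have h0 := smul_hmul 0 0 g
          have h1 := hmul_smul 0 g 0
          simp only [zero_smul] at h0 h1
          exact h0.trans h1.symm
        add_mem' := fun {a b} ha hb => by
          change hmul (a + b) g = hmul g (a + b)
          rw [add_hmul, hmul_add, ha, hb]
        smul_mem' := fun z a ha => by
          change hmul (z • a) g = hmul g (z • a)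
          rw [smul_hmul, hmul_smul, ha] }
    refine homogeneous_le hn L (fun p _ hp => hg p hp) (fun k l hk hl hkl f₁ hf₁ f₂ hf₂ => ?_) hf
    change hmul (hmul f₁ f₂) g = hmul g (hmul f₁ f₂)
    rw [hmul_assoc, ih l (by omega) hl hf₂, ← hmul_assoc, ih k (by omega) hk hf₁, hmul_assoc]

/-- The Hall algebra is commutative. -/
theorem hmul_comm [Finite F] {k l : ℕ} (hk : 0 < k) (hl : 0 < l) {f g : IsoClass F → ℂ}
    (hf : f ∈ homogeneous F k) (hg : g ∈ homogeneous F l) : hmul f g = hmul g f :=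
  hmul_comm_of_prim (fun _ hp =>
    (hmul_comm_of_prim (fun _ hq => hq.hmul_comm hp) hl hg).symm) hk hf

open scoped Classical in
/-- The unit of the Hall algebra. -/
noncomputable def one (F : Type u) [Field F] : IsoClass F → ℂ :=
  fun c => if c.rank = 0 then 1 else 0

theorem one_hmul (f : IsoClass F → ℂ) : hmul (one F) f = f := by
  classical
  funext c
  rw [← hall_rank_left_zero (fun _ b => f b) c]
  refine hall_congr fun a b _ => ?_
  rw [one, ite_mul, one_mul, zero_mul]

theorem hmul_one (f : IsoClass F → ℂ) : hmul f (one F) = f := by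
  classical
  funext c
  rw [← hall_rank_right_zero (fun a _ => f a) c]
  refine hall_congr fun a b _ => ?_
  rw [one, mul_ite, mul_one, mul_zero]

theorem antipode_one : antipode (one F) = one F := by
  classical
  funext c
  by_cases hc : c.rank = 0
  · exact antipode_of_rank_eq_zero _ hc
  · rw [antipode_of_rank_ne_zero _ hc, hall_congr (θ' := fun _ _ => 0), hall_zero, neg_zero, one,
      if_neg hc]
    intro a b _
    split_ifs with hb
    · rfl
    · have : (fun a' => cop (one F) a' b) = 0 := funext fun a' => by
        rw [cop_congr (f := one F) (g := 0) fun c hc => if_neg (by omega), cop_zero]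
        rfl
      rw [this]
      exact congrFun (map_zero (antipodeLinear F)) a

theorem IsPrim.antipode_eq {p : IsoClass F → ℂ} (hp : IsPrim p) : antipode p = -p := by
  have := hp.antipode_hmul (one F)
  rwa [one_hmul, antipode_one, hmul_one] at this

theorem antipode_hmul_swap [Finite F] {n : ℕ} (hn : 0 < n) {g : IsoClass F → ℂ}
    (hg : g ∈ homogeneous F n) (f : IsoClass F → ℂ) :
    antipode (hmul f g) = hmul (antipode g) (antipode f) := by
  induction n using Nat.strong_induction_on generalizing f g with
  | _ n ih =>
    let L : Submodule ℂ (IsoClass F → ℂ) :=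
      { carrier := {g | ∀ f, antipode (hmul f g) = hmul (antipode g) (antipode f)}
        zero_mem' := fun f => by
          have h0 := hmul_smul 0 f 0
          have h1 := smul_hmul 0 0 (antipode f)
          have h2 := antipode_smul (F := F) 0 0
          simp only [zero_smul] at h0 h1 h2
          rw [h0, h2, h1]
        add_mem' := fun {a b} ha hb f => by
          rw [hmul_add, antipode_add, antipode_add, add_hmul, ha, hb]
        smul_mem' := fun z a ha f => by
          rw [hmul_smul, antipode_smul, antipode_smul, smul_hmul, ha] }
    refine homogeneous_le hn L (fun p _ hp f => ?_) (fun k l hk hl hkl f₁ hf₁ f₂ hf₂ f => ?_) hg f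
    · rw [hp.antipode_hmul, hp.antipode_eq, ← neg_one_smul ℂ p, smul_hmul, neg_one_smul]
    · rw [← hmul_assoc, ih l (by omega) hl hf₂, ih k (by omega) hk hf₁,
        ih l (by omega) hl hf₂, hmul_assoc]

/-- The antipode is multiplicative. -/
theorem antipode_hmul [Finite F] {k l : ℕ} (hk : 0 < k) (hl : 0 < l) {f g : IsoClass F → ℂ}
    (hf : f ∈ homogeneous F k) (hg : g ∈ homogeneous F l) :
    antipode (hmul f g) = hmul (antipode f) (antipode g) := by
  rw [hmul_comm hk hl hf hg, antipode_hmul_swap hk hf]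

end IsoClass

section FlagTransitivity

variable {F V : Type*} [Field F] [AddCommGroup V] [Module F V] [FiniteDimensional F V]

theorem Submodule.exists_linearEquiv_map_eq {A B : Submodule F V}
    (h : Module.finrank F A = Module.finrank F B) :
    ∃ g : V ≃ₗ[F] V, A.map g.toLinearMap = B := by
  obtain ⟨A', hA⟩ := A.exists_isCompl
  obtain ⟨B', hB⟩ := B.exists_isCompl
  have h' : Module.finrank F A' = Module.finrank F B' := by
    have h1 := Submodule.finrank_add_eq_of_isCompl hA
    have h2 := Submodule.finrank_add_eq_of_isCompl hB
    omega
  refine ⟨(Submodule.prodEquivOfIsCompl A A' hA).symm.trans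
    (((LinearEquiv.ofFinrankEq A B h).prodCongr (LinearEquiv.ofFinrankEq A' B' h')).trans
      (Submodule.prodEquivOfIsCompl B B' hB)), ?_⟩
  refine Submodule.eq_of_le_of_finrank_eq ?_ ?_
  · rintro _ ⟨v, hv, rfl⟩
    have h1 : (Submodule.prodEquivOfIsCompl A A' hA).symm v = (⟨v, hv⟩, 0) :=
      Submodule.prodEquivOfIsCompl_symm_apply_left _ _ hA ⟨v, hv⟩
    simp only [LinearEquiv.coe_coe, LinearEquiv.trans_apply, h1, LinearEquiv.prodCongr_apply,
      map_zero, Submodule.coe_prodEquivOfIsCompl', Submodule.coe_zero, add_zero]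
    exact Subtype.mem _
  · rw [LinearEquiv.finrank_map_eq, h]

theorem Submodule.exists_linearEquiv_fixing_map_eq {W A B : Submodule F V} (hA : W ≤ A)
    (hB : W ≤ B) (h : Module.finrank F A = Module.finrank F B) :
    ∃ g : V ≃ₗ[F] V, (∀ w ∈ W, g w = w) ∧ A.map g.toLinearMap = B := by
  obtain ⟨W', hW⟩ := W.exists_isCompl
  have hdim : ∀ X : Submodule F V, W ≤ X → Module.finrank F (X.comap W'.subtype) +
      Module.finrank F W = Module.finrank F X := fun X hX => by
    have e : Module.finrank F (X.comap W'.subtype) = Module.finrank F (X ⊓ W' : Submodule F V) := by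
      rw [inf_comm, ← Submodule.map_comap_subtype]
      exact (Submodule.equivMapOfInjective _ W'.injective_subtype _).finrank_eq
    have h1 := Submodule.finrank_sup_add_finrank_inf_eq (X ⊓ W') W
    have h2 : X ⊓ W' ⊔ W = X := by
      rw [sup_comm, ← inf_comm, ← sup_inf_assoc_of_le W' hX, hW.sup_eq_top, top_inf_eq]
    have h3 : X ⊓ W' ⊓ W = ⊥ := by
      rw [inf_assoc, inf_comm W', hW.inf_eq_bot, inf_bot_eq]
    rw [h2, h3, finrank_bot] at h1
    omega
  have h' : Module.finrank F (A.comap W'.subtype) = Module.finrank F (B.comap W'.subtype) := by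
    have := hdim A hA
    have := hdim B hB
    omega
  obtain ⟨g, hg⟩ := Submodule.exists_linearEquiv_map_eq h'
  let G : V ≃ₗ[F] V := (Submodule.prodEquivOfIsCompl W W' hW).symm.trans
    (((LinearEquiv.refl F W).prodCongr g).trans (Submodule.prodEquivOfIsCompl W W' hW))
  have hG1 : ∀ w ∈ W, G w = w := fun w hw => by
    have h1 : (Submodule.prodEquivOfIsCompl W W' hW).symm w = (⟨w, hw⟩, 0) :=
      Submodule.prodEquivOfIsCompl_symm_apply_left _ _ hW ⟨w, hw⟩
    simp [G, h1]
  have hG2 : ∀ w : W', G w = g w := fun w => by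
    have h1 : (Submodule.prodEquivOfIsCompl W W' hW).symm w = (0, w) :=
      Submodule.prodEquivOfIsCompl_symm_apply_right _ _ hW w
    simp [G, h1]
  refine ⟨G, hG1, Submodule.eq_of_le_of_finrank_eq ?_ ?_⟩
  · rintro _ ⟨v, hv, rfl⟩
    obtain ⟨⟨w, w'⟩, rfl⟩ := (Submodule.prodEquivOfIsCompl W W' hW).surjective v
    rw [Submodule.coe_prodEquivOfIsCompl'] at hv ⊢
    have hw' : w' ∈ A.comap W'.subtype := by
      have := A.sub_mem hv (hA w.2)
      rwa [add_sub_cancel_left] at this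
    have h2 : g w' ∈ B.comap W'.subtype := by
      rw [← hg]; exact ⟨w', hw', rfl⟩
    rw [LinearEquiv.coe_coe, map_add, hG1 _ w.2, hG2]
    exact B.add_mem (hB w.2) h2
  · rw [LinearEquiv.finrank_map_eq, h]

theorem IsChain.eq_of_finrank_eq {C : Set (Submodule F V)} (hC : IsChain (· ≤ ·) C)
    {A B : Submodule F V} (hA : A ∈ C) (hB : B ∈ C)
    (h : Module.finrank F A = Module.finrank F B) : A = B := by
  rcases hC.total hA hB with h1 | h1
  · exact Submodule.eq_of_le_of_finrank_eq h1 h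
  · exact (Submodule.eq_of_le_of_finrank_eq h1 h.symm).symm

theorem IsChain.le_of_finrank_le {C : Set (Submodule F V)} (hC : IsChain (· ≤ ·) C)
    {A B : Submodule F V} (hA : A ∈ C) (hB : B ∈ C)
    (h : Module.finrank F A ≤ Module.finrank F B) : A ≤ B := by
  rcases hC.total hA hB with h1 | h1
  · exact h1
  · exact (Submodule.eq_of_le_of_finrank_le h1 h).ge

/-- The linear group acts transitively on the flags with given dimensions. -/
theorem IsChain.exists_linearEquiv_image_eq {C C' : Set (Submodule F V)}
    (hC : IsChain (· ≤ ·) C) (hC' : IsChain (· ≤ ·) C')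
    (h : (fun W : Submodule F V => Module.finrank F W) '' C =
      (fun W : Submodule F V => Module.finrank F W) '' C') :
    ∃ g : V ≃ₗ[F] V, (fun W => W.map g.toLinearMap) '' C = C' := by
  have key : ∀ j : ℕ, ∃ g : V ≃ₗ[F] V, ∀ W ∈ C, Module.finrank F W ≤ j →
      W.map g.toLinearMap ∈ C' := by
    have step : ∀ j : ℕ, (∃ g : V ≃ₗ[F] V, ∀ W ∈ C, Module.finrank F W < j →
        W.map g.toLinearMap ∈ C') → ∃ g : V ≃ₗ[F] V, ∀ W ∈ C, Module.finrank F W ≤ j →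
        W.map g.toLinearMap ∈ C' := by
      rintro j ⟨g, hg⟩
      by_cases hW : ∃ W ∈ C, Module.finrank F W = j
      · obtain ⟨W, hWC, hWj⟩ := hW
        obtain ⟨W', hWC', hWj'⟩ : j ∈ (fun W : Submodule F V => Module.finrank F W) '' C' :=
          h ▸ ⟨W, hWC, hWj⟩
        let X := sSup ((fun W => W.map g.toLinearMap) '' {U ∈ C | Module.finrank F U < j})
        obtain ⟨k, hk1, hk2⟩ := Submodule.exists_linearEquiv_fixing_map_eq
          (W := X) (A := W.map g.toLinearMap) (B := W') (by
            refine sSup_le ?_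
            rintro _ ⟨U, ⟨hU, hUj⟩, rfl⟩
            exact Submodule.map_mono (hC.le_of_finrank_le hU hWC (by omega))) (by
            refine sSup_le ?_
            rintro _ ⟨U, ⟨hU, hUj⟩, rfl⟩
            refine hC'.le_of_finrank_le (hg U hU hUj) hWC' ?_
            simp only at hWj' ⊢
            rw [LinearEquiv.finrank_map_eq]
            omega) (by
            simp only at hWj'
            rw [LinearEquiv.finrank_map_eq]
            omega)
        refine ⟨g.trans k, fun U hU hUj => ?_⟩
        rw [LinearEquiv.coe_trans, Submodule.map_comp]
        rcases hUj.lt_or_eq with hlt | heq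
        · have hle : U.map g.toLinearMap ≤ X := le_sSup ⟨U, ⟨hU, hlt⟩, rfl⟩
          have : (U.map g.toLinearMap).map k.toLinearMap = U.map g.toLinearMap := by
            refine Submodule.eq_of_le_of_finrank_eq ?_ (LinearEquiv.finrank_map_eq _ _)
            rintro _ ⟨v, hv, rfl⟩
            rw [LinearEquiv.coe_coe, hk1 v (hle hv)]
            exact hv
          rw [this]
          exact hg U hU hlt
        · rw [hC.eq_of_finrank_eq hU hWC (heq.trans hWj.symm), hk2]
          exact hWC'
      · refine ⟨g, fun U hU hUj => hg U hU (lt_of_le_of_ne hUj fun h => hW ⟨U, hU, h⟩)⟩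
    intro j
    induction j with
    | zero => exact step 0 ⟨LinearEquiv.refl F V, fun W _ h => absurd h (Nat.not_lt_zero _)⟩
    | succ j ih =>
      obtain ⟨g, hg⟩ := ih
      exact step (j + 1) ⟨g, fun W hW h => hg W hW (Nat.lt_succ_iff.1 h)⟩
  obtain ⟨g, hg⟩ := key (Module.finrank F V)
  refine ⟨g, Set.Subset.antisymm ?_ fun W' hW' => ?_⟩
  · rintro _ ⟨W, hW, rfl⟩
    exact hg W hW (Submodule.finrank_le W)
  · obtain ⟨W, hW, hd⟩ : Module.finrank F W' ∈ (fun W : Submodule F V => Module.finrank F W) '' C :=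
      h ▸ ⟨W', hW', rfl⟩
    refine ⟨W, hW, hC'.eq_of_finrank_eq (hg W hW (Submodule.finrank_le W)) hW' ?_⟩
    rw [LinearEquiv.finrank_map_eq]
    exact hd

end FlagTransitivity

section GLEquiv

variable {F : Type u} [Field F] {n : ℕ}

/-- The linear automorphism of `Fⁿ` given by an invertible matrix. -/
def glEquiv (g : GL (Fin n) F) : (Fin n → F) ≃ₗ[F] (Fin n → F) :=
  LinearEquiv.ofLinearMap g.val.toLin' g⁻¹.val.toLin'
    (by rw [← Matrix.toLin'_mul, Units.mul_inv, Matrix.toLin'_one])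
    (by rw [← Matrix.toLin'_mul, Units.inv_mul, Matrix.toLin'_one])

theorem glEquiv_apply (g : GL (Fin n) F) (v : Fin n → F) : glEquiv g v = g.val.mulVec v := rfl

theorem glEquiv_mul_apply (g h : GL (Fin n) F) (v : Fin n → F) :
    glEquiv (g * h) v = glEquiv g (glEquiv h v) := by
  simp [glEquiv_apply]

theorem exists_glEquiv_eq (e : (Fin n → F) ≃ₗ[F] (Fin n → F)) : ∃ g, glEquiv g = e := by
  refine ⟨⟨LinearMap.toMatrix' e.toLinearMap, LinearMap.toMatrix' e.symm.toLinearMap, ?_, ?_⟩, ?_⟩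
  · rw [← LinearMap.toMatrix'_comp, LinearEquiv.comp_coe, LinearEquiv.symm_trans_self]
    exact LinearMap.toMatrix'_id
  · rw [← LinearMap.toMatrix'_comp, LinearEquiv.comp_coe, LinearEquiv.self_trans_symm]
    exact LinearMap.toMatrix'_id
  · ext1 v
    rw [glEquiv_apply, ← Matrix.toLin'_apply, Matrix.toLin'_toMatrix']
    rfl

theorem map_glEquiv_mul (g h : GL (Fin n) F) (W : Submodule F (Fin n → F)) :
    W.map (glEquiv (g * h)).toLinearMap =
      (W.map (glEquiv h).toLinearMap).map (glEquiv g).toLinearMap := by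
  rw [← Submodule.map_comp]
  congr 1
  exact LinearMap.ext fun v => glEquiv_mul_apply g h v

theorem map_glEquiv_one (W : Submodule F (Fin n → F)) :
    W.map (glEquiv (1 : GL (Fin n) F)).toLinearMap = W := by
  have : (glEquiv (1 : GL (Fin n) F)).toLinearMap = LinearMap.id :=
    LinearMap.ext fun v => by simp [glEquiv_apply]
  rw [this, Submodule.map_id]

theorem map_glEquiv_inv_eq_iff (g h : GL (Fin n) F) (W : Submodule F (Fin n → F)) :
    W.map (glEquiv g⁻¹).toLinearMap = W.map (glEquiv h⁻¹).toLinearMap ↔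
      W.map (glEquiv (g * h⁻¹)).toLinearMap = W := by
  rw [map_glEquiv_mul]
  constructor
  · intro e
    rw [← e, ← map_glEquiv_mul, mul_inv_cancel, map_glEquiv_one]
  · intro e
    conv_lhs => rw [← e]
    rw [← map_glEquiv_mul, inv_mul_cancel, map_glEquiv_one]

theorem glEquiv_conj (g : GL (Fin n) F) (x : Matrix (Fin n) (Fin n) F) (v : Fin n → F) :
    glEquiv g (x.toLin' v) = (g.val * x * g⁻¹.val).toLin' (glEquiv g v) := by
  change g.val.mulVec (x.toLin' v) = (g.val * x * g⁻¹.val).toLin' (g.val.mulVec v)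
  rw [Matrix.toLin'_apply, Matrix.toLin'_apply, Matrix.mulVec_mulVec, Matrix.mulVec_mulVec,
    mul_assoc (g.val * x), Units.inv_mul, mul_one]

variable [Finite F]

/-- The object given by a square matrix. -/
abbrev EndObj.std (x : Matrix (Fin n) (Fin n) F) : EndObj F := ⟨Fin n → F, x.toLin'⟩

theorem cls_std_conj (g : GL (Fin n) F) (x : Matrix (Fin n) (Fin n) F) :
    (EndObj.std (g.val * x * g⁻¹.val)).cls = (EndObj.std x).cls := by
  symm
  refine EndObj.cls_eq (M := EndObj.std x) (N := EndObj.std _) (glEquiv g)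
    (glEquiv_conj g x)

theorem invFun_apply_eq_of_cls_eq (f : InvFun F n) {x y : Matrix (Fin n) (Fin n) F}
    (h : (EndObj.std x).cls = (EndObj.std y).cls) : f.val x = f.val y := by
  obtain ⟨e, he⟩ := EndObj.exists_of_cls_eq h
  obtain ⟨g, rfl⟩ := exists_glEquiv_eq e
  have h1 : g.val * x = y * g.val := by
    apply Matrix.toLin'.injective
    rw [Matrix.toLin'_mul, Matrix.toLin'_mul]
    exact LinearMap.ext he
  rw [← f.2 g x, h1, mul_assoc, Units.mul_inv, mul_one]

theorem exists_cls_std_eq {c : IsoClass F} (hc : c.rank = n) :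
    ∃ x : Matrix (Fin n) (Fin n) F, (EndObj.std x).cls = c := by
  obtain ⟨x, rfl⟩ := IsoClass.exists_cls_eq_of_rank hc
  refine ⟨LinearMap.toMatrix' x, ?_⟩
  rw [EndObj.std, Matrix.toLin'_toMatrix']

theorem rank_cls_std (x : Matrix (Fin n) (Fin n) F) : (EndObj.std x).cls.rank = n := by
  rw [IsoClass.rank_cls, Module.finrank_fin_fun]

open scoped Classical in
/-- An invariant function as a function on isomorphism classes, supported in dimension `n`. -/
noncomputable def toHall (f : InvFun F n) (c : IsoClass F) : ℂ :=
  if h : ∃ x : Matrix (Fin n) (Fin n) F, (EndObj.std x).cls = c then f.val h.choose else 0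

theorem toHall_std (f : InvFun F n) (x : Matrix (Fin n) (Fin n) F) :
    toHall f (EndObj.std x).cls = f.val x := by
  have h : ∃ y : Matrix (Fin n) (Fin n) F, (EndObj.std y).cls = (EndObj.std x).cls := ⟨x, rfl⟩
  rw [toHall, dif_pos h]
  exact invFun_apply_eq_of_cls_eq f h.choose_spec

theorem toHall_mem (f : InvFun F n) : toHall f ∈ IsoClass.homogeneous F n := by
  intro c hc
  refine dif_neg ?_
  rintro ⟨x, rfl⟩
  exact hc (rank_cls_std x)

/-- The restriction of a function on isomorphism classes to matrices of a given size. -/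
def ofHall (F : Type u) [Field F] [Finite F] (n : ℕ) : (IsoClass F → ℂ) →ₗ[ℂ] InvFun F n where
  toFun h := ⟨fun x => h (EndObj.std x).cls, fun g x => congrArg h (cls_std_conj g x)⟩
  map_add' _ _ := rfl
  map_smul' _ _ := rfl

theorem ofHall_apply (h : IsoClass F → ℂ) (x : Matrix (Fin n) (Fin n) F) :
    (ofHall F n h).val x = h (EndObj.std x).cls := rfl

theorem ofHall_toHall (f : InvFun F n) : ofHall F n (toHall f) = f :=
  Subtype.ext (funext fun x => toHall_std f x)

theorem toHall_ofHall {h : IsoClass F → ℂ} (hh : h ∈ IsoClass.homogeneous F n) :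
    toHall (ofHall F n h) = h := by
  funext c
  by_cases hc : c.rank = n
  · obtain ⟨x, rfl⟩ := exists_cls_std_eq hc
    exact toHall_std _ x
  · rw [hh c hc, toHall_mem (ofHall F n h) c hc]

end GLEquiv

namespace ParabolicPair

variable {F : Type u} [Field F] {n : ℕ} (Q : ParabolicPair F n)

/-- The sum of the summands with index in `T`. -/
def part (T : Finset (Fin Q.r)) : Submodule F (Fin n → F) where
  carrier := {v | ∀ j ∉ T, (Q.e j).mulVec v = 0}
  zero_mem' := fun _ _ => Matrix.mulVec_zero _
  add_mem' := fun {v w} hv hw j hj => by rw [Matrix.mulVec_add, hv j hj, hw j hj, add_zero]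
  smul_mem' := fun c v hv j hj => by rw [Matrix.mulVec_smul, hv j hj, smul_zero]

variable {Q}

theorem sum_mulVec (v : Fin n → F) : ∑ i, (Q.e i).mulVec v = v := by
  rw [← Matrix.sum_mulVec, Q.idem.complete, Matrix.one_mulVec]

theorem sum_mulVec_of_mem {T : Finset (Fin Q.r)} {v : Fin n → F} (hv : v ∈ Q.part T) :
    ∑ i ∈ T, (Q.e i).mulVec v = v := by
  conv_rhs => rw [← sum_mulVec (Q := Q) v]
  exact Finset.sum_subset (Finset.subset_univ _) fun i _ hi => hv i hi

theorem mulVec_mem_part {T : Finset (Fin Q.r)} {i : Fin Q.r} (hi : i ∈ T) (v : Fin n → F) :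
    (Q.e i).mulVec v ∈ Q.part T := by
  intro j hj
  rw [Matrix.mulVec_mulVec, Q.idem.ortho (show j ≠ i from fun h => hj (h ▸ hi)), Matrix.zero_mulVec]

theorem mul_mul_eq_zero_iff {i j : Fin Q.r} {A : Matrix (Fin n) (Fin n) F} :
    Q.e j * A * Q.e i = 0 ↔ ∀ v, (Q.e j).mulVec (A.mulVec ((Q.e i).mulVec v)) = 0 := by
  simp only [Matrix.mulVec_mulVec, ← mul_assoc]
  constructor
  · intro h v
    rw [h, Matrix.zero_mulVec]
  · intro h
    exact Matrix.mulVec_injective (funext fun v => by rw [h, Matrix.zero_mulVec])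

theorem mulVec_mem_part_iff {T T' : Finset (Fin Q.r)} {A : Matrix (Fin n) (Fin n) F} :
    (∀ v ∈ Q.part T, A.mulVec v ∈ Q.part T') ↔ ∀ i ∈ T, ∀ j ∉ T', Q.e j * A * Q.e i = 0 := by
  simp only [mul_mul_eq_zero_iff]
  constructor
  · intro h i hi j hj v
    exact h _ (mulVec_mem_part hi v) j hj
  · intro h v hv j hj
    rw [← sum_mulVec_of_mem hv, Matrix.mulVec_sum, Matrix.mulVec_sum]
    exact Finset.sum_eq_zero fun i hi => h i hi j hj v

theorem mem_lieP_iff {A : Matrix (Fin n) (Fin n) F} : A ∈ Q.lieP ↔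
    ∀ i, ∀ v ∈ Q.part (Finset.Iic i), A.mulVec v ∈ Q.part (Finset.Iic i) := by
  simp only [mulVec_mem_part_iff, Finset.mem_Iic, not_le]
  exact ⟨fun h i k hk j hj => h k j (hk.trans_lt hj), fun h i j hij => h i i le_rfl j hij⟩

theorem mem_lieU_iff {A : Matrix (Fin n) (Fin n) F} : A ∈ Q.lieU ↔
    ∀ i, ∀ v ∈ Q.part (Finset.Iic i), A.mulVec v ∈ Q.part (Finset.Iio i) := by
  simp only [mulVec_mem_part_iff, Finset.mem_Iic, Finset.mem_Iio, not_lt]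
  exact ⟨fun h i k hk j hj => h k j (hk.trans hj), fun h i j hij => h i i le_rfl j hij⟩

theorem part_mono {T T' : Finset (Fin Q.r)} (h : T ⊆ T') : Q.part T ≤ Q.part T' :=
  fun _ hv j hj => hv j fun hj' => hj (h hj')

theorem part_univ : Q.part Finset.univ = ⊤ :=
  eq_top_iff.2 fun _ _ j hj => absurd (Finset.mem_univ j) hj

theorem part_empty : Q.part ∅ = ⊥ :=
  eq_bot_iff.2 fun v hv => by
    rw [Submodule.mem_bot, ← sum_mulVec_of_mem hv, Finset.sum_empty]

theorem finrank_part (T : Finset (Fin Q.r)) :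
    Module.finrank F (Q.part T) = ∑ i ∈ T, (Q.e i).rank := by
  classical
  induction T using Finset.induction_on with
  | empty => rw [part_empty, finrank_bot, Finset.sum_empty]
  | insert a T ha ih =>
    have h1 := Submodule.finrank_sup_add_finrank_inf_eq (LinearMap.range (Q.e a).mulVecLin)
      (Q.part T)
    have h2 : LinearMap.range (Q.e a).mulVecLin ⊔ Q.part T = Q.part (insert a T) := by
      apply le_antisymm
      · refine sup_le ?_ (part_mono (Finset.subset_insert a T))
        rintro _ ⟨v, rfl⟩
        exact mulVec_mem_part (Finset.mem_insert_self a T) v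
      · intro v hv
        rw [← sum_mulVec_of_mem hv, Finset.sum_insert ha]
        refine Submodule.add_mem_sup ⟨v, rfl⟩ (Submodule.sum_mem _ fun i hi => ?_)
        exact mulVec_mem_part hi v
    have h3 : LinearMap.range (Q.e a).mulVecLin ⊓ Q.part T = ⊥ := by
      rw [eq_bot_iff]
      rintro _ ⟨⟨v, rfl⟩, hv⟩
      have h4 := hv a ha
      rw [Matrix.mulVecLin_apply, Matrix.mulVec_mulVec, Q.idem.idem a] at h4
      exact h4
    rw [h2, h3, finrank_bot, add_zero, ih] at h1
    rw [Finset.sum_insert ha, h1]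
    rfl

theorem mem_grpP_iff {g : GL (Fin n) F} : g ∈ Q.grpP ↔
    ∀ i, (Q.part (Finset.Iic i)).map (glEquiv g).toLinearMap = Q.part (Finset.Iic i) := by
  have h : g ∈ Q.grpP ↔ g.val ∈ Q.lieP ∧ g⁻¹.val ∈ Q.lieP := Iff.rfl
  rw [h]
  constructor
  · rintro ⟨h1, -⟩ i
    refine Submodule.eq_of_le_of_finrank_eq ?_ (LinearEquiv.finrank_map_eq _ _)
    rintro _ ⟨v, hv, rfl⟩
    exact mem_lieP_iff.1 h1 i v hv
  · intro h
    refine ⟨mem_lieP_iff.2 fun i v hv => ?_, mem_lieP_iff.2 fun i v hv => ?_⟩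
    · rw [← h i]
      exact ⟨v, hv, rfl⟩
    · rw [← h i] at hv
      obtain ⟨w, hw, rfl⟩ := hv
      have : g⁻¹.val.mulVec (glEquiv g w) = w := by
        rw [glEquiv_apply, Matrix.mulVec_mulVec, Units.inv_mul, Matrix.one_mulVec]
      rw [LinearEquiv.coe_coe, this]
      exact hw

theorem sub_proj_mem_lieU {A : Matrix (Fin n) (Fin n) F} (hA : A ∈ Q.lieP) :
    A - (Q.proj A).val ∈ Q.lieU := by
  intro i j hij
  rcases hij.lt_or_eq with h | rfl
  · rw [mul_sub, sub_mul, hA i j h, zero_sub, neg_eq_zero]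
    exact (Q.proj A).2 i j h.ne
  · have h2 : Q.e i * (Q.proj A).val * Q.e i = Q.e i * A * Q.e i := by
      change Q.e i * (∑ k, Q.e k * A * Q.e k) * Q.e i = _
      rw [Finset.mul_sum, Finset.sum_mul, Finset.sum_eq_single i]
      · rw [mul_assoc (Q.e i), mul_assoc (Q.e i * A), Q.idem.idem i, ← mul_assoc, ← mul_assoc,
          Q.idem.idem i]
      · intro k _ hk
        rw [mul_assoc (Q.e k), ← mul_assoc (Q.e i), Q.idem.ortho hk.symm, zero_mul, zero_mul]
      · intro h
        exact absurd (Finset.mem_univ _) h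
    rw [mul_sub, sub_mul, h2, sub_self]

theorem isUnit_one_add_of_mem_lieU {A : Matrix (Fin n) (Fin n) F} (hA : A ∈ Q.lieU) :
    IsUnit (1 + A) := by
  rw [← Matrix.mulVec_injective_iff_isUnit]
  have key : ∀ v, (1 + A).mulVec v = 0 → v = 0 := by
    intro v hv
    rw [Matrix.add_mulVec, Matrix.one_mulVec] at hv
    have h1 : ∀ m : ℕ, ∀ j : Fin Q.r, Q.r ≤ m + j.val → (Q.e j).mulVec v = 0 := by
      intro m
      induction m with
      | zero => intro j hj; omega
      | succ m ih =>
        intro j hj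
        have h2 := congrArg (Q.e j).mulVec hv
        rw [Matrix.mulVec_add, Matrix.mulVec_zero, ← sum_mulVec (Q := Q) v, Matrix.mulVec_sum,
          Matrix.mulVec_sum, Matrix.mulVec_sum, ← Matrix.mulVec_sum] at h2
        rw [sum_mulVec, Finset.sum_eq_zero, add_zero] at h2
        · exact h2
        · intro i _
          rcases le_or_gt i j with hij | hij
          · exact mul_mul_eq_zero_iff.1 (hA i j hij) v
          · rw [ih i (by have : j.val < i.val := hij; omega), Matrix.mulVec_zero,
              Matrix.mulVec_zero]
    rw [← sum_mulVec (Q := Q) v]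
    exact Finset.sum_eq_zero fun j _ => h1 Q.r j (Nat.le_add_right _ _)
  intro v w hvw
  rw [← sub_eq_zero]
  apply key
  rw [Matrix.mulVec_sub]
  exact sub_eq_zero.2 hvw

theorem card_grpU : Nat.card Q.grpU = Nat.card Q.lieU := by
  refine Nat.card_congr (Equiv.ofBijective
    (fun g : Q.grpU => (⟨g.1.val - 1, g.2⟩ : Q.lieU)) ⟨?_, ?_⟩)
  · intro g h hgh
    have h1 : g.1.val - 1 = h.1.val - 1 := congrArg Subtype.val hgh
    exact Subtype.ext (Units.ext (sub_left_injective h1))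
  · rintro ⟨A, hA⟩
    obtain ⟨g, hg⟩ := isUnit_one_add_of_mem_lieU hA
    have h1 : g.val - 1 = A := by rw [hg, add_sub_cancel_left]
    exact ⟨⟨g, by change g.val - 1 ∈ Q.lieU; rw [h1]; exact hA⟩, Subtype.ext h1⟩

end ParabolicPair

section HcProd

variable {F : Type u} [Field F] {k l : ℕ}

/-- The span of the first `k` coordinate vectors. -/
def firstCoords (F : Type u) [Field F] (k l : ℕ) : Submodule F (Fin (k + l) → F) :=
  (LinearMap.funLeft F F (Fin.natAdd k : Fin l → Fin (k + l))).ker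

theorem mem_firstCoords {v : Fin (k + l) → F} :
    v ∈ firstCoords F k l ↔ ∀ i : Fin l, v (Fin.natAdd k i) = 0 := by
  rw [firstCoords, LinearMap.mem_ker]
  exact funext_iff

theorem blockPair_part_zero :
    (blockPair F k l).part (Finset.Iic (0 : Fin 2)) = firstCoords F k l := by
  ext v
  rw [mem_firstCoords]
  change (∀ j : Fin 2, j ∉ Finset.Iic (0 : Fin 2) →
    (Matrix.diagonal fun t => if Fin.addCases (fun _ : Fin k => (0 : Fin 2))
      (fun _ : Fin l => 1) t = j then (1 : F) else 0).mulVec v = 0) ↔ _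
  constructor
  · intro h i
    have := congrFun (h 1 (by decide)) (Fin.natAdd k i)
    simpa [Matrix.mulVec_diagonal] using this
  · intro h j hj
    have hj1 : j = 1 := by
      fin_cases j
      · exact absurd (by decide) hj
      · rfl
    subst hj1
    funext t
    rw [Matrix.mulVec_diagonal]
    refine Fin.addCases (fun i => ?_) (fun i => ?_) t
    · simp
    · simp [h i]

theorem blockPair_part_one :
    (blockPair F k l).part (Finset.Iic (1 : Fin 2)) = ⊤ := by
  have : Finset.Iic (1 : Fin 2) = Finset.univ := by decide
  exact (congrArg (blockPair F k l).part this).trans ParabolicPair.part_univ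

theorem mem_blockPair_lieP_iff {A : Matrix (Fin (k + l)) (Fin (k + l)) F} :
    A ∈ (blockPair F k l).lieP ↔ ∀ v ∈ firstCoords F k l, A.toLin' v ∈ firstCoords F k l := by
  rw [ParabolicPair.mem_lieP_iff, ← blockPair_part_zero]
  constructor
  · intro h
    exact h (0 : Fin 2)
  · intro h i
    change Fin 2 at i
    fin_cases i
    · exact h
    · intro v _
      change _ ∈ (blockPair F k l).part (Finset.Iic (1 : Fin 2))
      rw [blockPair_part_one]
      trivial

theorem mem_blockPair_grpP_iff {g : GL (Fin (k + l)) F} : g ∈ (blockPair F k l).grpP ↔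
    (firstCoords F k l).map (glEquiv g).toLinearMap = firstCoords F k l := by
  rw [ParabolicPair.mem_grpP_iff, ← blockPair_part_zero]
  constructor
  · intro h
    exact h (0 : Fin 2)
  · intro h i
    change Fin 2 at i
    fin_cases i
    · exact h
    · change ((blockPair F k l).part (Finset.Iic (1 : Fin 2))).map _ =
        (blockPair F k l).part (Finset.Iic (1 : Fin 2))
      rw [blockPair_part_one]
      exact Submodule.map_top _ |>.trans (LinearEquiv.range _)

theorem finrank_firstCoords : Module.finrank F (firstCoords F k l) = k := by
  have h1 := LinearMap.finrank_range_add_finrank_ker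
    (LinearMap.funLeft F F (Fin.natAdd k : Fin l → Fin (k + l)))
  rw [LinearMap.range_eq_top.2 (LinearMap.funLeft_surjective_of_injective F F _
    (Fin.natAdd_injective _ _)), finrank_top, Module.finrank_fin_fun, Module.finrank_fin_fun] at h1
  rw [firstCoords]
  omega

theorem proj_submatrix_castAdd (A : Matrix (Fin (k + l)) (Fin (k + l)) F) :
    ((blockPair F k l).proj A).val.submatrix (Fin.castAdd l) (Fin.castAdd l) =
      A.submatrix (Fin.castAdd l) (Fin.castAdd l) := by
  ext i j
  change (∑ t : Fin 2, (Matrix.diagonal fun s => if Fin.addCases (fun _ : Fin k => (0 : Fin 2))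
      (fun _ : Fin l => 1) s = t then (1 : F) else 0) * A * (Matrix.diagonal fun s =>
      if Fin.addCases (fun _ : Fin k => (0 : Fin 2)) (fun _ : Fin l => 1) s = t then (1 : F)
        else 0)) (Fin.castAdd l i) (Fin.castAdd l j) = _
  rw [Matrix.sum_apply, Fin.sum_univ_two]
  simp [Matrix.mul_diagonal, Matrix.diagonal_mul]

theorem proj_submatrix_natAdd (A : Matrix (Fin (k + l)) (Fin (k + l)) F) :
    ((blockPair F k l).proj A).val.submatrix (Fin.natAdd k) (Fin.natAdd k) =
      A.submatrix (Fin.natAdd k) (Fin.natAdd k) := by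
  ext i j
  change (∑ t : Fin 2, (Matrix.diagonal fun s => if Fin.addCases (fun _ : Fin k => (0 : Fin 2))
      (fun _ : Fin l => 1) s = t then (1 : F) else 0) * A * (Matrix.diagonal fun s =>
      if Fin.addCases (fun _ : Fin k => (0 : Fin 2)) (fun _ : Fin l => 1) s = t then (1 : F)
        else 0)) (Fin.natAdd k i) (Fin.natAdd k j) = _
  rw [Matrix.sum_apply, Fin.sum_univ_two]
  simp [Matrix.mul_diagonal, Matrix.diagonal_mul]

variable [Finite F]

theorem cls_std_sub_firstCoords (A : Matrix (Fin (k + l)) (Fin (k + l)) F)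
    (h : ∀ v ∈ firstCoords F k l, A.toLin' v ∈ firstCoords F k l) :
    ((EndObj.std A).sub ⟨firstCoords F k l, h⟩).cls =
      (EndObj.std (A.submatrix (Fin.castAdd l) (Fin.castAdd l))).cls := by
  have e1 : ∀ (v : Fin k → F) (i : Fin k),
      Function.ExtendByZero.linearMap F (Fin.castAdd l) v (Fin.castAdd l i) = v i := fun v i =>
    (Fin.castAdd_injective k l).extend_apply _ _ i
  have e2 : ∀ (v : Fin k → F) (i : Fin l),
      Function.ExtendByZero.linearMap F (Fin.castAdd l) v (Fin.natAdd k i) = 0 := fun v i =>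
    Function.extend_apply' _ _ _ (by
      rintro ⟨j, hj⟩
      have := congrArg Fin.val hj
      simp at this
      omega)
  have hmem : ∀ v : Fin k → F, Function.ExtendByZero.linearMap F (Fin.castAdd l) v ∈
      firstCoords F k l := fun v => mem_firstCoords.2 (e2 v)
  refine EndObj.cls_sub_eq (M := EndObj.std A) (N := EndObj.std _) _
    (Function.ExtendByZero.linearMap F (Fin.castAdd l)) ?_ ?_ ?_
  · intro v w hvw
    funext i
    rw [← e1 v, ← e1 w, hvw]
  · apply le_antisymm
    · rintro _ ⟨v, rfl⟩
      exact hmem v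
    · intro v hv
      refine ⟨fun i => v (Fin.castAdd l i), ?_⟩
      funext t
      refine Fin.addCases (fun i => ?_) (fun i => ?_) t
      · rw [e1]
      · rw [e2, mem_firstCoords.1 hv]
  · intro v
    funext t
    refine Fin.addCases (fun i => ?_) (fun i => ?_) t
    · rw [e1]
      simp only [Matrix.toLin'_apply, Matrix.mulVec, dotProduct, Fin.sum_univ_add, e1, e2,
        mul_zero, Finset.sum_const_zero, add_zero, Matrix.submatrix_apply]
    · rw [e2]
      exact (mem_firstCoords.1 (h _ (hmem v)) i).symm

theorem cls_std_quo_firstCoords (A : Matrix (Fin (k + l)) (Fin (k + l)) F)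
    (h : ∀ v ∈ firstCoords F k l, A.toLin' v ∈ firstCoords F k l) :
    ((EndObj.std A).quo ⟨firstCoords F k l, h⟩).cls =
      (EndObj.std (A.submatrix (Fin.natAdd k) (Fin.natAdd k))).cls := by
  refine EndObj.cls_quo_eq (M := EndObj.std A) (N := EndObj.std _) _
    (LinearMap.funLeft F F (Fin.natAdd k)) (LinearMap.funLeft_surjective_of_injective F F _
    (Fin.natAdd_injective _ _)) rfl ?_
  intro v
  funext i
  have hz : ∀ (i : Fin l) (j : Fin k), A (Fin.natAdd k i) (Fin.castAdd l j) = 0 := by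
    intro i j
    have h1 := mem_firstCoords.1 (h (Pi.single (Fin.castAdd l j) 1) (mem_firstCoords.2 fun i => by
      rw [Pi.single_apply, if_neg]
      intro hj
      have := congrArg Fin.val hj
      simp at this
      omega)) i
    simpa using h1
  simp only [LinearMap.funLeft_apply, Matrix.toLin'_apply, Matrix.mulVec, dotProduct,
    Fin.sum_univ_add, hz, zero_mul, Finset.sum_const_zero, zero_add, Matrix.submatrix_apply]

end HcProd

theorem hall_cls_std {F : Type u} [Field F] [Finite F] {n : ℕ}
    (θ : IsoClass F → IsoClass F → ℂ) (x : Matrix (Fin n) (Fin n) F) :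
    IsoClass.hall θ (EndObj.std x).cls =
      ∑ W : Submodule F (Fin n → F), IsoClass.stableTerm θ (EndObj.std x) W :=
  IsoClass.hall_cls_eq_sum θ (EndObj.std x)

section HcProd

variable {F : Type u} [Field F] [Fintype F] [DecidableEq F] {k l : ℕ}

open scoped Classical in
theorem hcProd_apply (f₁ : InvFun F k) (f₂ : InvFun F l)
    (x : Matrix (Fin (k + l)) (Fin (k + l)) F) :
    (hcProd f₁ f₂).val x = IsoClass.hmul (toHall f₁) (toHall f₂) (EndObj.std x).cls := by
  let θ : IsoClass F → IsoClass F → ℂ := fun a b => toHall f₁ a * toHall f₂ b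
  have hterm : ∀ A : Matrix (Fin (k + l)) (Fin (k + l)) F,
      IsoClass.stableTerm θ (EndObj.std A) (firstCoords F k l) =
        if A ∈ (blockPair F k l).lieP then boxProd f₁ f₂ ((blockPair F k l).proj A) else 0 := by
    intro A
    by_cases hA : A ∈ (blockPair F k l).lieP
    · have hA' := mem_blockPair_lieP_iff.1 hA
      rw [if_pos hA, IsoClass.stableTerm, dif_pos hA', cls_std_sub_firstCoords,
        cls_std_quo_firstCoords, boxProd, proj_submatrix_castAdd, proj_submatrix_natAdd]
      simp only [θ, toHall_std]
    · rw [if_neg hA, IsoClass.stableTerm, dif_neg fun h => hA (mem_blockPair_lieP_iff.2 h)]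
  have hg : ∀ g : GL (Fin (k + l)) F, IsoClass.stableTerm θ (EndObj.std x)
      ((firstCoords F k l).map (glEquiv g⁻¹).toLinearMap) =
      if g.val * x * g⁻¹.val ∈ (blockPair F k l).lieP then
        boxProd f₁ f₂ ((blockPair F k l).proj (g.val * x * g⁻¹.val)) else 0 := by
    intro g
    rw [← hterm]
    have h := IsoClass.stableTerm_map θ (M := EndObj.std x)
      (N := EndObj.std (g.val * x * g⁻¹.val)) (glEquiv g) (glEquiv_conj g x)
      ((firstCoords F k l).map (glEquiv g⁻¹).toLinearMap)
    rw [← map_glEquiv_mul, mul_inv_cancel, map_glEquiv_one] at h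
    exact h.symm
  have hsum := sum_eq_card_mul_sum_image (blockPair F k l).grpP
    (fun g : GL (Fin (k + l)) F => (firstCoords F k l).map (glEquiv g⁻¹).toLinearMap)
    (fun g h => (map_glEquiv_inv_eq_iff g h _).trans mem_blockPair_grpP_iff.symm)
    (IsoClass.stableTerm θ (EndObj.std x))
  have h0 : (Nat.card (blockPair F k l).grpP : ℂ) ≠ 0 := by exact_mod_cast Nat.card_pos.ne'
  simp only [hg] at hsum
  have hval : (hcProd f₁ f₂).val x = (Nat.card (blockPair F k l).grpP : ℂ)⁻¹ *
      ∑ g : GL (Fin (k + l)) F, if g.val * x * g⁻¹.val ∈ (blockPair F k l).lieP then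
        boxProd f₁ f₂ ((blockPair F k l).proj (g.val * x * g⁻¹.val)) else 0 := rfl
  rw [hval, hsum, inv_mul_cancel_left₀ h0]
  refine Eq.trans ?_ (hall_cls_std θ x).symm
  refine Finset.sum_subset (Finset.subset_univ _) fun W _ hW => ?_
  by_cases h : ∀ v ∈ W, x.toLin' v ∈ W
  · refine (dif_pos h).trans ?_
    refine mul_eq_zero_of_left (toHall_mem f₁ _ fun hr => hW ?_) _
    have hr' : Module.finrank F W = k := hr
    obtain ⟨e, he⟩ := Submodule.exists_linearEquiv_map_eq (A := firstCoords F k l) (B := W)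
      ((finrank_firstCoords (F := F) (k := k) (l := l)).trans hr'.symm)
    obtain ⟨g, rfl⟩ := exists_glEquiv_eq e
    exact Finset.mem_image.2 ⟨g⁻¹, Finset.mem_univ _, by rw [inv_inv]; exact he⟩
  · exact dif_neg h

theorem toHall_hcProd (f₁ : InvFun F k) (f₂ : InvFun F l) :
    toHall (hcProd f₁ f₂) = IsoClass.hmul (toHall f₁) (toHall f₂) := by
  rw [← toHall_ofHall (IsoClass.hmul_mem_homogeneous (toHall_mem f₁) (toHall_mem f₂))]
  congr 1
  exact Subtype.ext (funext fun x => hcProd_apply f₁ f₂ x)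

end HcProd

theorem avg_add_unipotent_std {F : Type u} [Field F] [Finite F] {n : ℕ} (f : InvFun F n)
    (A : Matrix (Fin n) (Fin n) F) (W : (EndObj.std A).Sub) :
    (avg fun t : ((Fin n → F) ⧸ W.1) →ₗ[F] W.1 =>
      f.val (A + LinearMap.toMatrix' (W.1.subtype ∘ₗ t ∘ₗ W.1.mkQ))) =
      IsoClass.cop (toHall f) ((EndObj.std A).sub W).cls ((EndObj.std A).quo W).cls := by
  rw [← IsoClass.avg_add_unipotent]
  congr 1
  funext t
  rw [← toHall_std f, EndObj.std, map_add, Matrix.toLin'_toMatrix']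

/-- Homogeneous primitive elements give pre-cuspidal functions. -/
theorem isPrecuspidal_of_isPrim {F : Type u} [Field F] [Fintype F] [DecidableEq F] {n : ℕ}
    {f : InvFun F n} (hf : IsoClass.IsPrim (toHall f)) : IsPrecuspidal f := by
  classical
  intro Q hQ
  obtain ⟨i, h1, h2⟩ : ∃ i, Q.part (Finset.Iic i) ≠ ⊥ ∧ Q.part (Finset.Iic i) ≠ ⊤ := by
    by_contra! hcon
    refine hQ (eq_top_iff.2 fun g _ => ParabolicPair.mem_grpP_iff.2 fun i => ?_)
    by_cases hi : Q.part (Finset.Iic i) = ⊥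
    · rw [hi, Submodule.map_bot]
    · rw [hcon i hi, Submodule.map_top]
      exact LinearEquiv.range _
  set W := Q.part (Finset.Iic i) with hW
  let u : (((Fin n → F) ⧸ W) →ₗ[F] W) → Matrix (Fin n) (Fin n) F := fun t =>
    LinearMap.toMatrix' (W.subtype ∘ₗ t ∘ₗ W.mkQ)
  have hu : ∀ t v, (u t).mulVec v = (t (W.mkQ v) : W) := fun t v => by
    rw [← Matrix.toLin'_apply, Matrix.toLin'_toMatrix']
    rfl
  have huU : ∀ t, u t ∈ Q.lieU := fun t => ParabolicPair.mem_lieU_iff.2 fun k v hv => by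
    rw [hu]
    rcases le_or_gt k i with hk | hk
    · have hv' : v ∈ W := ParabolicPair.part_mono (Finset.Iic_subset_Iic.2 hk) hv
      rw [Submodule.mkQ_apply, (Submodule.Quotient.mk_eq_zero _).2 hv', map_zero]
      exact Submodule.zero_mem _
    · refine ParabolicPair.part_mono (fun j hj => ?_) (t (W.mkQ v)).2
      exact Finset.mem_Iio.2 ((Finset.mem_Iic.1 hj).trans_lt hk)
  funext x
  let S : ℂ := ∑ y : Matrix (Fin n) (Fin n) F, if y ∈ Q.lieU then f.val (x.val + y) else 0
  have hS : ∀ t, S = ∑ y : Matrix (Fin n) (Fin n) F,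
      if y ∈ Q.lieU then f.val (x.val + y + u t) else 0 := by
    intro t
    symm
    refine Fintype.sum_equiv (Equiv.addRight (u t)) _ _ fun y => ?_
    rw [Equiv.coe_addRight, add_assoc]
    refine if_congr ?_ rfl rfl
    exact (Submodule.add_mem_iff_left _ (huU t)).symm
  have hS0 : S = 0 := by
    rw [← avg_const (α := ((Fin n → F) ⧸ W) →ₗ[F] W) S, funext hS, avg_sum]
    refine Finset.sum_eq_zero fun y _ => ?_
    split_ifs with hy
    · have hst : ∀ v ∈ W, (x.val + y).toLin' v ∈ W := by
        have hP : x.val + y ∈ Q.lieP :=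
          add_mem (fun a b hab => x.2 a b hab.ne) fun a b hab => hy a b hab.le
        exact ParabolicPair.mem_lieP_iff.1 hP i
      have h3 := avg_add_unipotent_std f (x.val + y) ⟨W, hst⟩
      refine h3.trans (hf.cop _ _ ?_ ?_)
      · intro h
        exact h1 (congrArg EndObj.Sub.val (EndObj.rank_sub_eq_zero.1 h))
      · intro h
        exact h2 (congrArg EndObj.Sub.val (EndObj.rank_quo_eq_zero.1 h))
    · exact avg_const 0
  have hres : Q.hcRes f x = (Nat.card Q.grpU : ℂ)⁻¹ * S := by
    simp only [S]
    rfl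
  rw [hres, hS0, mul_zero]
  rfl
section Flags

variable {F V : Type*} [Field F] [AddCommGroup V] [Module F V]

/-- The strict flags of subspaces, without the zero subspace and with the whole space. -/
structure IsFlag (C : Set (Submodule F V)) : Prop where
  chain : IsChain (· ≤ ·) C
  bot_notMem : ⊥ ∉ C
  sSup_eq : sSup C = ⊤

/-- The predecessor of `W` in the flag `C`. -/
def flagPred (C : Set (Submodule F V)) (W : Submodule F V) : Submodule F V :=
  sSup {U ∈ C | U < W}

/-- The endomorphisms that map each member of a flag into its predecessor. -/
def flagRadical (C : Set (Submodule F V)) : Submodule F (V →ₗ[F] V) where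
  carrier := {y | ∀ W ∈ C, ∀ v ∈ W, y v ∈ flagPred C W}
  zero_mem' := fun W _ _ _ => (flagPred C W).zero_mem
  add_mem' := fun hy hz W hW v hv => (flagPred C W).add_mem (hy W hW v hv) (hz W hW v hv)
  smul_mem' := fun c _ hy W hW v hv => (flagPred C W).smul_mem c (hy W hW v hv)

theorem mem_flagRadical {C : Set (Submodule F V)} {y : V →ₗ[F] V} :
    y ∈ flagRadical C ↔ ∀ W ∈ C, ∀ v ∈ W, y v ∈ flagPred C W := Iff.rfl

theorem IsChain.sSup_mem [Finite V] {C : Set (Submodule F V)} (hC : IsChain (· ≤ ·) C)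
    (hne : C.Nonempty) : sSup C ∈ C := by
  obtain ⟨W, hW, hmax⟩ := Set.exists_max_image C (fun W => Module.finrank F W) C.toFinite hne
  have : sSup C = W := le_antisymm
    (sSup_le fun U hU => hC.le_of_finrank_le hU hW (hmax U hU)) (le_sSup hW)
  rwa [this]

theorem IsFlag.top_mem [Finite V] [Nontrivial V] {C : Set (Submodule F V)} (hC : IsFlag C) :
    ⊤ ∈ C := by
  rw [← hC.sSup_eq]
  refine hC.chain.sSup_mem (Set.nonempty_iff_ne_empty.2 fun h => ?_)
  have := hC.sSup_eq
  rw [h, sSup_empty] at this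
  exact bot_ne_top this

theorem Submodule.map_sSup_eq {V' : Type*} [AddCommGroup V'] [Module F V'] (f : V →ₗ[F] V')
    (S : Set (Submodule F V)) : (sSup S).map f = sSup ((fun U => U.map f) '' S) := by
  rw [(Submodule.gc_map_comap f).l_sSup, sSup_image]

/-- The flag of `V` obtained from a flag of the subspace `W` by adding `V`. -/
def extendFlag (W : Submodule F V) (C : Set (Submodule F W)) : Set (Submodule F V) :=
  insert ⊤ ((fun U => U.map W.subtype) '' C)

section Extend

variable {W : Submodule F V}

theorem map_subtype_ne_top (hW : W ≠ ⊤) (U : Submodule F W) : U.map W.subtype ≠ ⊤ := fun h =>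
  hW (eq_top_iff.2 (h ▸ Submodule.map_subtype_le W U))

theorem top_notMem_image (hW : W ≠ ⊤) (C : Set (Submodule F W)) :
    (⊤ : Submodule F V) ∉ (fun U => U.map W.subtype) '' C := by
  rintro ⟨U, -, hU⟩
  exact map_subtype_ne_top hW U hU

theorem extendFlag_diff (hW : W ≠ ⊤) (C : Set (Submodule F W)) :
    extendFlag W C \ {⊤} = (fun U => U.map W.subtype) '' C := by
  rw [extendFlag, Set.insert_sdiff_self_of_notMem (top_notMem_image hW C)]

theorem preimage_extendFlag (hW : W ≠ ⊤) (C : Set (Submodule F W)) :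
    (fun U : Submodule F W => U.map W.subtype) ⁻¹' extendFlag W C = C := by
  ext U
  constructor
  · rintro (h | ⟨U', hU', h⟩)
    · exact absurd h (map_subtype_ne_top hW U)
    · rwa [← Submodule.map_injective_of_injective W.injective_subtype h]
  · intro h
    exact Or.inr ⟨U, h, rfl⟩

theorem isFlag_extendFlag (hW : W ≠ ⊤) {C : Set (Submodule F W)} (hC : IsFlag C) :
    IsFlag (extendFlag W C) := by
  refine ⟨?_, ?_, ?_⟩
  · refine IsChain.insert ?_ fun _ _ _ => Or.inr le_top
    rintro _ ⟨U, hU, rfl⟩ _ ⟨U', hU', rfl⟩ _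
    exact (hC.chain.total hU hU').imp Submodule.map_mono Submodule.map_mono
  · rintro (h | ⟨U, hU, h⟩)
    · exact hW (top_unique (h ▸ bot_le))
    · refine hC.bot_notMem ?_
      have : U = ⊥ := Submodule.map_injective_of_injective W.injective_subtype
        (h.trans (Submodule.map_bot _).symm)
      rwa [← this]
  · exact top_unique (le_sSup (Set.mem_insert _ _))

theorem sSup_extendFlag_diff (hW : W ≠ ⊤) {C : Set (Submodule F W)} (hC : IsFlag C) :
    sSup (extendFlag W C \ {⊤}) = W := by
  rw [extendFlag_diff hW, ← Submodule.map_sSup_eq, hC.sSup_eq, Submodule.map_subtype_top]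

theorem flagPred_extendFlag_top (hW : W ≠ ⊤) {C : Set (Submodule F W)} (hC : IsFlag C) :
    flagPred (extendFlag W C) ⊤ = W := by
  refine Eq.trans ?_ (sSup_extendFlag_diff hW hC)
  rw [flagPred]
  congr 1
  ext U
  exact and_congr_right fun _ => lt_top_iff_ne_top

theorem flagPred_extendFlag_map (C : Set (Submodule F W)) (U : Submodule F W) :
    flagPred (extendFlag W C) (U.map W.subtype) = (flagPred C U).map W.subtype := by
  have hlt : ∀ U' : Submodule F W, U'.map W.subtype < U.map W.subtype ↔ U' < U := fun U' =>
    lt_iff_lt_of_le_iff_le' (Submodule.map_le_map_iff_of_injective W.injective_subtype _ _)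
      (Submodule.map_le_map_iff_of_injective W.injective_subtype _ _)
  rw [flagPred, flagPred, Submodule.map_sSup_eq]
  congr 1
  ext X
  constructor
  · rintro ⟨h | ⟨U', hU', rfl⟩, hX⟩
    · rw [h] at hX
      exact absurd hX not_top_lt
    · exact ⟨U', ⟨hU', (hlt U').1 hX⟩, rfl⟩
  · rintro ⟨U', ⟨hU', hlt'⟩, rfl⟩
    exact ⟨Or.inr ⟨U', hU', rfl⟩, (hlt U').2 hlt'⟩

theorem mem_flagRadical_extendFlag (hW : W ≠ ⊤) {C : Set (Submodule F W)} (hC : IsFlag C)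
    {y : V →ₗ[F] V} :
    y ∈ flagRadical (extendFlag W C) ↔ (∀ v, y v ∈ W) ∧
      ∀ U ∈ C, ∀ u ∈ U, y (u : W) ∈ (flagPred C U).map W.subtype := by
  rw [mem_flagRadical]
  constructor
  · intro h
    refine ⟨fun v => ?_, fun U hU u hu => ?_⟩
    · rw [← flagPred_extendFlag_top hW hC]
      exact h ⊤ (Set.mem_insert _ _) v trivial
    · rw [← flagPred_extendFlag_map]
      exact h _ (Or.inr ⟨U, hU, rfl⟩) _ ⟨u, hu, rfl⟩
  · rintro ⟨h1, h2⟩ X (rfl | ⟨U, hU, rfl⟩) v hv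
    · rw [flagPred_extendFlag_top hW hC]
      exact h1 v
    · rw [flagPred_extendFlag_map]
      obtain ⟨u, hu, rfl⟩ := hv
      exact h2 U hU u hu

theorem ncard_extendFlag [Finite V] (hW : W ≠ ⊤) (C : Set (Submodule F W)) :
    (extendFlag W C).ncard = C.ncard + 1 := by
  rw [extendFlag, Set.ncard_insert_of_notMem (top_notMem_image hW C),
    Set.ncard_image_of_injective _ (Submodule.map_injective_of_injective W.injective_subtype)]

end Extend

theorem isFlag_preimage {W : Submodule F V} {C : Set (Submodule F V)} (hC : IsFlag C)
    (hCW : sSup (C \ {⊤}) = W) (hW : W ≠ ⊤) :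
    IsFlag ((fun U : Submodule F W => U.map W.subtype) ⁻¹' C) ∧
      extendFlag W ((fun U : Submodule F W => U.map W.subtype) ⁻¹' C) = insert ⊤ C := by
  have h1 : (fun U : Submodule F W => U.map W.subtype) ''
      ((fun U : Submodule F W => U.map W.subtype) ⁻¹' C) = C \ {⊤} := by
    ext X
    constructor
    · rintro ⟨U, hU, rfl⟩
      exact ⟨hU, map_subtype_ne_top hW U⟩
    · rintro ⟨hX, hX'⟩
      have hle : X ≤ W := hCW ▸ le_sSup ⟨hX, hX'⟩
      have : (X.comap W.subtype).map W.subtype = X := by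
        rw [Submodule.map_comap_subtype, inf_eq_right.2 hle]
      exact ⟨X.comap W.subtype, by rw [Set.mem_preimage, this]; exact hX, this⟩
  refine ⟨⟨?_, ?_, ?_⟩, ?_⟩
  · intro U hU U' hU' _
    rcases hC.chain.total hU hU' with h | h
    · exact Or.inl ((Submodule.map_le_map_iff_of_injective W.injective_subtype _ _).1 h)
    · exact Or.inr ((Submodule.map_le_map_iff_of_injective W.injective_subtype _ _).1 h)
  · intro h
    rw [Set.mem_preimage, Submodule.map_bot] at h
    exact hC.bot_notMem h
  · apply Submodule.map_injective_of_injective W.injective_subtype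
    rw [Submodule.map_sSup_eq, h1, hCW, Submodule.map_subtype_top]
  · rw [extendFlag, h1, Set.insert_sdiff_singleton]

end Flags

section FlagRadicalHom

variable {F V : Type*} [Field F] [AddCommGroup V] [Module F V]

/-- The radical of an extended flag, in terms of a retraction `ρ` onto the subspace. -/
def flagRadicalHom {W : Submodule F V} (hW : W ≠ ⊤) {C : Set (Submodule F W)} (hC : IsFlag C)
    {ρ : V →ₗ[F] W} (hρ : ∀ w : W, ρ w = w) :
    flagRadical C × ((V ⧸ W) →ₗ[F] W) →+ flagRadical (extendFlag W C) where
  toFun p := ⟨W.subtype ∘ₗ p.1.1 ∘ₗ ρ + W.subtype ∘ₗ p.2 ∘ₗ W.mkQ,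
    (mem_flagRadical_extendFlag hW hC).2 ⟨fun v => W.add_mem (Subtype.mem _) (Subtype.mem _),
      fun U hU u hu => by
        have h0 : W.mkQ (u : W) = 0 := (Submodule.Quotient.mk_eq_zero _).2 u.2
        rw [LinearMap.add_apply, LinearMap.comp_apply, LinearMap.comp_apply, LinearMap.comp_apply,
          LinearMap.comp_apply, h0, map_zero, map_zero, add_zero, hρ]
        exact ⟨_, p.1.2 U hU u hu, rfl⟩⟩⟩
  map_zero' := by
    apply Subtype.ext
    simp
  map_add' p q := by
    apply Subtype.ext
    simp only [Prod.fst_add, Prod.snd_add, Submodule.coe_add, LinearMap.comp_add,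
      LinearMap.add_comp]
    abel

theorem flagRadicalHom_surjective {W : Submodule F V} (hW : W ≠ ⊤) {C : Set (Submodule F W)}
    (hC : IsFlag C) {ρ : V →ₗ[F] W} (hρ : ∀ w : W, ρ w = w) :
    Function.Surjective (flagRadicalHom hW hC hρ) := by
  rintro ⟨y, hy⟩
  obtain ⟨h1, h2⟩ := (mem_flagRadical_extendFlag hW hC).1 hy
  let y' : V →ₗ[F] W := y.codRestrict W h1
  let z : W →ₗ[F] W := y' ∘ₗ W.subtype
  have hz : z ∈ flagRadical C := fun U hU u hu => by
    obtain ⟨w, hw, hwy⟩ := h2 U hU u hu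
    have : z u = w := Subtype.ext hwy.symm
    rwa [this]
  have hker : W ≤ (y' - z ∘ₗ ρ).ker := fun w hw => by
    have : ρ w = ⟨w, hw⟩ := hρ ⟨w, hw⟩
    rw [LinearMap.mem_ker, LinearMap.sub_apply, LinearMap.comp_apply, this]
    exact sub_self _
  refine ⟨(⟨z, hz⟩, W.liftQ _ hker), ?_⟩
  apply Subtype.ext
  ext v
  change ((z (ρ v) : W) : V) + ((y' v - z (ρ v) : W) : V) = y v
  rw [← Submodule.coe_add, add_sub_cancel]
  rfl

end FlagRadicalHom

namespace EndObj

variable {F : Type u} [Field F]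

theorem avg_flagRadical_extendFlag (g : IsoClass F → ℂ) (M : EndObj F) (W : M.Sub) (hW : W.1 ≠ ⊤)
    {C : Set (Submodule F W.1)} (hC : IsFlag C) :
    (avg fun y : flagRadical (extendFlag W.1 C) => g (EndObj.mk M.V (M.x + y.1)).cls) =
      avg fun z : flagRadical C =>
        IsoClass.cop g (EndObj.mk W.1 ((M.sub W).x + z.1)).cls (M.quo W).cls := by
  obtain ⟨ρ, hρ⟩ := LinearMap.exists_leftInverse_of_injective W.1.subtype (Submodule.ker_subtype _)
  have hρ' : ∀ w : W.1, ρ w = w := fun w => LinearMap.congr_fun hρ w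
  have h0 := avg_comp_surjective (K := flagRadical C × ((M.V ⧸ W.1) →ₗ[F] W.1))
    (L := flagRadical (extendFlag W.1 C)) (flagRadicalHom hW hC hρ')
    (flagRadicalHom_surjective hW hC hρ')
    fun y => g (EndObj.mk M.V (M.x + y.1)).cls
  refine h0.symm.trans ?_
  rw [avg_prod]
  refine avg_congr (Equiv.refl _) fun z => ?_
  let M' : EndObj F := EndObj.mk M.V (M.x + W.1.subtype ∘ₗ z.1 ∘ₗ ρ)
  have hst : ∀ v ∈ W.1, M'.x v ∈ W.1 := fun v hv => W.1.add_mem (W.2 v hv) (Subtype.mem _)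
  have h1 := IsoClass.avg_add_unipotent g M' ⟨W.1, hst⟩
  have h2 : (M'.sub ⟨W.1, hst⟩).cls = (EndObj.mk W.1 ((M.sub W).x + z.1)).cls := by
    refine cls_eq (M := M'.sub ⟨W.1, hst⟩) (N := EndObj.mk W.1 _) (LinearEquiv.refl F W.1)
      fun v => Subtype.ext ?_
    change M.x v + (z.1 (ρ v) : W.1) = M.x v + (z.1 v : W.1)
    rw [hρ']
  have h3 : (M'.quo ⟨W.1, hst⟩).cls = (M.quo W).cls := by
    refine cls_eq (M := M'.quo ⟨W.1, hst⟩) (N := M.quo W) (LinearEquiv.refl F (M.V ⧸ W.1))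
      fun v => ?_
    obtain ⟨v, rfl⟩ := W.1.mkQ_surjective v
    change W.1.mkQ (M.x v + (z.1 (ρ v) : W.1)) = W.1.mkQ (M.x v)
    rw [map_add, Submodule.mkQ_apply W.1 (z.1 (ρ v) : W.1),
      (Submodule.Quotient.mk_eq_zero _).2 (Subtype.mem _), add_zero]
  rw [h2, h3] at h1
  rw [Equiv.refl_apply, ← h1]
  refine avg_congr (Equiv.refl _) fun t => ?_
  change g (EndObj.mk M.V (M.x + (_ + _))).cls = g (EndObj.mk M.V (M.x + _ + _)).cls
  rw [add_assoc]
  rfl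

open scoped Classical in
/-- The contribution of the flag `C` to the duality operation, up to a global sign. -/
noncomputable def flagTerm (g : IsoClass F → ℂ) (M : EndObj F) (C : Set (Submodule F M.V)) : ℂ :=
  if ∀ W ∈ C, ∀ v ∈ W, M.x v ∈ W then
    (-1) ^ C.ncard * avg fun y : flagRadical C => g (EndObj.mk M.V (M.x + y.1)).cls
  else 0

open scoped Classical in
theorem flagTerm_extendFlag (g : IsoClass F → ℂ) (M : EndObj F) {W : Submodule F M.V} (hW : W ≠ ⊤)
    {C : Set (Submodule F W)} (hC : IsFlag C) :
    flagTerm g M (extendFlag W C) = if h : ∀ v ∈ W, M.x v ∈ W then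
      -flagTerm (fun a => IsoClass.cop g a (M.quo ⟨W, h⟩).cls) (M.sub ⟨W, h⟩) C else 0 := by
  have hst : ∀ h : ∀ v ∈ W, M.x v ∈ W, ((∀ X ∈ extendFlag W C, ∀ v ∈ X, M.x v ∈ X) ↔
      ∀ U ∈ C, ∀ u ∈ U, (M.sub ⟨W, h⟩).x u ∈ U) := by
    intro h
    constructor
    · intro h' U hU u hu
      obtain ⟨w, hw, hwx⟩ := h' _ (Or.inr ⟨U, hU, rfl⟩) _ ⟨u, hu, rfl⟩
      have : (M.sub ⟨W, h⟩).x u = w := Subtype.ext hwx.symm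
      rwa [this]
    · rintro h' X (rfl | ⟨U, hU, rfl⟩) v hv
      · trivial
      · obtain ⟨u, hu, rfl⟩ := hv
        exact ⟨_, h' U hU u hu, rfl⟩
  split_ifs with h
  · by_cases h' : ∀ X ∈ extendFlag W C, ∀ v ∈ X, M.x v ∈ X
    · rw [flagTerm, flagTerm, if_pos h', if_pos ((hst h).1 h'), ncard_extendFlag hW,
        avg_flagRadical_extendFlag g M ⟨W, h⟩ hW hC, pow_succ]
      ring
    · rw [flagTerm, flagTerm, if_neg h', if_neg fun h'' => h' ((hst h).2 h''), neg_zero]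
  · refine if_neg fun h' => h fun v hv => ?_
    have h1 : W = sSup ((fun U => U.map W.subtype) '' C) := by
      rw [← Submodule.map_sSup_eq, hC.sSup_eq, Submodule.map_subtype_top]
    have h2 : W ≤ W.comap M.x := by
      conv_lhs => rw [h1]
      refine sSup_le ?_
      rintro _ ⟨U, hU, rfl⟩ v hv
      exact Submodule.map_subtype_le W U (h' _ (Or.inr ⟨U, hU, rfl⟩) v hv)
    exact h2 hv

open scoped Classical in
/-- The alternating sum over all flags. -/
noncomputable def flagSum (g : IsoClass F → ℂ) (M : EndObj F) : ℂ :=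
  ∑ C : Set (Submodule F M.V) with IsFlag C, flagTerm g M C

open scoped Classical in
theorem sum_flagTerm_fiber (g : IsoClass F → ℂ) (M : EndObj F) [Nontrivial M.V]
    {W : Submodule F M.V} (hW : W ≠ ⊤) :
    ∑ C ∈ {C : Set (Submodule F M.V) | IsFlag C} with sSup (C \ {⊤}) = W, flagTerm g M C =
      if h : ∀ v ∈ W, M.x v ∈ W then
        -flagSum (fun a => IsoClass.cop g a (M.quo ⟨W, h⟩).cls) (M.sub ⟨W, h⟩) else 0 := by
  have h1 : ∑ C ∈ {C : Set (Submodule F M.V) | IsFlag C} with sSup (C \ {⊤}) = W, flagTerm g M C =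
      ∑ C : Set (Submodule F W) with IsFlag C, flagTerm g M (extendFlag W C) := by
    have hins : ∀ C : Set (Submodule F M.V), IsFlag C → insert ⊤ C = C := fun C hC =>
      Set.insert_eq_of_mem hC.top_mem
    refine Finset.sum_nbij' (fun C => (fun U : Submodule F W => U.map W.subtype) ⁻¹' C)
      (fun C => extendFlag W C) ?_ ?_ ?_ ?_ ?_
    · intro C hC
      simp only [Finset.mem_filter, Finset.mem_univ, true_and] at hC ⊢
      exact (isFlag_preimage hC.1 hC.2 hW).1
    · intro C hC
      simp only [Finset.mem_filter, Finset.mem_univ, true_and] at hC ⊢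
      exact ⟨isFlag_extendFlag hW hC, sSup_extendFlag_diff hW hC⟩
    · intro C hC
      simp only [Finset.mem_filter, Finset.mem_univ, true_and] at hC
      rw [(isFlag_preimage hC.1 hC.2 hW).2, hins C hC.1]
    · intro C _
      exact preimage_extendFlag hW C
    · intro C hC
      simp only [Finset.mem_filter, Finset.mem_univ, true_and] at hC
      rw [(isFlag_preimage hC.1 hC.2 hW).2, hins C hC.1]
  rw [h1]
  split_ifs with h
  · rw [flagSum, ← Finset.sum_neg_distrib]
    refine Finset.sum_congr rfl fun C hC => ?_
    rw [flagTerm_extendFlag g M hW (Finset.mem_filter.1 hC).2, dif_pos h]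
  · refine Finset.sum_eq_zero fun C hC => ?_
    rw [flagTerm_extendFlag g M hW (Finset.mem_filter.1 hC).2, dif_neg h]

/-- The antipode is the alternating sum over all flags. -/
theorem antipode_cls (g : IsoClass F → ℂ) (M : EndObj F) :
    IsoClass.antipode g M.cls = flagSum g M := by
  classical
  induction hn : Module.finrank F M.V using Nat.strong_induction_on generalizing g M with
  | _ n ih =>
    subst hn
    by_cases h0 : Module.finrank F M.V = 0
    · have hs : Subsingleton M.V := Module.finrank_zero_iff.1 h0
      rw [IsoClass.antipode_of_rank_eq_zero g (c := M.cls) h0, flagSum]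
      have hflag : ∀ C : Set (Submodule F M.V), IsFlag C ↔ C = ∅ := by
        intro C
        constructor
        · intro hC
          refine Set.eq_empty_of_forall_notMem fun X hX => hC.bot_notMem ?_
          rwa [← Subsingleton.elim X ⊥]
        · rintro rfl
          exact ⟨Set.pairwise_empty _, Set.notMem_empty _, Subsingleton.elim _ _⟩
      simp only [hflag]
      rw [Finset.sum_filter, Finset.sum_ite_eq' Finset.univ ∅, if_pos (Finset.mem_univ _), flagTerm,
        if_pos fun W hW => absurd hW (Set.notMem_empty W), Set.ncard_empty, pow_zero, one_mul]
      have h1 : ∀ y : flagRadical (∅ : Set (Submodule F M.V)),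
          g (EndObj.mk M.V (M.x + y.1)).cls = g M.cls := fun y => by
        rw [Subsingleton.elim (M.x + y.1) M.x]
      rw [funext h1, avg_const]
    · have hnt : Nontrivial M.V := Module.nontrivial_of_finrank_pos (R := F) (Nat.pos_of_ne_zero h0)
      rw [IsoClass.antipode_of_rank_ne_zero g (c := M.cls) h0, IsoClass.hall_cls, sum_sub_eq,
        flagSum, ← Finset.sum_fiberwise _ (fun C : Set (Submodule F M.V) => sSup (C \ {⊤})),
        ← Finset.sum_neg_distrib]
      refine Finset.sum_congr rfl fun W _ => ?_
      by_cases hW : W = ⊤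
      · subst hW
        have hr : (M.quo ⟨⊤, fun _ _ => Submodule.mem_top⟩).cls.rank = 0 := rank_quo_eq_zero.2 rfl
        rw [dif_pos fun _ _ => Submodule.mem_top, if_pos hr, neg_zero]
        symm
        refine Finset.sum_eq_zero fun C hC => ?_
        simp only [Finset.mem_filter, Finset.mem_univ, true_and] at hC
        exfalso
        have hne : (C \ {⊤}).Nonempty := Set.nonempty_iff_ne_empty.2 fun h => by
          have := hC.2
          rw [h, sSup_empty] at this
          exact bot_ne_top this
        have := (hC.1.chain.mono Set.sdiff_subset).sSup_mem hne
        rw [hC.2] at this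
        exact this.2 rfl
      · rw [sum_flagTerm_fiber g M hW]
        split_ifs with h hr
        · exact absurd (congrArg Sub.val (rank_quo_eq_zero.1 hr)) hW
        · rw [ih _ (Submodule.finrank_lt hW) _ (M.sub ⟨W, h⟩) rfl]
        · exact neg_zero

end EndObj

section FlagTransport

variable {F : Type u} [Field F]

theorem flagPred_image {V V' : Type*} [AddCommGroup V] [Module F V] [AddCommGroup V'] [Module F V']
    (e : V ≃ₗ[F] V') (C : Set (Submodule F V)) (W : Submodule F V) :
    flagPred ((fun U => U.map e.toLinearMap) '' C) (W.map e.toLinearMap) =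
      (flagPred C W).map e.toLinearMap := by
  have hle : ∀ U U' : Submodule F V, U.map e.toLinearMap ≤ U'.map e.toLinearMap ↔ U ≤ U' :=
    Submodule.map_le_map_iff_of_injective e.injective
  have hlt : ∀ U : Submodule F V, U.map e.toLinearMap < W.map e.toLinearMap ↔ U < W := fun U =>
    lt_iff_lt_of_le_iff_le' (hle _ _) (hle _ _)
  rw [flagPred, flagPred, Submodule.map_sSup_eq]
  congr 1
  ext X
  constructor
  · rintro ⟨⟨U, hU, rfl⟩, hX⟩
    exact ⟨U, ⟨hU, (hlt U).1 hX⟩, rfl⟩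
  · rintro ⟨U, ⟨hU, hUW⟩, rfl⟩
    exact ⟨⟨U, hU, rfl⟩, (hlt U).2 hUW⟩

theorem conj_mem_flagRadical_image {V V' : Type*} [AddCommGroup V] [Module F V] [AddCommGroup V']
    [Module F V'] (e : V ≃ₗ[F] V') (C : Set (Submodule F V)) (y : V →ₗ[F] V) :
    y ∈ flagRadical C ↔ e.conj y ∈ flagRadical ((fun U => U.map e.toLinearMap) '' C) := by
  rw [mem_flagRadical, mem_flagRadical, Set.forall_mem_image]
  refine forall₂_congr fun W hW => ?_
  rw [flagPred_image]
  constructor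
  · rintro h _ ⟨v, hv, rfl⟩
    refine ⟨y v, h v hv, ?_⟩
    simp [LinearEquiv.conj_apply]
  · intro h v hv
    obtain ⟨w, hw, hwv⟩ := h (e v) ⟨v, hv, rfl⟩
    have : w = y v := e.injective (by simpa [LinearEquiv.conj_apply] using hwv)
    rwa [← this]

theorem EndObj.flagTerm_image (g : IsoClass F → ℂ) {M N : EndObj F} (e : M.V ≃ₗ[F] N.V)
    (he : ∀ v, e (M.x v) = N.x (e v)) (C : Set (Submodule F M.V)) :
    flagTerm g N ((fun U => U.map e.toLinearMap) '' C) = flagTerm g M C := by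
  have hst : (∀ W ∈ (fun U => Submodule.map e.toLinearMap U) '' C, ∀ v ∈ W, N.x v ∈ W) ↔
      ∀ W ∈ C, ∀ v ∈ W, M.x v ∈ W := by
    rw [Set.forall_mem_image]
    refine forall₂_congr fun W hW => ?_
    constructor
    · intro h v hv
      obtain ⟨w, hw, hwv⟩ := h (e v) ⟨v, hv, rfl⟩
      have : w = M.x v := e.injective (hwv.trans (he v).symm)
      rwa [← this]
    · rintro h _ ⟨v, hv, rfl⟩
      exact ⟨M.x v, h v hv, he v⟩
  rw [flagTerm, flagTerm]
  by_cases h : ∀ W ∈ C, ∀ v ∈ W, M.x v ∈ W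
  swap
  · rw [if_neg h, if_neg (mt hst.1 h)]
  rw [if_pos h, if_pos (hst.2 h)]
  rw [Set.ncard_image_of_injective _ (Submodule.map_injective_of_injective e.injective)]
  congr 1
  symm
  refine avg_congr (e.conj.toEquiv.subtypeEquiv (conj_mem_flagRadical_image e C)) fun y => ?_
  congr 1
  refine cls_eq (M := EndObj.mk M.V (M.x + y.1)) (N := EndObj.mk N.V _) e fun v => ?_
  change e (M.x v + y.1 v) = N.x (e v) + e (y.1 (e.symm (e v)))
  rw [map_add, he, e.symm_apply_apply]

end FlagTransport

namespace ParabolicPair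

variable {F : Type u} [Field F] {n : ℕ}

/-- The flag of a parabolic pair. -/
def flag (Q : ParabolicPair F n) : Set (Submodule F (Fin n → F)) :=
  Set.range fun i => Q.part (Finset.Iic i)

variable {Q : ParabolicPair F n}

theorem strictMono_part_Iic (hQ : ∀ i, 0 < (Q.e i).rank) :
    StrictMono fun i => Q.part (Finset.Iic i) := by
  intro i j hij
  refine lt_of_le_of_ne (part_mono (Finset.Iic_subset_Iic.2 hij.le)) fun h => ?_
  have h1 := congrArg (fun W : Submodule F (Fin n → F) => Module.finrank F W) h
  simp only [finrank_part] at h1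
  refine h1.not_lt (Finset.sum_lt_sum_of_subset (Finset.Iic_subset_Iic.2 hij.le)
    (Finset.mem_Iic.2 le_rfl) (fun h => absurd (Finset.mem_Iic.1 h) (not_le.2 hij)) (hQ j)
    fun _ _ _ => Nat.zero_le _)

theorem isFlag_flag (hQ : ∀ i, 0 < (Q.e i).rank) : IsFlag Q.flag := by
  refine ⟨?_, ?_, ?_⟩
  · rintro _ ⟨i, rfl⟩ _ ⟨j, rfl⟩ _
    exact (le_total i j).imp (fun h => (strictMono_part_Iic hQ).monotone h)
      fun h => (strictMono_part_Iic hQ).monotone h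
  · rintro ⟨i, hi⟩
    have h1 := finrank_part (Q := Q) (Finset.Iic i)
    simp only at hi
    rw [hi, finrank_bot, eq_comm, Finset.sum_eq_zero_iff] at h1
    exact (hQ i).ne' (h1 i (Finset.mem_Iic.2 le_rfl))
  · rw [eq_top_iff]
    intro v _
    rw [← sum_mulVec (Q := Q) v]
    exact Submodule.sum_mem _ fun i _ =>
      (le_sSup (Set.mem_range_self i) : Q.part (Finset.Iic i) ≤ sSup Q.flag)
        (mulVec_mem_part (Finset.mem_Iic.2 le_rfl) v)

theorem flagPred_flag (hQ : ∀ i, 0 < (Q.e i).rank) (i : Fin Q.r) :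
    flagPred Q.flag (Q.part (Finset.Iic i)) = Q.part (Finset.Iio i) := by
  apply le_antisymm
  · refine sSup_le ?_
    rintro _ ⟨⟨j, rfl⟩, hj⟩
    have hji : j < i := (strictMono_part_Iic hQ).lt_iff_lt.1 hj
    exact part_mono fun k hk => Finset.mem_Iio.2 ((Finset.mem_Iic.1 hk).trans_lt hji)
  · intro v hv
    rw [← sum_mulVec_of_mem hv]
    refine Submodule.sum_mem _ fun j hj => ?_
    have hle : Q.part (Finset.Iic j) ≤ flagPred Q.flag (Q.part (Finset.Iic i)) :=
      le_sSup ⟨⟨j, rfl⟩, strictMono_part_Iic hQ (Finset.mem_Iio.1 hj)⟩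
    exact hle (mulVec_mem_part (Finset.mem_Iic.2 le_rfl) v)

theorem toLin'_mem_flagRadical_iff (hQ : ∀ i, 0 < (Q.e i).rank) {A : Matrix (Fin n) (Fin n) F} :
    A ∈ Q.lieU ↔ A.toLin' ∈ flagRadical Q.flag := by
  rw [mem_lieU_iff, mem_flagRadical, flag, Set.forall_mem_range]
  refine forall_congr' fun i => ?_
  have := flagPred_flag hQ i
  rw [flag] at this
  rw [this]
  rfl

theorem mem_lieP_iff_flag {A : Matrix (Fin n) (Fin n) F} :
    A ∈ Q.lieP ↔ ∀ W ∈ Q.flag, ∀ v ∈ W, A.toLin' v ∈ W := by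
  rw [mem_lieP_iff, flag, Set.forall_mem_range]
  rfl

theorem mem_grpP_iff_flag (hQ : ∀ i, 0 < (Q.e i).rank) {g : GL (Fin n) F} :
    g ∈ Q.grpP ↔ (fun U => U.map (glEquiv g).toLinearMap) '' Q.flag = Q.flag := by
  rw [mem_grpP_iff]
  constructor
  · intro h
    rw [flag, ← Set.range_comp]
    exact congrArg Set.range (funext h)
  · intro h i
    refine (isFlag_flag hQ).chain.eq_of_finrank_eq ?_ (Set.mem_range_self i)
      (LinearEquiv.finrank_map_eq _ _)
    rw [← h]
    exact ⟨_, Set.mem_range_self i, rfl⟩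

theorem ncard_flag (hQ : ∀ i, 0 < (Q.e i).rank) : Q.flag.ncard = Q.r := by
  rw [flag, ← Set.image_univ, Set.ncard_image_of_injective _ (strictMono_part_Iic hQ).injective,
    Set.ncard_univ, Nat.card_fin]

theorem ssRank_add (hQ : ∀ i, 0 < (Q.e i).rank) : Q.ssRank + Q.r = n := by
  have h1 := finrank_part (Q := Q) Finset.univ
  rw [part_univ, finrank_top, Module.finrank_fin_fun] at h1
  have h2 : Q.r = ∑ _i : Fin Q.r, 1 := by simp
  conv_lhs => rw [ssRank]; rhs; rw [h2]
  rw [← Finset.sum_add_distrib]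
  conv_rhs => rw [h1]
  exact Finset.sum_congr rfl fun i _ => Nat.sub_add_cancel (hQ i)

/-- The translates of the flag of a parabolic pair. -/
def flagConj (Q : ParabolicPair F n) (g : GL (Fin n) F) : Set (Submodule F (Fin n → F)) :=
  (fun U => U.map (glEquiv g⁻¹).toLinearMap) '' Q.flag

theorem image_flagConj (g : GL (Fin n) F) :
    (fun U => U.map (glEquiv g).toLinearMap) '' Q.flagConj g = Q.flag := by
  rw [flagConj, ← Set.image_comp]
  conv_rhs => rw [← Set.image_id Q.flag]
  refine congrArg (· '' Q.flag) (funext fun U => ?_)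
  rw [Function.comp_apply, ← map_glEquiv_mul, mul_inv_cancel, map_glEquiv_one, id]

theorem flagConj_eq_iff (hQ : ∀ i, 0 < (Q.e i).rank) (g h : GL (Fin n) F) :
    Q.flagConj g = Q.flagConj h ↔ g * h⁻¹ ∈ Q.grpP := by
  rw [mem_grpP_iff_flag hQ]
  have hmul : (fun U => U.map (glEquiv (g * h⁻¹)).toLinearMap) '' Q.flag =
      (fun U => U.map (glEquiv g).toLinearMap) '' Q.flagConj h := by
    rw [flagConj, ← Set.image_comp]
    exact congrArg (· '' Q.flag) (funext fun U => map_glEquiv_mul g h⁻¹ U)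
  rw [hmul]
  constructor
  · intro e
    rw [← e, image_flagConj]
  · intro e
    rw [← image_flagConj g] at e
    exact ((Submodule.map_injective_of_injective (glEquiv g).injective).image_injective e).symm

section Finite

variable [Fintype F]

theorem avg_flagRadical_flag (hQ : ∀ i, 0 < (Q.e i).rank) (f : InvFun F n)
    {A : Matrix (Fin n) (Fin n) F} (hA : A ∈ Q.lieP) :
    (avg fun y : flagRadical Q.flag => toHall f (EndObj.mk (Fin n → F) (A.toLin' + y.1)).cls) =
      Q.hcRes f (Q.proj A) := by
  classical
  have h1 : Q.hcRes f (Q.proj A) = (Nat.card Q.grpU : ℂ)⁻¹ *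
      ∑ y : Matrix (Fin n) (Fin n) F, if y ∈ Q.lieU then f.val ((Q.proj A).val + y) else 0 := by
    rw [hcRes]
    simp only [LinearMap.coe_mk, AddHom.coe_mk]
  have h2 : (∑ y : Matrix (Fin n) (Fin n) F,
      if y ∈ Q.lieU then f.val ((Q.proj A).val + y) else 0) =
      ∑ y : Matrix (Fin n) (Fin n) F, if y ∈ Q.lieU then f.val (A + y) else 0 := by
    symm
    refine Fintype.sum_equiv (Equiv.addLeft (A - (Q.proj A).val)) _ _ fun y => ?_
    rw [Equiv.coe_addLeft, ← add_assoc, add_sub_cancel]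
    exact if_congr (Submodule.add_mem_iff_right _ (sub_proj_mem_lieU hA)).symm rfl rfl
  rw [h1, h2, card_grpU, ← Finset.sum_filter,
    Finset.sum_subtype (p := (· ∈ Q.lieU)) _ (by simp), ← avg_eq fun y : Q.lieU => f.val (A + y.1)]
  symm
  refine avg_congr (Matrix.toLin'.toEquiv.subtypeEquiv fun A => toLin'_mem_flagRadical_iff hQ)
    fun y => ?_
  rw [← toHall_std f, EndObj.std, map_add]
  rfl

open scoped Classical in
theorem hcInd_hcRes_apply [DecidableEq F] (hQ : ∀ i, 0 < (Q.e i).rank) (f : InvFun F n)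
    (x : Matrix (Fin n) (Fin n) F) :
    (-1) ^ Q.r * (Q.hcInd (Q.hcRes f)).val x =
      ∑ C ∈ Finset.univ.image Q.flagConj, EndObj.flagTerm (toHall f) (EndObj.std x) C := by
  have hg : ∀ g : GL (Fin n) F, EndObj.flagTerm (toHall f) (EndObj.std x) (Q.flagConj g) =
      (-1) ^ Q.r * if g.val * x * g⁻¹.val ∈ Q.lieP then
        Q.hcRes f (Q.proj (g.val * x * g⁻¹.val)) else 0 := by
    intro g
    have h := EndObj.flagTerm_image (toHall f) (M := EndObj.std x)
      (N := EndObj.std (g.val * x * g⁻¹.val)) (glEquiv g) (glEquiv_conj g x) (Q.flagConj g)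
    rw [image_flagConj] at h
    rw [← h, EndObj.flagTerm]
    by_cases hA : g.val * x * g⁻¹.val ∈ Q.lieP
    · rw [if_pos (mem_lieP_iff_flag.1 hA), if_pos hA, ncard_flag hQ, ← avg_flagRadical_flag hQ f hA]
    · rw [if_neg fun h => hA (mem_lieP_iff_flag.2 h), if_neg hA, mul_zero]
  have hsum := sum_eq_card_mul_sum_image Q.grpP Q.flagConj (flagConj_eq_iff hQ)
    (EndObj.flagTerm (toHall f) (EndObj.std x))
  have h0 : (Nat.card Q.grpP : ℂ) ≠ 0 := by exact_mod_cast Nat.card_pos.ne'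
  simp only [hg] at hsum
  rw [← Finset.mul_sum] at hsum
  have hval : (Q.hcInd (Q.hcRes f)).val x = (Nat.card Q.grpP : ℂ)⁻¹ *
      ∑ g : GL (Fin n) F, if g.val * x * g⁻¹.val ∈ Q.lieP then
        Q.hcRes f (Q.proj (g.val * x * g⁻¹.val)) else 0 := rfl
  rw [hval, mul_left_comm, hsum, inv_mul_cancel_left₀ h0]

end Finite

end ParabolicPair

section FlagType

variable {F : Type u} [Field F] {n : ℕ}

theorem Composition.sizeUpTo_eq_sum (c : Composition n) (k : ℕ) (hk : k ≤ c.length) :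
    c.sizeUpTo k = ∑ j : Fin c.length with j.val < k, c.blocksFun j := by
  induction k with
  | zero => simp
  | succ k ih =>
    have h : Finset.univ.filter (fun j : Fin c.length => j.val < k + 1) =
        insert ⟨k, hk⟩ (Finset.univ.filter fun j : Fin c.length => j.val < k) := by
      ext j
      simp only [Finset.mem_filter, Finset.mem_univ, true_and, Finset.mem_insert, Fin.ext_iff]
      omega
    rw [h, Finset.sum_insert (by simp), ← ih (Nat.le_of_succ_le hk), c.sizeUpTo_succ hk, add_comm]
    rfl

open scoped Classical in
/-- The composition formed by the dimensions of the steps of a flag. -/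
noncomputable def flagType (C : Set (Submodule F (Fin n → F))) : Composition n :=
  (compositionEquiv n).symm
    { boundaries := {j | j = 0 ∨ j = Fin.last n ∨ ∃ W ∈ C, Module.finrank F W = j.val}
      zero_mem := by simp
      getLast_mem := by simp }

theorem flagType_eq_iff {C : Set (Submodule F (Fin n → F))} {c : Composition n} :
    flagType C = c ↔ ∀ j : Fin (n + 1), (j = 0 ∨ j = Fin.last n ∨ ∃ W ∈ C,
      Module.finrank F W = j.val) ↔ j ∈ c.boundaries := by
  classical
  rw [flagType, Equiv.symm_apply_eq, CompositionAsSet.ext_iff, Finset.ext_iff]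
  simp only [Finset.mem_filter, Finset.mem_univ, true_and]
  rfl

theorem IsFlag.mem_finrank_image_iff {C : Set (Submodule F (Fin n → F))} [Finite F]
    (hC : IsFlag C) (j : ℕ) :
    j ∈ (fun W : Submodule F (Fin n → F) => Module.finrank F W) '' C ↔
      j ≠ 0 ∧ ∃ h : j < n + 1, (⟨j, h⟩ : Fin (n + 1)) ∈ (flagType C).boundaries := by
  constructor
  · rintro ⟨W, hW, rfl⟩
    have hle : Module.finrank F W ≤ n := by
      have := Submodule.finrank_le W
      rwa [Module.finrank_fin_fun] at this
    refine ⟨fun h => hC.bot_notMem ?_, Nat.lt_succ_of_le hle,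
      (flagType_eq_iff.1 rfl _).1 (Or.inr (Or.inr ⟨W, hW, rfl⟩))⟩
    rwa [← Submodule.finrank_eq_zero.1 h]
  · rintro ⟨h0, h, hj⟩
    rcases (flagType_eq_iff.1 rfl _).2 hj with h1 | h1 | h1
    · exact absurd (congrArg Fin.val h1) h0
    · have hjn : j = n := congrArg Fin.val h1
      have : Nontrivial (Fin n → F) := Module.nontrivial_of_finrank_pos (R := F) (by
        rw [Module.finrank_fin_fun]; omega)
      exact ⟨⊤, hC.top_mem, by simp only [finrank_top, Module.finrank_fin_fun, hjn]⟩
    · exact h1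

theorem ParabolicPair.rank_pos_of_hasType {Q : ParabolicPair F n} {c : Composition n}
    (hQ : Q.HasType c) (i : Fin Q.r) : 0 < (Q.e i).rank := by
  obtain ⟨h, hr⟩ := hQ
  rw [hr i]
  exact c.blocks_pos' _ _

theorem ParabolicPair.flagType_flag {Q : ParabolicPair F n} {c : Composition n}
    (hQ : Q.HasType c) : flagType Q.flag = c := by
  obtain ⟨h, hr⟩ := hQ
  rw [flagType_eq_iff]
  have hdim : ∀ i : Fin Q.r, Module.finrank F (Q.part (Finset.Iic i)) = c.sizeUpTo (i.val + 1) := by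
    intro i
    rw [finrank_part, c.sizeUpTo_eq_sum _ (by omega)]
    refine Finset.sum_nbij' (Fin.cast h) (Fin.cast h.symm) ?_ ?_ ?_ ?_ ?_
    · intro j hj
      have hj' : j.val ≤ i.val := Fin.le_def.1 (Finset.mem_Iic.1 hj)
      simp only [Finset.mem_filter, Finset.mem_univ, true_and, Fin.val_cast]
      omega
    · intro j hj
      have hj' := (Finset.mem_filter.1 hj).2
      rw [Finset.mem_Iic, Fin.le_def, Fin.val_cast]
      omega
    · intro j _
      rfl
    · intro j _
      rfl
    · intro j _
      exact hr j
  intro j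
  have hmem : j ∈ c.boundaries ↔ ∃ i : Fin (c.length + 1), c.sizeUpTo i.val = j.val := by
    rw [Composition.boundaries, Finset.mem_map]
    simp only [Finset.mem_univ, true_and, Fin.ext_iff]
    rfl
  rw [hmem]
  constructor
  · rintro (rfl | rfl | ⟨_, ⟨i, rfl⟩, hi⟩)
    · exact ⟨0, c.sizeUpTo_zero⟩
    · exact ⟨Fin.last _, c.sizeUpTo_length⟩
    · exact ⟨⟨i.val + 1, by omega⟩, (hdim i).symm.trans hi⟩
  · rintro ⟨i, hi⟩
    rcases Nat.eq_zero_or_pos i.val with h0 | h0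
    · left
      rw [h0, c.sizeUpTo_zero] at hi
      exact Fin.ext hi.symm
    · right; right
      refine ⟨_, ⟨⟨i.val - 1, by omega⟩, rfl⟩, ?_⟩
      rw [hdim, ← hi]
      congr 1
      exact Nat.sub_add_cancel h0

open scoped Classical in
theorem ParabolicPair.image_flagConj_eq [Fintype F] [DecidableEq F] {Q : ParabolicPair F n}
    {c : Composition n} (hQ : Q.HasType c) : Finset.univ.image Q.flagConj =
      ({C : Set (Submodule F (Fin n → F)) | IsFlag C} : Finset _).filter (flagType · = c) := by
  have hpos := rank_pos_of_hasType hQ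
  have hflag := isFlag_flag hpos
  ext C
  simp only [Finset.mem_image, Finset.mem_univ, true_and, Finset.mem_filter]
  constructor
  · rintro ⟨g, rfl⟩
    have hdim : (fun W : Submodule F (Fin n → F) => Module.finrank F W) '' Q.flagConj g =
        (fun W : Submodule F (Fin n → F) => Module.finrank F W) '' Q.flag := by
      rw [flagConj, ← Set.image_comp]
      exact congrArg (· '' Q.flag) (funext fun U => LinearEquiv.finrank_map_eq _ _)
    refine ⟨⟨?_, ?_, ?_⟩, ?_⟩
    · rintro _ ⟨U, hU, rfl⟩ _ ⟨U', hU', rfl⟩ _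
      exact (hflag.chain.total hU hU').imp Submodule.map_mono Submodule.map_mono
    · rintro ⟨U, hU, h⟩
      refine hflag.bot_notMem ?_
      have : U = ⊥ := Submodule.map_injective_of_injective (glEquiv g⁻¹).injective
        (h.trans (Submodule.map_bot _).symm)
      rwa [← this]
    · rw [flagConj, ← Submodule.map_sSup_eq, hflag.sSup_eq, Submodule.map_top]
      exact LinearEquiv.range _
    · rw [← flagType_flag hQ, flagType_eq_iff]
      intro j
      rw [← flagType_eq_iff.1 (rfl : flagType Q.flag = _) j]
      refine or_congr_right (or_congr_right ?_)
      have := Set.ext_iff.1 hdim j.val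
      exact this
  · rintro ⟨hC, hCc⟩
    have hdim : (fun W : Submodule F (Fin n → F) => Module.finrank F W) '' C =
        (fun W : Submodule F (Fin n → F) => Module.finrank F W) '' Q.flag := by
      ext j
      rw [hC.mem_finrank_image_iff, hflag.mem_finrank_image_iff, hCc, flagType_flag hQ]
    obtain ⟨e, he⟩ := hflag.chain.exists_linearEquiv_image_eq hC.chain hdim.symm
    obtain ⟨g, rfl⟩ := exists_glEquiv_eq e
    exact ⟨g⁻¹, by rw [flagConj, inv_inv]; exact he⟩

/-- The duality operation is the antipode of the Hall algebra, up to the sign `(-1) ^ n`. -/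
theorem duality_apply [Fintype F] [DecidableEq F] (χ : DualityChoice F n) (f : InvFun F n) :
    duality χ f = (-1 : ℂ) ^ n • ofHall F n (IsoClass.antipode (toHall f)) := by
  classical
  apply Subtype.ext
  funext x
  have h1 : (duality χ f).val x = ∑ c : Composition n, (-1 : ℂ) ^ (χ.P c).ssRank *
      ((χ.P c).hcInd ((χ.P c).hcRes f)).val x := by
    rw [duality, LinearMap.sum_apply, Submodule.coe_sum, Finset.sum_apply]
    rfl
  have h2 : ∀ c : Composition n, (-1 : ℂ) ^ (χ.P c).ssRank *
      ((χ.P c).hcInd ((χ.P c).hcRes f)).val x = (-1) ^ n *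
      ∑ C ∈ ({C : Set (Submodule F (Fin n → F)) | IsFlag C} : Finset _).filter (flagType · = c),
        EndObj.flagTerm (toHall f) (EndObj.std x) C := by
    intro c
    have hpos := ParabolicPair.rank_pos_of_hasType (χ.hasType c)
    rw [← ParabolicPair.image_flagConj_eq (χ.hasType c),
      ← ParabolicPair.hcInd_hcRes_apply hpos f x, ← mul_assoc, ← pow_add]
    congr 1
    have h3 : n + (χ.P c).r = (χ.P c).ssRank + 2 * (χ.P c).r := by
      have := ParabolicPair.ssRank_add hpos
      omega
    rw [h3, pow_add, pow_mul, neg_one_sq, one_pow, mul_one]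
  rw [h1, Finset.sum_congr rfl fun c _ => h2 c, ← Finset.mul_sum, Finset.sum_fiberwise]
  change _ = (-1 : ℂ) ^ n * IsoClass.antipode (toHall f) (EndObj.std x).cls
  rw [EndObj.antipode_cls]
  rfl

end FlagType

section Duality

variable {F : Type u} [Field F] {n : ℕ}

theorem antipode_mem_homogeneous [Finite F] {f : IsoClass F → ℂ}
    (hf : f ∈ IsoClass.homogeneous F n) : IsoClass.antipode f ∈ IsoClass.homogeneous F n := by
  classical
  intro c hc
  obtain ⟨M, rfl⟩ := EndObj.exists_cls_eq c
  rw [EndObj.antipode_cls, EndObj.flagSum]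
  refine Finset.sum_eq_zero fun C _ => ?_
  rw [EndObj.flagTerm]
  split_ifs
  · have h : ∀ y : flagRadical C, f (EndObj.mk M.V (M.x + y.1)).cls = 0 := fun y => hf _ hc
    simp only [h, avg_const, mul_zero]
  · rfl

theorem exists_glEquiv_map_ne {W : Submodule F (Fin n → F)} (h0 : W ≠ ⊥) (h1 : W ≠ ⊤) :
    ∃ g : GL (Fin n) F, W.map (glEquiv g).toLinearMap ≠ W := by
  obtain ⟨v, hv, hv0⟩ := W.exists_mem_ne_zero_of_ne_bot h0
  obtain ⟨w, hw⟩ : ∃ w, w ∉ W := by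
    by_contra! h
    exact h1 (eq_top_iff.2 fun w _ => h w)
  have hw0 : w ≠ 0 := fun h => hw (h ▸ W.zero_mem)
  obtain ⟨e, he⟩ := Submodule.exists_linearEquiv_map_eq
    (A := Submodule.span F {v}) (B := Submodule.span F {w})
    ((finrank_span_singleton hv0).trans (finrank_span_singleton hw0).symm)
  obtain ⟨g, rfl⟩ := exists_glEquiv_eq e
  refine ⟨g, fun h => hw ?_⟩
  have h2 : w ∈ (Submodule.span F {v}).map (glEquiv g).toLinearMap :=
    he ▸ Submodule.mem_span_singleton_self w
  rw [← h]
  exact Submodule.map_mono ((Submodule.span_singleton_le_iff_mem _ _).2 hv) h2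

theorem ParabolicPair.grpP_ne_top {Q : ParabolicPair F n} (hQ : ∀ i, 0 < (Q.e i).rank)
    (hr : 1 < Q.r) : Q.grpP ≠ ⊤ := by
  intro h
  let i : Fin Q.r := ⟨0, by omega⟩
  let j : Fin Q.r := ⟨1, hr⟩
  have hij : Q.part (Finset.Iic i) < Q.part (Finset.Iic j) :=
    strictMono_part_Iic hQ (Fin.mk_lt_mk.2 zero_lt_one)
  obtain ⟨g, hg⟩ := exists_glEquiv_map_ne (W := Q.part (Finset.Iic i))
    (fun h => (isFlag_flag hQ).bot_notMem ⟨i, h⟩) hij.ne_top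
  exact hg (mem_grpP_iff.1 (h ▸ Subgroup.mem_top g) i)

variable [Fintype F] [DecidableEq F]

theorem ParabolicPair.hcInd_hcRes_of_r_eq_one {Q : ParabolicPair F n} (hr : Q.r = 1)
    (f : InvFun F n) : Q.hcInd (Q.hcRes f) = f := by
  classical
  have hsub : Subsingleton (Fin Q.r) := by rw [hr]; infer_instance
  have he : ∀ i, Q.e i = 1 := fun i => by
    rw [← Q.idem.complete]
    exact (Fintype.sum_subsingleton _ i).symm
  let i : Fin Q.r := ⟨0, by omega⟩
  have hP : ∀ A, A ∈ Q.lieP := fun A a b hab => absurd (Subsingleton.elim a b) hab.ne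
  have hU : ∀ A, A ∈ Q.lieU ↔ A = 0 := fun A => by
    constructor
    · intro h
      have := h i i le_rfl
      rwa [he, mul_one, one_mul] at this
    · rintro rfl
      exact Q.lieU.zero_mem
  have hproj : ∀ A, (Q.proj A).val = A := fun A => by
    change ∑ k, Q.e k * A * Q.e k = A
    rw [Fintype.sum_subsingleton _ i, he, mul_one, one_mul]
  have hG : Q.grpP = ⊤ := eq_top_iff.2 fun g _ => ⟨hP _, hP _⟩
  have hUcard : Nat.card Q.grpU = 1 := by
    rw [card_grpU]
    have : Subsingleton Q.lieU :=
      ⟨fun a b => Subtype.ext (((hU _).1 a.2).trans ((hU _).1 b.2).symm)⟩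
    exact Nat.card_of_subsingleton 0
  have hres : ∀ x, Q.hcRes f x = f.val x.val := fun x => by
    change (Nat.card Q.grpU : ℂ)⁻¹ *
      (∑ y : Matrix (Fin n) (Fin n) F, if y ∈ Q.lieU then f.val (x.val + y) else 0) = _
    simp only [hU, Finset.sum_ite_eq', Finset.mem_univ, if_true, add_zero, hUcard, Nat.cast_one,
      inv_one, one_mul]
  apply Subtype.ext
  funext x
  change (Nat.card Q.grpP : ℂ)⁻¹ * (∑ g : GL (Fin n) F, if g.val * x * g⁻¹.val ∈ Q.lieP then
    Q.hcRes f (Q.proj (g.val * x * g⁻¹.val)) else 0) = _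
  simp only [hP, if_true, hres, hproj, f.2 _ x, Finset.sum_const, Finset.card_univ, hG,
    nsmul_eq_mul]
  rw [Nat.card_congr Subgroup.topEquiv.toEquiv, Nat.card_eq_fintype_card]
  exact inv_mul_cancel_left₀ (by exact_mod_cast Fintype.card_ne_zero) _

theorem duality_of_isPrecuspidal (hn : 0 < n) (χ : DualityChoice F n) {f : InvFun F n}
    (hf : IsPrecuspidal f) : duality χ f = (-1 : ℂ) ^ (n - 1) • f := by
  rw [duality, LinearMap.sum_apply, Finset.sum_eq_single (Composition.single n hn)]
  · have hr : (χ.P (Composition.single n hn)).r = 1 := by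
      obtain ⟨h, -⟩ := χ.hasType (Composition.single n hn)
      rw [h, Composition.single_length]
    have hs := ParabolicPair.ssRank_add
      (ParabolicPair.rank_pos_of_hasType (χ.hasType (Composition.single n hn)))
    rw [LinearMap.smul_apply, LinearMap.comp_apply, ParabolicPair.hcInd_hcRes_of_r_eq_one hr]
    congr 2
    omega
  · intro c _ hc
    obtain ⟨h, -⟩ := χ.hasType c
    have h1 := mt (Composition.eq_single_iff_length hn).2 hc
    have h2 := c.length_pos_of_pos hn
    rw [LinearMap.smul_apply, LinearMap.comp_apply, hf _ (ParabolicPair.grpP_ne_top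
      (ParabolicPair.rank_pos_of_hasType (χ.hasType c)) (by omega)), map_zero, smul_zero]
  · exact fun h => absurd (Finset.mem_univ _) h

theorem duality_zero (χ : DualityChoice F 0) : duality χ = LinearMap.id := by
  refine LinearMap.ext fun f => ?_
  rw [duality_apply, pow_zero, one_smul, LinearMap.id_apply]
  apply Subtype.ext
  funext x
  rw [ofHall_apply, IsoClass.antipode_of_rank_eq_zero _ (rank_cls_std x), toHall_std]

theorem ofHall_hmul {k l : ℕ} {g h : IsoClass F → ℂ} (hg : g ∈ IsoClass.homogeneous F k)
    (hh : h ∈ IsoClass.homogeneous F l) :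
    ofHall F (k + l) (IsoClass.hmul g h) = hcProd (ofHall F k g) (ofHall F l h) := by
  rw [← ofHall_toHall (hcProd _ _), toHall_hcProd, toHall_ofHall hg, toHall_ofHall hh]

theorem duality_hcProd {k l : ℕ} (hk : 0 < k) (hl : 0 < l) (χ : DualityChoice F (k + l))
    (χ₁ : DualityChoice F k) (χ₂ : DualityChoice F l) (f₁ : InvFun F k) (f₂ : InvFun F l) :
    duality χ (hcProd f₁ f₂) = hcProd (duality χ₁ f₁) (duality χ₂ f₂) := by
  have h1 := antipode_mem_homogeneous (toHall_mem f₁)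
  have h2 := antipode_mem_homogeneous (toHall_mem f₂)
  rw [duality_apply, duality_apply, duality_apply, toHall_hcProd,
    IsoClass.antipode_hmul hk hl (toHall_mem f₁) (toHall_mem f₂),
    ← map_smul, ← map_smul, ← map_smul,
    ← ofHall_hmul (Submodule.smul_mem _ _ h1) (Submodule.smul_mem _ _ h2),
    IsoClass.smul_hmul, IsoClass.hmul_smul, smul_smul, pow_add]

variable {m : ℕ}

theorem isDualityFamily_duality (χ : (n : Fin (m + 1)) → DualityChoice F n.val) :
    IsDualityFamily fun n => duality (χ n) where
  zero := duality_zero _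
  comm _ _ h1 h2 _ _ _ := duality_hcProd h1 h2 _ _ _ _ _
  precuspidal n hn _ hf := duality_of_isPrecuspidal hn (χ n) hf

theorem IsDualityFamily.eq {D D' : (n : Fin (m + 1)) → Module.End ℂ (InvFun F n.val)}
    (hD : IsDualityFamily D) (hD' : IsDualityFamily D') (n : ℕ) (hn : n < m + 1) :
    D ⟨n, hn⟩ = D' ⟨n, hn⟩ := by
  induction n using Nat.strong_induction_on with
  | _ n ih =>
    rcases Nat.eq_zero_or_pos n with rfl | hpos
    · exact hD.zero.trans hD'.zero.symm
    · have key := IsoClass.homogeneous_le (F := F) hpos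
        (LinearMap.eqLocus (D ⟨n, hn⟩ ∘ₗ ofHall F n) (D' ⟨n, hn⟩ ∘ₗ ofHall F n))
        (fun p hp hprim => by
          have hc : IsPrecuspidal (ofHall F n p) :=
            isPrecuspidal_of_isPrim (by rwa [toHall_ofHall hp])
          exact (hD.precuspidal ⟨n, hn⟩ hpos _ hc).trans
            (hD'.precuspidal ⟨n, hn⟩ hpos _ hc).symm)
        (fun k l hk hl hkl g hg h hh => by
          subst hkl
          change D ⟨k + l, hn⟩ (ofHall F (k + l) (IsoClass.hmul g h)) =
            D' ⟨k + l, hn⟩ (ofHall F (k + l) (IsoClass.hmul g h))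
          rw [ofHall_hmul hg hh, hD.comm k l hk hl (by omega), hD'.comm k l hk hl (by omega),
            ih k (by omega), ih l (by omega)])
      refine LinearMap.ext fun f => ?_
      have := key (toHall_mem f)
      rw [← ofHall_toHall f]
      exact this

end Duality

theorem mainTheorem9 (𝔽 : Type*) [Field 𝔽] [Fintype 𝔽] [DecidableEq 𝔽] (m : ℕ) (hm : 0 < m) :
    (∃! D : (n : Fin (m + 1)) → Module.End ℂ (InvFun 𝔽 n.val), IsDualityFamily D) ∧
    ∀ D : (n : Fin (m + 1)) → Module.End ℂ (InvFun 𝔽 n.val), IsDualityFamily D →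
      ∀ (n : Fin (m + 1)) (χ : DualityChoice 𝔽 n.val), D n = duality χ := by
  classical
  let χ₀ (n : Fin (m + 1)) : DualityChoice 𝔽 n.val := Classical.choice inferInstance
  constructor
  · exact ⟨_, isDualityFamily_duality χ₀, fun D hD =>
      funext fun n => hD.eq (isDualityFamily_duality χ₀) n.1 n.2⟩
  · intro D hD n χ
    have h : D n = duality (Function.update χ₀ n χ n) :=
      hD.eq (isDualityFamily_duality (Function.update χ₀ n χ)) n.1 n.2
    rwa [Function.update_self] at h
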